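/- **Setting.** Let $k\ge 1$, $0\le d<m$, $T>0$, $0=t_0<t_1<\dots<t_n=T$, let $D\subset\mathbb R^m$ be open and $\varepsilon_0>0$. For $0\le i\le k$ and $1\le j\le n$ let $F_i^j:\mathbb R\times D\to\mathbb R^m$ and $R^j:\mathbb R\times D\times(-\varepsilon_0,\varepsilon_0)\to\mathbb R^m$ be $C^{k+1}$ and $T$-periodic in $t$. Put $F_i(t,x)=\sum_{j}\chi_{[t_{j-1},t_j]}(t)F_i^j(t,x)$, $R(t,x,\varepsilon)=\sum_j\chi_{[t_{j-1},t_j]}(t)R^j(t,x,\varepsilon)$ and consider the $T$-periodic piecewise smooth system $$x'=\sum_{i=0}^k\varepsilon^iF_i(t,x)+\varepsilon^{k+1}R(t,x,\varepsilon),\tag{1}$$ whose solutions are the continuous $D$-valued functions that on each strip $[t_{j-1}+qT,t_j+qT]$ ($q\in\mathbb Z$) solve $x'=\sum_{i=0}^k\varepsilon^iF_i^j(t,x)+\varepsilon^{k+1}R^j(t,x,\varepsilon)$. Write $\mathbb R^m=\mathbb R^d\times\mathbb R^{m-d}\ni(a,b)$, with projections $\pi,\pi^\perp$ onto the two factors.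 Let $V\subset\mathbb R^d$ be open, let $\beta:\overline V\to\mathbb R^{m-d}$ be $C^{k+1}$, and suppose that $z_\alpha=(\alpha,\beta(\alpha))\in D$ for $\alpha\in\overline V$. Assume that for every $\alpha\in\overline V$ the solution of the unperturbed system $x'=F_0(t,x)$ starting at $z_\alpha$ at time $0$ is $T$-periodic. **Averaged functions.** Let $x(t,z,0)$ be the solution of $x'=F_0(t,x)$ on $[0,T]$ with $x(0,z,0)=z$, and let $Y(t,z)$ be the fundamental matrix, with $Y(0,z)=\mathrm{Id}$, of $y'=\frac{\partial F_0}{\partial x}(t,x(t,z,0))\,y$ (all derivatives of the $F_i$ in $x$ are taken strip by strip). For a smooth map $G$, a point $p$, vectors $v_1,\dots,v_r$ and an integer $l\geq 1$ put $$\Phi_{r,l}[G](p;v_1,\dots,v_r)=\sum_{\substack{c\in\mathbb Z_{\ge0}^r\\ c_1+2c_2+\dots+rc_r=l}}\ \prod_{j=1}^r\frac1{c_j!\,(j!)^{c_j}}\ \ \partial^{L}G(p)\bigl(v_1^{c_1},\dots,v_r^{c_r}\bigr),\qquad L=c_1+\dots+c_r,$$ where $v_j^{c_j}$ means that $v_j$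 is repeated $c_j$ times. Define recursively, for $1\le i\le k$, $$y_i(t,z)=i!\,Y(t,z)\int_0^tY(s,z)^{-1}\Bigl(F_i+\Phi_{i-1,i}[F_0](\,\cdot\,;y_1,\dots,y_{i-1})+\sum_{l=1}^{i-1}\Phi_{l,l}[F_{i-l}](\,\cdot\,;y_1,\dots,y_l)\Bigr)ds,$$ where $F_i$ and the derivatives in $x$ of $F_0,F_{i-l}$ are evaluated at $(s,x(s,z,0))$ and the $y_j$ at $(s,z)$. Put $$g_0(z)=Y(T,z)^{-1}\bigl(x(T,z,0)-z\bigr),\qquad g_i(z)=Y(T,z)^{-1}\,\frac{y_i(T,z)}{i!}\quad(1\le i\le k).$$ **Bifurcation functions.** Let $\Delta_\alpha$ be the lower right $(m-d)\times(m-d)$ block of $\mathrm{Id}-Y(T,z_\alpha)^{-1}$, and assume $\det\Delta_\alpha\ne0$ for every $\alpha\in\overline V$. With all derivatives taken in $b$ at $b=\beta(\alpha)$, put for $1\le i\le k$ $$\gamma_i(\alpha)=-i!\,\Delta_\alpha^{-1}\Bigl(\pi^\perp g_i(z_\alpha)+\Phi_{i-1,i}[\pi^\perp g_0(\alpha,\cdot)](\beta(\alpha);\gamma_1,\dots,\gamma_{i-1})+\sum_{l=1}^{i-1}\Phi_{l,l}[\pi^\perp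 g_{i-l}(\alpha,\cdot)](\beta(\alpha);\gamma_1,\dots,\gamma_l)\Bigr),$$ $$f_i(\alpha)=\pi g_i(z_\alpha)+\sum_{l=1}^{i}\Phi_{l,l}[\pi g_{i-l}(\alpha,\cdot)](\beta(\alpha);\gamma_1,\dots,\gamma_l),$$ where the $\gamma_j$ are evaluated at $\alpha$. **Theorem.** Assume that $f_1=\dots=f_{k-1}=0$ on $\overline V$ and that there is $\alpha^*\in V$ with $f_k(\alpha^*)=0$ and $\det Df_k(\alpha^*)\ne0$. Then for all sufficiently small $|\varepsilon|$ system (1) has a $T$-periodic solution $\varphi(\cdot,\varepsilon)$, and these satisfy $|\varphi(0,\varepsilon)-z_{\alpha^*}|=O(\varepsilon)$ as $\varepsilon\to0$. -/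

import Mathlib

open Set Filter Topology Asymptotics
open scoped Nat

/-! ### Faà di Bruno type sums -/

/-- The `r`-tuples `(c_1, …, c_r)` of non-negative integers with
`c_1 + 2 c_2 + ⋯ + r c_r = l` (entry `j : Fin r` is `c_{j+1}`). -/
def weightedTuples (r l : ℕ) : Finset (Fin r → ℕ) :=
  (Fintype.piFinset fun _ => Finset.range (l + 1)).filter
    fun c => ∑ j : Fin r, ((j : ℕ) + 1) * c j = l

theorem mem_weightedTuples {r l : ℕ} {c : Fin r → ℕ} :
    c ∈ weightedTuples r l ↔ ∑ j : Fin r, ((j : ℕ) + 1) * c j = l := by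
  simp only [weightedTuples, Finset.mem_filter, Fintype.mem_piFinset, Finset.mem_range,
    and_iff_right_iff_imp]
  intro h j
  have h1 : ((j : ℕ) + 1) * c j ≤ ∑ i : Fin r, ((i : ℕ) + 1) * c i :=
    Finset.single_le_sum (f := fun i : Fin r => ((i : ℕ) + 1) * c i)
      (fun _ _ => Nat.zero_le _) (Finset.mem_univ j)
  have h2 : c j ≤ ((j : ℕ) + 1) * c j := Nat.le_mul_of_pos_left _ (Nat.succ_pos _)
  omega

/-- The list in which `v_1` is repeated `c_1` times, then `v_2` is repeated `c_2` times, and so on;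
its length is `c_1 + ⋯ + c_r`. -/
def repeatedVectors {X : Type*} {r : ℕ} (c : Fin r → ℕ) (v : Fin r → X) : List X :=
  (List.finRange r).flatMap fun j => List.replicate (c j) (v j)

/-- `∑_c 1 / (c_1! c_2! 2!^{c_2} ⋯ c_r! r!^{c_r}) ∂^L G(x) (v_1^{c_1}, …, v_r^{c_r})`, where `c` runs
over the `r`-tuples with `c_1 + 2 c_2 + ⋯ + r c_r = l`, and `L = c_1 + ⋯ + c_r`. -/
noncomputable def faaDiBrunoSum {X W : Type*} [NormedAddCommGroup X] [NormedSpace ℝ X]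
    [NormedAddCommGroup W] [NormedSpace ℝ W] (r l : ℕ) (G : X → W) (x : X) (v : Fin r → X) : W :=
  ∑ c ∈ weightedTuples r l,
    (1 / ∏ j : Fin r, (((c j)! : ℝ) * ((((j : ℕ) + 1)! : ℕ) : ℝ) ^ c j)) •
      iteratedFDeriv ℝ (repeatedVectors c v).length G x (repeatedVectors c v).get

/-! ### Piecewise smooth periodic systems -/

/-- The data of a `T`-periodic system `x' = ∑_{i ≤ k} ε^i F_i(t, x) + ε^{k+1} R(t, x, ε)` that is
given by functions `F_i^j`, `R^j` of class `C^{k+1}` on the `j`-th of the `n` time strips into which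
`0 = t_0 < t_1 < ⋯ < t_n = T` divides the period. Here `F i j` is `F_i^{j+1}`, with `j : Fin n`, and
only the indices `i ≤ k` matter. -/
structure PiecewiseSystem (E : Type*) [NormedAddCommGroup E] [NormedSpace ℝ E] (n k : ℕ) where
  T : ℝ
  T_pos : 0 < T
  t : Fin (n + 1) → ℝ
  t_strictMono : StrictMono t
  t_zero : t 0 = 0
  t_last : t (Fin.last n) = T
  D : Set E
  isOpen_D : IsOpen D
  ε₀ : ℝ
  ε₀_pos : 0 < ε₀
  F : ℕ → Fin n → ℝ → E → E
  R : Fin n → ℝ → E → ℝ → E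
  contDiffOn_F : ∀ i ≤ k, ∀ j,
    ContDiffOn ℝ ((k + 1 : ℕ) : WithTop ℕ∞) (fun p : ℝ × E => F i j p.1 p.2) (univ ×ˢ D)
  contDiffOn_R : ∀ j,
    ContDiffOn ℝ ((k + 1 : ℕ) : WithTop ℕ∞) (fun p : ℝ × E × ℝ => R j p.1 p.2.1 p.2.2)
      (univ ×ˢ D ×ˢ Ioo (-ε₀) ε₀)
  periodic_F : ∀ i ≤ k, ∀ j, ∀ s, ∀ x ∈ D, F i j (s + T) x = F i j s x
  periodic_R : ∀ j, ∀ s, ∀ x ∈ D, ∀ ε ∈ Ioo (-ε₀) ε₀, R j (s + T) x ε = R j s x ε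

namespace PiecewiseSystem

variable {E : Type*} [NormedAddCommGroup E] [NormedSpace ℝ E] {n k : ℕ}

/-- The `j`-th closed time strip `[t_{j-1}, t_j]`, moved by `q` periods. -/
def strip (S : PiecewiseSystem E n k) (q : ℤ) (j : Fin n) : Set ℝ :=
  Icc (S.t j.castSucc + q * S.T) (S.t j.succ + q * S.T)

/-- The right-hand side `∑_{i ≤ k} ε^i F_i^j(s, x) + ε^{k+1} R^j(s, x, ε)` on the `j`-th strip. -/
def field (S : PiecewiseSystem E n k) (ε : ℝ) (j : Fin n) (s : ℝ) (x : E) : E :=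
  ∑ i ∈ Finset.range (k + 1), ε ^ i • S.F i j s x + ε ^ (k + 1) • S.R j s x ε

/-- The piecewise smooth function `F_i(s, x) = ∑_j χ_{[t_{j-1}, t_j]}(s) F_i^j(s, x)`. -/
noncomputable def piecewiseF (S : PiecewiseSystem E n k) (i : ℕ) (s : ℝ) (x : E) : E :=
  ∑ j, (S.strip 0 j).indicator (fun r => S.F i j r x) s

/-- `x` solves, during the `q`-th period, the system whose right-hand side on the `j`-th strip is
`G j`. Trajectories cross the discontinuity set `{t = t_j}` transversally, so a solution is the
continuous concatenation of solutions on the closed strips. -/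
def IsSolutionOnPeriod (S : PiecewiseSystem E n k) (G : Fin n → ℝ → E → E) (q : ℤ)
    (x : ℝ → E) : Prop :=
  ∀ j, ∀ s ∈ S.strip q j, x s ∈ S.D ∧ HasDerivWithinAt x (G j s (x s)) (S.strip q j) s

/-- `x` is a `T`-periodic solution, defined on all of `ℝ`. -/
def IsPeriodicSolution (S : PiecewiseSystem E n k) (G : Fin n → ℝ → E → E) (x : ℝ → E) : Prop :=
  Function.Periodic x S.T ∧ ∀ q : ℤ, S.IsSolutionOnPeriod G q x

/-- The solution `s ↦ x(s, z, 0)` on `[0, T]` of the unperturbed system `x' = F_0(s, x)` with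
`x(0, z, 0) = z` (unique on `[0, T]` where it exists). -/
noncomputable def unperturbed (S : PiecewiseSystem E n k) (z : E) : ℝ → E :=
  Classical.epsilon fun x => x 0 = z ∧ S.IsSolutionOnPeriod (S.F 0) 0 x

/-- The fundamental matrix `s ↦ Y(s, z)` on `[0, T]`, with `Y(0, z) = Id`, of the variational
equation `y' = ∂F_0/∂x (s, x(s, z, 0)) y`. -/
noncomputable def fundamental (S : PiecewiseSystem E n k) (z : E) : ℝ → E →L[ℝ] E :=
  Classical.epsilon fun Y => Y 0 = ContinuousLinearMap.id ℝ E ∧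
    ∀ j, ∀ s ∈ S.strip 0 j,
      HasDerivWithinAt Y ((fderiv ℝ (S.F 0 j s) (S.unperturbed z s)).comp (Y s)) (S.strip 0 j) s

/-- The functions `y_i(τ, z)`, `i ≥ 1`:
`y_i(τ, z) = i! Y(τ, z) ∫_0^τ Y(s, z)⁻¹ (F_i + ∑_{S'_i} … ∂^{I'} F_0 (y_1^{b_1}, …, y_{i-1}^{b_{i-1}})
  + ∑_{l=1}^{i-1} ∑_{S_l} … ∂^L F_{i-l} (y_1^{b_1}, …, y_l^{b_l})) ds`. -/
noncomputable def yFun (S : PiecewiseSystem E n k) (z : E) (i : ℕ) (τ : ℝ) : E :=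
  (i ! : ℝ) • S.fundamental z τ (∫ s in (0 : ℝ)..τ,
    (S.fundamental z s).inverse
      (S.piecewiseF i s (S.unperturbed z s)
        + faaDiBrunoSum (i - 1) i (S.piecewiseF 0 s) (S.unperturbed z s)
            (fun j : Fin (i - 1) => yFun S z (j + 1) s)
        + ∑ l : Fin (i - 1),
            faaDiBrunoSum (l + 1) (l + 1) (S.piecewiseF (i - (l + 1)) s) (S.unperturbed z s)
              (fun j : Fin (l + 1) => yFun S z (j + 1) s)))
termination_by i
decreasing_by all_goals omega

/-- The averaged functions `g_0(z) = Y(T, z)⁻¹ (x(T, z, 0) - z)` and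
`g_i(z) = Y(T, z)⁻¹ y_i(T, z) / i!` for `i ≥ 1`. -/
noncomputable def averaged (S : PiecewiseSystem E n k) (i : ℕ) (z : E) : E :=
  if i = 0 then (S.fundamental z S.T).inverse (S.unperturbed z S.T - z)
  else (S.fundamental z S.T).inverse ((1 / (i ! : ℝ)) • S.yFun z i S.T)

end PiecewiseSystem

/-! ### Bifurcation functions of the Lyapunov–Schmidt reduction -/

section LyapunovSchmidt

variable {A B : Type*} [NormedAddCommGroup A] [NormedSpace ℝ A]
  [NormedAddCommGroup B] [NormedSpace ℝ B]

/-- The lower right block `B → B` of a linear operator on `A × B`. -/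
def lowerRightBlock (M : (A × B) →L[ℝ] (A × B)) : B →L[ℝ] B :=
  (ContinuousLinearMap.snd ℝ A B).comp (M.comp (ContinuousLinearMap.inr ℝ A B))

/-- The functions `γ_i(α)`, `i ≥ 1`, with `z_α = (α, β α)`:
`γ_i = - i! Δ_α⁻¹ (π^⊥ g_i(z_α) + ∑_{S'_i} … ∂_b^{I'} π^⊥ g_0(z_α) (γ_1^{c_1}, …, γ_{i-1}^{c_{i-1}})
  + ∑_{l=1}^{i-1} ∑_{S_l} … ∂_b^L π^⊥ g_{i-l}(z_α) (γ_1^{c_1}, …, γ_l^{c_l}))`. -/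
noncomputable def gammaFun (g : ℕ → A × B → A × B) (Δ : A → B →L[ℝ] B) (β : A → B)
    (i : ℕ) (α : A) : B :=
  -((i ! : ℝ) • (Δ α).inverse
    ((g i (α, β α)).2
      + faaDiBrunoSum (i - 1) i (fun b => (g 0 (α, b)).2) (β α)
          (fun j : Fin (i - 1) => gammaFun g Δ β (j + 1) α)
      + ∑ l : Fin (i - 1),
          faaDiBrunoSum (l + 1) (l + 1) (fun b => (g (i - (l + 1)) (α, b)).2) (β α)
            (fun j : Fin (l + 1) => gammaFun g Δ β (j + 1) α)))
termination_by i
decreasing_by all_goals omega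

/-- The bifurcation function of order `i`:
`f_i(α) = π g_i(z_α) + ∑_{l=1}^{i} ∑_{S_l} … ∂_b^L π g_{i-l}(z_α) (γ_1^{c_1}, …, γ_l^{c_l})`. -/
noncomputable def bifurcationFun (g : ℕ → A × B → A × B) (Δ : A → B →L[ℝ] B) (β : A → B)
    (i : ℕ) (α : A) : A :=
  (g i (α, β α)).1
    + ∑ l : Fin i,
        faaDiBrunoSum (l + 1) (l + 1) (fun b => (g (i - (l + 1)) (α, b)).1) (β α)
          (fun j : Fin (l + 1) => gammaFun g Δ β (j + 1) α)

namespace PiecewiseSystem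

variable {n k : ℕ}

/-- `Δ_α`, the lower right block of `Id - Y(T, z_α)⁻¹`. -/
noncomputable def Delta (S : PiecewiseSystem (A × B) n k) (β : A → B) (α : A) : B →L[ℝ] B :=
  lowerRightBlock
    (ContinuousLinearMap.id ℝ (A × B) - (S.fundamental (α, β α) S.T).inverse)

/-- The bifurcation function `f_i` of the piecewise smooth system. -/
noncomputable def bifurcation (S : PiecewiseSystem (A × B) n k) (β : A → B) (i : ℕ) : A → A :=
  bifurcationFun S.averaged (S.Delta β) β i

end PiecewiseSystem

end LyapunovSchmidt

-- A T-periodic solution corresponds to a zero of the displacement x(T, z, ε) - z. The right-hand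
-- sides jump in t, but only at fixed times, so the initial value problem on [0, T] is a fixed point
-- equation u = z + ∑_j ∫_0^t χ_j f_j(s, u, ε) ds in C([0, T], E). Its right side is C^{k+1} in (z,
-- ε, u): superposition operators inherit smoothness (`contDiffOn_nemytskii`), and the integrals are
-- continuous linear maps. The derivative in u is a Volterra operator V with 1 - V invertible
-- (`isUnit_one_sub_volterra`), so the implicit function theorem makes the flow a C^{k+1} function
-- of (z, ε) with values in C([0, T], E) (`IsFlow.exists_contDiffAt`).
--
-- Dividing by ε repeatedly (`ContDiffAt.exists_partial_expansion`) gives the flow as ∑ ε^i c_i(z) +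
-- o(ε^k) with c_i of class C^{k+1-i}. Coefficients of such expansions are unique
-- (`coeff_eq_zero_of_isLittleO`). Inserting the expansion into the integral equation yields for c_i
-- a linear equation whose inhomogeneity is the Faà di Bruno expression in the lower c_l, and
-- variation of constants gives y_i = i! c_i (`yFun_eq_coeff`). Hence the displacement is Y(T, z) ∑
-- ε^i g_i(z) + o(ε^k) for every z near z_{α*}.
--
-- The γ_i are chosen so that along b_α(ε) = β(α) + ∑ ε^j γ_j(α) / j! the π^⊥ part of ∑ ε^i g_i is
-- o(ε^k), while the π part is ε^k f_k(α) + o(ε^k) (`sum_isLittleO_bifurcationFun`).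
-- `ContDiffAt.exists_lyapunovSchmidt` turns these approximate curves into an exact reduction. It
-- applies the constant matrix Y(T, z_{α*})⁻¹ to the displacement, solves "second component = w" for
-- b, which is possible as Δ is invertible, and calls the first component Θ(α, ε, w). On the
-- approximate curve w = O(ε^k), and comparison with w = 0 gives Θ(α, ε, 0) = ε^k C(α) f_k(α) +
-- o(ε^k), where C is continuous at α* and C(α*) = Id. After division by ε^k the simple zero α*
-- continues to a C^1 branch (`ContDiffAt.exists_zero_branch`), and differentiability of the branch
-- at ε = 0 gives the bound O(ε).

universe u

/-! ### Symmetry of higher derivatives. -/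

section Symmetry

variable {X W : Type*} [NormedAddCommGroup X] [NormedSpace ℝ X]
  [NormedAddCommGroup W] [NormedSpace ℝ W]

theorem ContDiffAt.differentiableAt_iteratedFDeriv_real {n : ℕ} {G : X → W} {x : X}
    (hG : ContDiffAt ℝ ((n + 1 : ℕ) : WithTop ℕ∞) G x) :
    DifferentiableAt ℝ (iteratedFDeriv ℝ n G) x :=
  (hG.iteratedFDeriv_right (m := 1) (i := n) (by
    push_cast; rw [add_comm])).differentiableAt (by simp)

/-- Swapping the first two slots is the symmetry of the second derivative of `iteratedFDeriv ℝ n G`.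
Any other adjacent swap leaves the first slot alone, and there one differentiates the identity of
one order less. Adjacent swaps generate all permutations. -/
theorem iteratedFDeriv_comp_swap_castSucc_succ (n : ℕ) :
    ∀ {G : X → W} {x : X}, ContDiffAt ℝ ((n + 1 : ℕ) : WithTop ℕ∞) G x → ∀ (i : Fin n)
      (v : Fin (n + 1) → X),
      iteratedFDeriv ℝ (n + 1) G x (v ∘ Equiv.swap i.castSucc i.succ) =
        iteratedFDeriv ℝ (n + 1) G x v := by
  induction n with
  | zero => intro G x _ i; exact i.elim0
  | succ n ih =>
    intro G x hG i v
    refine Fin.cases ?_ (fun i => ?_) i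
    · have h2 : ContDiffAt ℝ 2 (iteratedFDeriv ℝ n G) x :=
        hG.iteratedFDeriv_right (m := 2) (i := n) (by
          push_cast; rw [add_assoc, add_comm]; norm_num)
      have hs := h2.isSymmSndFDerivAt (by simp)
      -- The first two slots are peeled off as a second derivative of the n-th derivative.
      have key : ∀ w : Fin (n + 2) → X, iteratedFDeriv ℝ (n + 2) G x w =
          (fderiv ℝ (fderiv ℝ (iteratedFDeriv ℝ n G)) x (w 0) (w 1)) (Fin.tail (Fin.tail w)) := by
        intro w
        rw [iteratedFDeriv_succ_apply_left]
        have e1 : HasFDerivAt (fun y => iteratedFDeriv ℝ (n + 1) G y (Fin.tail w))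
            ((ContinuousMultilinearMap.apply ℝ (fun _ : Fin (n + 1) => X) W (Fin.tail w)).comp
              (fderiv ℝ (iteratedFDeriv ℝ (n + 1) G) x)) x :=
          (ContinuousMultilinearMap.apply ℝ (fun _ : Fin (n + 1) => X) W
            (Fin.tail w)).hasFDerivAt.comp x
            (ContDiffAt.differentiableAt_iteratedFDeriv_real hG).hasFDerivAt
        have hd : HasFDerivAt (fderiv ℝ (iteratedFDeriv ℝ n G))
            (fderiv ℝ (fderiv ℝ (iteratedFDeriv ℝ n G)) x) x :=
          ((h2.fderiv_right (m := 1) (by norm_num)).differentiableAt (by simp)).hasFDerivAt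
        have e2 := (hd.clm_apply (hasFDerivAt_const (w 1) x)).continuousMultilinear_apply_const
          (Fin.tail (Fin.tail w))
        have e3 := congrArg (fun T : X →L[ℝ] W => T (w 0)) (e1.unique e2)
        simpa using e3
      rw [key, key]
      have h0 : (v ∘ Equiv.swap (Fin.castSucc (0 : Fin (n + 1))) (Fin.succ 0)) 0 = v 1 := by
        simp
      have h1 : (v ∘ Equiv.swap (Fin.castSucc (0 : Fin (n + 1))) (Fin.succ 0)) 1 = v 0 := by
        simp
      have h2 : Fin.tail (Fin.tail (v ∘ Equiv.swap (Fin.castSucc (0 : Fin (n + 1))) (Fin.succ 0)))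
          = Fin.tail (Fin.tail v) := by
        funext j
        simp only [Fin.tail, Function.comp]
        rw [Equiv.swap_apply_of_ne_of_ne]
        · simp [Fin.ext_iff]
        · simp [Fin.ext_iff]
      rw [h0, h1, h2, hs]
    · rw [iteratedFDeriv_succ_apply_left, iteratedFDeriv_succ_apply_left]
      have h0 : (v ∘ Equiv.swap (Fin.castSucc i.succ) (Fin.succ i.succ)) 0 = v 0 := by
        simp only [Function.comp]
        rw [Equiv.swap_apply_of_ne_of_ne]
        · simp [Fin.ext_iff]
        · simp [Fin.ext_iff]
      have ht : Fin.tail (v ∘ Equiv.swap (Fin.castSucc i.succ) (Fin.succ i.succ)) =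
          Fin.tail v ∘ Equiv.swap i.castSucc i.succ := by
        funext j
        simp only [Fin.tail, Function.comp, ← Fin.succ_castSucc]
        congr 1
        exact (Function.Injective.map_swap (Fin.succ_injective _) _ _ _).symm
      rw [h0, ht]
      -- The induction hypothesis is needed at all nearby points, since it is differentiated at `x`.
      have hev : ∀ᶠ y in 𝓝 x, ∀ w : Fin (n + 1) → X,
          iteratedFDeriv ℝ (n + 1) G y (w ∘ Equiv.swap i.castSucc i.succ) =
            iteratedFDeriv ℝ (n + 1) G y w := by
        have := (hG.of_le (by norm_cast; omega : ((n + 1 : ℕ) : WithTop ℕ∞) ≤ ((n + 1 + 1 : ℕ) : WithTop ℕ∞))).eventually (by simp)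
        filter_upwards [this] with y hy w
        exact ih hy i w
      have hd := ContDiffAt.differentiableAt_iteratedFDeriv_real hG
      have e1 : ∀ w : Fin (n + 1) → X, HasFDerivAt (fun y => iteratedFDeriv ℝ (n + 1) G y w)
          ((ContinuousMultilinearMap.apply ℝ (fun _ : Fin (n + 1) => X) W w).comp
            (fderiv ℝ (iteratedFDeriv ℝ (n + 1) G) x)) x := fun w =>
        (ContinuousMultilinearMap.apply ℝ (fun _ : Fin (n + 1) => X) W w).hasFDerivAt.comp x
          hd.hasFDerivAt
      have e2 := (e1 (Fin.tail v ∘ Equiv.swap i.castSucc i.succ)).congr_of_eventuallyEq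
        (f₁ := fun y => iteratedFDeriv ℝ (n + 1) G y (Fin.tail v))
        (by filter_upwards [hev] with y hy using (hy _).symm)
      have := congrArg (fun T : X →L[ℝ] W => T (v 0)) (e2.unique (e1 (Fin.tail v)))
      simpa using this

/-- The iterated derivative of order `n` of a `C^n` function is symmetric. -/
theorem ContDiffAt.iteratedFDeriv_comp_perm_real {n : ℕ} {G : X → W} {x : X}
    (hG : ContDiffAt ℝ (n : WithTop ℕ∞) G x) (v : Fin n → X) (σ : Equiv.Perm (Fin n)) :
    iteratedFDeriv ℝ n G x (v ∘ σ) = iteratedFDeriv ℝ n G x v := by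
  obtain _ | n := n
  · congr 1
    exact Subsingleton.elim _ _
  have hσ : σ ∈ Submonoid.closure
      (Set.range fun i : Fin n => Equiv.swap i.castSucc i.succ) := by
    rw [Equiv.Perm.mclosure_swap_castSucc_succ]; trivial
  induction hσ using Submonoid.closure_induction generalizing v with
  | mem σ hσ =>
    obtain ⟨i, rfl⟩ := hσ
    exact iteratedFDeriv_comp_swap_castSucc_succ n hG i v
  | one => rfl
  | mul σ τ _ _ h1 h2 =>
    have : v ∘ ⇑(σ * τ) = (v ∘ σ) ∘ τ := rfl
    rw [this, h2, h1]

/-- Turns a permutation of lists into a reindexing of slots, so that symmetry under permutations of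
`Fin n` can be used for lists whose lengths agree only propositionally. -/
theorem List.Perm.exists_equiv_get {α : Type*} {l₁ l₂ : List α} (h : l₁.Perm l₂) :
    ∃ e : Fin l₁.length ≃ Fin l₂.length, l₁.get = l₂.get ∘ e := by
  induction h with
  | nil => exact ⟨Equiv.refl _, rfl⟩
  | cons a _ ih =>
    obtain ⟨e, he⟩ := ih
    refine ⟨(finSuccEquiv _).trans ((Equiv.optionCongr e).trans (finSuccEquiv _).symm), ?_⟩
    funext i
    refine Fin.cases ?_ (fun i => ?_) i
    · rfl
    · simpa using congrFun he i
  | swap a b l =>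
    refine ⟨Equiv.swap (0 : Fin (l.length + 2)) 1, ?_⟩
    funext i
    refine Fin.cases ?_ (fun i => Fin.cases ?_ (fun i => ?_) i) i
    · have : Equiv.swap (0 : Fin (l.length + 2)) 1 0 = 1 := Equiv.swap_apply_left _ _
      simp only [Function.comp]
      erw [this]
      rfl
    · have : Equiv.swap (0 : Fin (l.length + 2)) 1 1 = 0 := Equiv.swap_apply_right _ _
      simp only [Function.comp]
      erw [this]
      rfl
    · have : Equiv.swap (0 : Fin (l.length + 2)) 1 i.succ.succ = i.succ.succ := by
        apply Equiv.swap_apply_of_ne_of_ne <;> simp [Fin.ext_iff]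
      simp only [Function.comp]
      erw [this]
      rfl
  | trans _ _ ih₁ ih₂ =>
    obtain ⟨e, he⟩ := ih₁
    obtain ⟨e', he'⟩ := ih₂
    exact ⟨e.trans e', by rw [he, he']; rfl⟩

/-- The value of the iterated derivative on a list of vectors does not depend on their order. -/
theorem ContDiffAt.iteratedFDeriv_get_perm {G : X → W} {x : X} {l₁ l₂ : List X}
    (hG : ContDiffAt ℝ (l₂.length : WithTop ℕ∞) G x) (h : l₁.Perm l₂) :
    iteratedFDeriv ℝ l₁.length G x l₁.get = iteratedFDeriv ℝ l₂.length G x l₂.get := by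
  obtain ⟨e, he⟩ := h.exists_equiv_get
  have key : ∀ (n : ℕ) (e : Fin n ≃ Fin l₂.length),
      iteratedFDeriv ℝ n G x (l₂.get ∘ e) = iteratedFDeriv ℝ l₂.length G x l₂.get := by
    intro n e
    obtain rfl : n = l₂.length := by simpa using Fintype.card_congr e
    exact hG.iteratedFDeriv_comp_perm_real _ e
  rw [he, key]

end Symmetry

/-! ### Counting maps by the sizes of their fibres. -/

section Counting

/-- In the polynomial ring, expand (∑ X_j)^p once as a sum over maps and once by the multinomial
theorem. Then apply the linear map that sends the monomial X^c to `g c`. -/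
theorem Fintype.sum_fun_eq_sum_piAntidiag {ι W : Type*} [Fintype ι] [DecidableEq ι]
    [AddCommMonoid W] (p : ℕ) (g : (ι → ℕ) → W) :
    ∑ f : Fin p → ι, g (fun j => Fintype.card {i // f i = j}) =
      ∑ c ∈ Finset.piAntidiag Finset.univ p, Nat.multinomial Finset.univ c • g c := by
  have h1 := Fintype.sum_pow (fun j : ι => (MvPolynomial.X j : MvPolynomial ι ℕ)) p
  rw [Finset.sum_pow_eq_sum_piAntidiag] at h1
  have h2 := congrArg ((MvPolynomial.basisMonomials ι ℕ).constr ℕ (fun s => g s)) h1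
  rw [map_sum, map_sum] at h2
  have hm : ∀ c : ι → ℕ, (MvPolynomial.basisMonomials ι ℕ).constr ℕ (fun s => g s)
      (∏ j, MvPolynomial.X j ^ c j) = g c := by
    intro c
    have : (∏ j, (MvPolynomial.X j : MvPolynomial ι ℕ) ^ c j) =
        MvPolynomial.basisMonomials ι ℕ (Finsupp.equivFunOnFinite.symm c) := by
      rw [MvPolynomial.coe_basisMonomials]
      beta_reduce
      rw [MvPolynomial.monomial_eq, Finsupp.prod_fintype _ _ (by simp)]
      simp
    rw [this, Module.Basis.constr_basis]
    rfl
  symm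
  convert h2 using 2 with c _ f _
  · rw [← nsmul_eq_mul, map_nsmul, hm]
  · rw [← hm]
    congr 1
    rw [← Finset.prod_fiberwise_of_maps_to (s := Finset.univ) (t := Finset.univ) (g := f)
      (fun _ _ => Finset.mem_univ _)]
    refine Finset.prod_congr rfl fun j _ => ?_
    rw [Finset.prod_congr rfl (g := fun _ => MvPolynomial.X j) (by
      intro i hi; rw [(Finset.mem_filter.1 hi).2]), Finset.prod_const, Fintype.card_subtype]

theorem count_repeatedVectors_id {r : ℕ} (c : Fin r → ℕ) (a : Fin r) :
    (repeatedVectors c id).count a = c a := by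
  simp only [repeatedVectors, List.count_flatMap, Function.comp_def, List.count_replicate, id]
  rw [← List.ofFn_eq_map, List.sum_ofFn]
  simp

theorem map_repeatedVectors_id {Y : Type*} {r : ℕ} (c : Fin r → ℕ) (w : Fin r → Y) :
    (repeatedVectors c id).map w = repeatedVectors c w := by
  simp [repeatedVectors, List.map_flatMap]

theorem perm_ofFn_repeatedVectors {Y : Type*} {p r : ℕ} (f : Fin p → Fin r) (w : Fin r → Y) :
    (List.ofFn (w ∘ f)).Perm
      (repeatedVectors (fun j => Fintype.card {i // f i = j}) w) := by
  -- Multiplicities are compared for the lists of indices, because `w` need not be injective;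
  -- mapping by `w` comes afterwards.
  have h : (List.ofFn f).Perm (repeatedVectors (fun j => Fintype.card {i // f i = j}) id) := by
    rw [List.perm_iff_count]
    intro a
    rw [count_repeatedVectors_id, List.ofFn_eq_map, List.count, List.countP_map]
    simp [Fintype.card_subtype, Finset.filter, Fin.univ_def, Function.comp_def,
      List.countP_eq_length_filter]
    rfl
  have h2 := h.map w
  rwa [map_repeatedVectors_id, List.map_ofFn] at h2

end Counting

/-! ### Taylor's formula with Peano remainder, and uniqueness of coefficients. -/

section Taylor

/-- Along the segment from `x` to `x + u`, the remainder of order `L + 1` has as derivative the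
remainder of order `L` of `fderiv ℝ G`, applied to `u`; the mean value inequality then closes the
induction. The codomain varies because it becomes `X →L[ℝ] W`, which is also why `X` and `W` share a
universe. -/
theorem ContDiffAt.taylor_isLittleO {X : Type u} [NormedAddCommGroup X] [NormedSpace ℝ X] (L : ℕ) :
    ∀ {W : Type u} [NormedAddCommGroup W] [NormedSpace ℝ W] {G : X → W} {x : X},
      ContDiffAt ℝ (L : WithTop ℕ∞) G x →
      (fun u => G (x + u) - ∑ p ∈ Finset.range (L + 1),
        (1 / (p ! : ℝ)) • iteratedFDeriv ℝ p G x (fun _ => u)) =o[𝓝 0] fun u => ‖u‖ ^ L := by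
  induction L with
  | zero =>
    intro W _ _ G x hG
    simp only [zero_add, Finset.range_one, Finset.sum_singleton, pow_zero, isLittleO_one_iff,
      iteratedFDeriv_zero_apply, Nat.factorial_zero, Nat.cast_one, div_one, one_smul]
    have h : Tendsto (fun u => G (x + u)) (𝓝 0) (𝓝 (G x)) := by
      have : Tendsto (fun u : X => x + u) (𝓝 0) (𝓝 x) :=
        Continuous.tendsto' (by fun_prop) _ _ (by simp)
      exact hG.continuousAt.tendsto.comp this
    simpa using h.sub_const (G x)
  | succ L ih =>
    intro W _ _ G x hG
    have hG' : ContDiffAt ℝ (L : WithTop ℕ∞) (fderiv ℝ G) x :=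
      hG.fderiv_right (by push_cast; exact le_rfl)
    have h1 := ih hG'
    rw [isLittleO_iff] at h1 ⊢
    intro C hC
    have hd : ∀ᶠ y in 𝓝 x, DifferentiableAt ℝ G y := by
      filter_upwards [hG.eventually (by simp)] with y hy
      exact hy.differentiableAt (by simp)
    have hd' : ∀ᶠ u in 𝓝 (0 : X), DifferentiableAt ℝ G (x + u) := by
      have : Tendsto (fun u : X => x + u) (𝓝 0) (𝓝 x) :=
        Continuous.tendsto' (by fun_prop) _ _ (by simp)
      exact this.eventually hd
    obtain ⟨δ, hδ, hball⟩ := Metric.eventually_nhds_iff_ball.1 ((h1 hC).and hd')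
    refine Metric.eventually_nhds_iff_ball.2 ⟨δ, hδ, fun u hu => ?_⟩
    have hsu : ∀ s ∈ Icc (0 : ℝ) 1, s • u ∈ Metric.ball (0 : X) δ := by
      intro s hs
      rw [mem_ball_zero_iff] at hu ⊢
      rw [norm_smul, Real.norm_eq_abs, abs_of_nonneg hs.1]
      exact lt_of_le_of_lt (mul_le_of_le_one_left (norm_nonneg _) hs.2) hu
    let q : ℝ → W := fun s => G (x + s • u) - ∑ p ∈ Finset.range (L + 2),
        (s ^ p / (p ! : ℝ)) • iteratedFDeriv ℝ p G x (fun _ => u)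
    let q' : ℝ → W := fun s => (fderiv ℝ G (x + s • u) - ∑ p ∈ Finset.range (L + 1),
        (1 / (p ! : ℝ)) • iteratedFDeriv ℝ p (fderiv ℝ G) x (fun _ => s • u)) u
    have hq : ∀ s ∈ Icc (0 : ℝ) 1, HasDerivWithinAt q (q' s) (Icc 0 1) s := by
      intro s hs
      apply HasDerivAt.hasDerivWithinAt
      have ha : HasDerivAt (fun s : ℝ => G (x + s • u)) (fderiv ℝ G (x + s • u) u) s := by
        have h2 : HasDerivAt (fun s : ℝ => x + s • u) u s := by
          simpa using ((hasDerivAt_id s).smul_const u).const_add x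
        exact (hball _ (hsu s hs)).2.hasFDerivAt.comp_hasDerivAt s h2
      have hb : HasDerivAt (fun s : ℝ => ∑ p ∈ Finset.range (L + 2),
          (s ^ p / (p ! : ℝ)) • iteratedFDeriv ℝ p G x (fun _ => u))
          ((∑ p ∈ Finset.range (L + 1),
            (1 / (p ! : ℝ)) • iteratedFDeriv ℝ p (fderiv ℝ G) x (fun _ => s • u)) u) s := by
        have h3 : HasDerivAt (fun s : ℝ => ∑ p ∈ Finset.range (L + 2),
          (s ^ p / (p ! : ℝ)) • iteratedFDeriv ℝ p G x (fun _ => u))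
          (∑ p ∈ Finset.range (L + 2),
            ((p : ℝ) * s ^ (p - 1) / (p ! : ℝ)) • iteratedFDeriv ℝ p G x (fun _ => u)) s := by
          apply HasDerivAt.fun_sum
          intro p _
          exact ((hasDerivAt_pow p s).div_const _).smul_const _
        convert h3 using 1
        rw [Finset.sum_range_succ' _ (L + 1)]
        simp only [sum_apply, Nat.cast_zero, zero_mul, zero_div, zero_smul,
          add_zero]
        refine Finset.sum_congr rfl fun p _ => ?_
        rw [iteratedFDeriv_succ_apply_right]
        have : (fun _ : Fin p => s • u) = fun i => (fun _ : Fin p => s) i • (fun _ : Fin p => u) i :=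
          rfl
        rw [this, ContinuousMultilinearMap.map_smul_univ, Finset.prod_const, Finset.card_univ,
          Fintype.card_fin, smul_smul, smul_apply]
        congr 1
        rw [Nat.factorial_succ, Nat.add_sub_cancel]
        push_cast
        have : ((p : ℝ) + 1) ≠ 0 := by positivity
        field_simp
      exact ha.sub hb
    have hbd : ∀ s ∈ Ico (0 : ℝ) 1, ‖q' s‖ ≤ C * ‖u‖ ^ (L + 1) := by
      intro s hs
      have hs' : s ∈ Icc (0 : ℝ) 1 := ⟨hs.1, hs.2.le⟩
      have h4 := (hball _ (hsu s hs')).1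
      refine (ContinuousLinearMap.le_opNorm _ _).trans ?_
      rw [pow_succ, ← mul_assoc]
      gcongr
      refine h4.trans ?_
      rw [Real.norm_of_nonneg (by positivity)]
      gcongr
      rw [norm_smul, Real.norm_eq_abs, abs_of_nonneg hs.1]
      exact mul_le_of_le_one_left (norm_nonneg _) hs.2.le
    have h5 := norm_image_sub_le_of_norm_deriv_le_segment' hq hbd 1 (right_mem_Icc.2 zero_le_one)
    have h0 : q 0 = 0 := by
      simp only [q, zero_smul, add_zero]
      rw [Finset.sum_range_succ']
      simp
    have h1 : q 1 = G (x + u) - ∑ p ∈ Finset.range (L + 1 + 1),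
        (1 / (p ! : ℝ)) • iteratedFDeriv ℝ p G x (fun _ => u) := by
      simp [q]
    rw [h0, h1, sub_zero, sub_zero, mul_one] at h5
    rw [Real.norm_of_nonneg (by positivity)]
    exact h5

/-- The vanishing of the coefficients of a polynomial which is small to high order. -/
theorem coeff_eq_zero_of_isLittleO {W : Type*} [NormedAddCommGroup W] [NormedSpace ℝ W] (L : ℕ) :
    ∀ {a : ℕ → W}, (fun ε : ℝ => ∑ l ∈ Finset.range (L + 1), ε ^ l • a l) =o[𝓝[≠] 0]
      (fun ε : ℝ => ε ^ L) → ∀ l ≤ L, a l = 0 := by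
  induction L with
  | zero =>
    intro a h l hl
    obtain rfl : l = 0 := by omega
    simpa [isLittleO_const_const_iff, isLittleO_one_iff, tendsto_const_nhds_iff] using h
  | succ L ih =>
    intro a h
    have h0 : a 0 = 0 := by
      have h1 : Tendsto (fun ε : ℝ => ∑ l ∈ Finset.range (L + 1 + 1), ε ^ l • a l) (𝓝[≠] 0)
          (𝓝 0) := by
        refine h.isBigO.trans_tendsto (Tendsto.mono_left ?_ nhdsWithin_le_nhds)
        exact Continuous.tendsto' (by fun_prop) _ _ (by simp)
      have h2 : Tendsto (fun ε : ℝ => ∑ l ∈ Finset.range (L + 1 + 1), ε ^ l • a l) (𝓝[≠] 0)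
          (𝓝 (a 0)) := by
        refine Tendsto.mono_left ?_ nhdsWithin_le_nhds
        refine Continuous.tendsto' (by fun_prop) _ _ ?_
        rw [Finset.sum_range_succ']
        simp
      exact tendsto_nhds_unique h2 h1
    have h3 : ∀ l ≤ L, a (l + 1) = 0 := by
      have h4 : (fun ε : ℝ => ∑ l ∈ Finset.range (L + 1), ε ^ l • a (l + 1)) =o[𝓝[≠] 0]
          (fun ε : ℝ => ε ^ L) := by
        -- Division by ε is the reason for working in the punctured neighbourhood.
        have h5 := (isBigO_refl (fun ε : ℝ => ε⁻¹) (𝓝[≠] 0)).smul_isLittleO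
          h
        refine h5.congr' ?_ ?_
        · filter_upwards [self_mem_nhdsWithin] with ε hε
          have hε : ε ≠ 0 := hε
          rw [Finset.sum_range_succ', h0, smul_zero, add_zero, Finset.smul_sum]
          refine Finset.sum_congr rfl fun l _ => ?_
          rw [smul_smul]
          congr 1
          field_simp
          ring
        · filter_upwards [self_mem_nhdsWithin] with ε hε
          have hε : ε ≠ 0 := hε
          simp only [smul_eq_mul]
          field_simp
          ring
      exact fun l hl => ih h4 l hl
    intro l hl
    obtain _ | l := l
    · exact h0
    · exact h3 l (by omega)

end Taylor

/-! ### Faà di Bruno sums as Taylor coefficients along a polynomial curve. -/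

section FaaDiBruno

variable {X W : Type u} [NormedAddCommGroup X] [NormedSpace ℝ X]
  [NormedAddCommGroup W] [NormedSpace ℝ W]

/-- The curve `∑_j ε^{j+1} / (j+1)! v_j`. -/
noncomputable def weightedCurve {r : ℕ} (v : Fin r → X) (ε : ℝ) : X :=
  ∑ j : Fin r, (ε ^ ((j : ℕ) + 1) / (((j : ℕ) + 1)! : ℝ)) • v j

theorem continuous_weightedCurve {r : ℕ} (v : Fin r → X) : Continuous (weightedCurve v) := by
  unfold weightedCurve
  fun_prop

theorem weightedCurve_zero {r : ℕ} (v : Fin r → X) : weightedCurve v 0 = 0 := by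
  simp [weightedCurve]

theorem tendsto_weightedCurve {r : ℕ} (v : Fin r → X) :
    Tendsto (weightedCurve v) (𝓝 0) (𝓝 0) :=
  (continuous_weightedCurve v).tendsto' _ _ (weightedCurve_zero v)

theorem isBigO_pow_pow_of_le {a b : ℕ} (h : a ≤ b) :
    (fun ε : ℝ => ε ^ b) =O[𝓝 0] (fun ε : ℝ => ε ^ a) := by
  obtain ⟨c, rfl⟩ := Nat.exists_eq_add_of_le h
  have : (fun ε : ℝ => ε ^ c) =O[𝓝 0] (fun _ : ℝ => (1 : ℝ)) :=
    (Continuous.tendsto (by fun_prop : Continuous fun ε : ℝ => ε ^ c) 0).isBigO_one ℝ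
  simpa [pow_add] using (isBigO_refl (fun ε : ℝ => ε ^ a) (𝓝 0)).mul this

theorem isLittleO_pow_pow_of_lt {a b : ℕ} (h : a < b) :
    (fun ε : ℝ => ε ^ b) =o[𝓝 0] (fun ε : ℝ => ε ^ a) :=
  isLittleO_pow_pow h

theorem isBigO_weightedCurve {r : ℕ} (v : Fin r → X) :
    weightedCurve v =O[𝓝 0] (fun ε : ℝ => ε) := by
  unfold weightedCurve
  refine IsBigO.fun_sum fun j _ => ?_
  have h1 : (fun ε : ℝ => ε ^ ((j : ℕ) + 1) / (((j : ℕ) + 1)! : ℝ)) =O[𝓝 0] (fun ε : ℝ => ε) := by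
    have := (isBigO_pow_pow_of_le (a := 1) (b := (j : ℕ) + 1) (by omega)).const_mul_left
      (1 / (((j : ℕ) + 1)! : ℝ))
    simpa [div_eq_inv_mul] using this
  simpa using h1.smul (isBigO_const_const (v j) (one_ne_zero : (1 : ℝ) ≠ 0) (𝓝 0))

/-- The coefficient of `faaDiBrunoSum` belonging to a single tuple. -/
noncomputable def faaDiBrunoTerm {r : ℕ} (G : X → W) (x : X) (v : Fin r → X) (c : Fin r → ℕ) : W :=
  (1 / ∏ j : Fin r, (((c j)! : ℝ) * ((((j : ℕ) + 1)! : ℕ) : ℝ) ^ c j)) •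
      iteratedFDeriv ℝ (repeatedVectors c v).length G x (repeatedVectors c v).get

/-- Multinomial expansion of a symmetric form. The multinomial coefficient p! / ∏ c_j! cancels the
factor 1 / p!, and the denominators (j!)^{c_j} come from the coefficients of the curve. -/
theorem iteratedFDeriv_weightedCurve {p r : ℕ} {G : X → W} {x : X}
    (hG : ContDiffAt ℝ (p : WithTop ℕ∞) G x) (v : Fin r → X) (ε : ℝ) :
    (1 / (p ! : ℝ)) • iteratedFDeriv ℝ p G x (fun _ => weightedCurve v ε) =
      ∑ c ∈ Finset.piAntidiag Finset.univ p,
        ε ^ (∑ j : Fin r, ((j : ℕ) + 1) * c j) • faaDiBrunoTerm G x v c := by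
  unfold weightedCurve
  rw [ContinuousMultilinearMap.map_sum]
  let s : Fin r → ℝ := fun j => ε ^ ((j : ℕ) + 1) / (((j : ℕ) + 1)! : ℝ)
  let g : (Fin r → ℕ) → W := fun c => (∏ j, s j ^ c j) •
    iteratedFDeriv ℝ (repeatedVectors c v).length G x (repeatedVectors c v).get
  have h1 : ∀ f : Fin p → Fin r,
      iteratedFDeriv ℝ p G x (fun i => (ε ^ ((f i : ℕ) + 1) / (((f i : ℕ) + 1)! : ℝ)) • v (f i)) =
        g (fun j => Fintype.card {i // f i = j}) := by
    intro f
    have e1 : iteratedFDeriv ℝ p G x (fun i => (s (f i)) • v (f i)) =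
        (∏ i, s (f i)) • iteratedFDeriv ℝ p G x (v ∘ f) :=
      ContinuousMultilinearMap.map_smul_univ _ _ _
    have e2 : ∏ i, s (f i) = ∏ j, s j ^ Fintype.card {i // f i = j} := by
      rw [← Finset.prod_fiberwise_of_maps_to (s := Finset.univ) (t := Finset.univ) (g := f)
        (fun _ _ => Finset.mem_univ _)]
      refine Finset.prod_congr rfl fun j _ => ?_
      rw [Finset.prod_congr rfl (g := fun _ => s j) (by
        intro i hi; rw [(Finset.mem_filter.1 hi).2]), Finset.prod_const, Fintype.card_subtype]
    have e3 : iteratedFDeriv ℝ p G x (v ∘ f) =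
        iteratedFDeriv ℝ (List.ofFn (v ∘ f)).length G x (List.ofFn (v ∘ f)).get := by
      have aux : ∀ (n : ℕ) (h : n = p) (w : Fin n → X), (∀ i, w i = (v ∘ f) (Fin.cast h i)) →
          iteratedFDeriv ℝ p G x (v ∘ f) = iteratedFDeriv ℝ n G x w := by
        intro n h w hw
        subst h
        congr 1
        funext i
        exact (hw i).symm
      refine aux _ (List.length_ofFn) _ fun i => ?_
      simp only [List.get_ofFn, Function.comp]
    have hp := perm_ofFn_repeatedVectors f v
    have e4 := ContDiffAt.iteratedFDeriv_get_perm (G := G) (x := x) (by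
      rw [← hp.length_eq, List.length_ofFn]; exact hG) hp
    simp only [g]
    rw [← e4, ← e3, ← e2, ← e1]
  rw [Finset.sum_congr rfl fun f _ => h1 f, Fintype.sum_fun_eq_sum_piAntidiag, Finset.smul_sum]
  refine Finset.sum_congr rfl fun c hc => ?_
  have hc' : ∑ j, c j = p := (Finset.mem_piAntidiag.1 hc).1
  simp only [g, faaDiBrunoTerm]
  rw [← Nat.cast_smul_eq_nsmul ℝ, smul_smul, smul_smul, smul_smul]
  congr 1
  have hm := Nat.multinomial_spec Finset.univ c
  rw [hc'] at hm
  have hm' : (∏ i, ((c i)! : ℝ)) * (Nat.multinomial Finset.univ c : ℝ) = (p ! : ℝ) := by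
    exact_mod_cast hm
  have hp0 : (p ! : ℝ) ≠ 0 := by positivity
  have hc0 : (∏ i, ((c i)! : ℝ)) ≠ 0 := Finset.prod_ne_zero_iff.2 fun i _ => by positivity
  have hs : ∏ j, s j ^ c j = ε ^ (∑ j : Fin r, ((j : ℕ) + 1) * c j) /
      ∏ j : Fin r, ((((j : ℕ) + 1)! : ℕ) : ℝ) ^ c j := by
    simp only [s, div_pow]
    rw [Finset.prod_div_distrib, ← Finset.prod_pow_eq_pow_sum]
    congr 1
    refine Finset.prod_congr rfl fun j _ => ?_
    rw [pow_mul]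
  have hq0 : (∏ j : Fin r, ((((j : ℕ) + 1)! : ℕ) : ℝ) ^ c j) ≠ 0 :=
    Finset.prod_ne_zero_iff.2 fun i _ => by positivity
  rw [hs, Finset.prod_mul_distrib, ← hm']
  have hm0 : (Nat.multinomial Finset.univ c : ℝ) ≠ 0 := by
    intro h; rw [h, mul_zero] at hm'; exact hp0 hm'.symm
  field_simp

/-- In the Taylor polynomial along the curve, tuples are grouped by degree ∑ c_j, and here they are
regrouped by weight ∑ j c_j. The degree is at most the weight, so every tuple of weight at most `L`
is already present; those of larger weight contribute o(ε^L). -/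
theorem ContDiffAt.faaDiBruno_isLittleO {L r : ℕ} {G : X → W} {x : X}
    (hG : ContDiffAt ℝ (L : WithTop ℕ∞) G x) (v : Fin r → X) :
    (fun ε : ℝ => G (x + weightedCurve v ε) - ∑ l ∈ Finset.range (L + 1),
      ε ^ l • faaDiBrunoSum r l G x v) =o[𝓝 0] (fun ε : ℝ => ε ^ L) := by
  have h1 := (hG.taylor_isLittleO).comp_tendsto (tendsto_weightedCurve v)
  have h2 : ((fun u : X => ‖u‖ ^ L) ∘ weightedCurve v) =O[𝓝 0] (fun ε : ℝ => ε ^ L) :=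
    (isBigO_weightedCurve v).norm_left.pow L
  have h3 := h1.trans_isBigO h2
  let wt : (Fin r → ℕ) → ℕ := fun c => ∑ j : Fin r, ((j : ℕ) + 1) * c j
  let S : Finset (Fin r → ℕ) := (Finset.range (L + 1)).biUnion
    fun p => Finset.piAntidiag Finset.univ p
  have hS : ∀ c, c ∈ S ↔ ∑ j, c j ≤ L := by
    intro c
    simp [S]
  have hsum1 : ∀ ε : ℝ, ∑ p ∈ Finset.range (L + 1),
      (1 / (p ! : ℝ)) • iteratedFDeriv ℝ p G x (fun _ => weightedCurve v ε) =
      ∑ c ∈ S, ε ^ wt c • faaDiBrunoTerm G x v c := by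
    intro ε
    rw [← Finset.sum_fiberwise_of_maps_to (s := S) (t := Finset.range (L + 1))
      (g := fun c => ∑ j, c j) (fun c hc => by
        rw [Finset.mem_range]; exact Nat.lt_succ_of_le ((hS c).1 hc))]
    refine Finset.sum_congr rfl fun p hp => ?_
    have hpL : p ≤ L := Nat.lt_succ_iff.1 (Finset.mem_range.1 hp)
    rw [iteratedFDeriv_weightedCurve (hG.of_le (by exact_mod_cast hpL))]
    refine Finset.sum_congr ?_ fun _ _ => rfl
    ext c
    simp only [Finset.mem_filter, hS, Finset.mem_piAntidiag]
    constructor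
    · rintro ⟨h, _⟩; exact ⟨h ▸ hpL, h⟩
    · rintro ⟨_, h⟩; exact ⟨h, fun _ _ => Finset.mem_univ _⟩
  have hle : ∀ c : Fin r → ℕ, ∑ j, c j ≤ wt c := fun c =>
    Finset.sum_le_sum fun j _ => Nat.le_mul_of_pos_left _ (Nat.succ_pos _)
  have hsum2 : ∀ ε : ℝ, ∑ l ∈ Finset.range (L + 1), ε ^ l • faaDiBrunoSum r l G x v =
      ∑ c ∈ S.filter (fun c => wt c ≤ L), ε ^ wt c • faaDiBrunoTerm G x v c := by
    intro ε
    rw [← Finset.sum_fiberwise_of_maps_to (s := S.filter (fun c => wt c ≤ L))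
      (t := Finset.range (L + 1)) (g := wt) (fun c hc => by
        rw [Finset.mem_range]; exact Nat.lt_succ_of_le (Finset.mem_filter.1 hc).2)]
    refine Finset.sum_congr rfl fun l hl => ?_
    have hlL : l ≤ L := Nat.lt_succ_iff.1 (Finset.mem_range.1 hl)
    unfold faaDiBrunoSum
    rw [Finset.smul_sum]
    refine Finset.sum_congr ?_ fun c hc => ?_
    · ext c
      simp only [Finset.mem_filter, hS, mem_weightedTuples]
      constructor
      · intro h
        have h' : wt c = l := h
        exact ⟨⟨(hle c).trans (h' ▸ hlL), h' ▸ hlL⟩, h'⟩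
      · rintro ⟨_, h⟩; exact h
    · have : wt c = l := (Finset.mem_filter.1 hc).2
      rw [this]
      rfl
  have h4 : (fun ε : ℝ => ∑ c ∈ S.filter (fun c => ¬ wt c ≤ L),
      ε ^ wt c • faaDiBrunoTerm G x v c) =o[𝓝 0] (fun ε : ℝ => ε ^ L) := by
    refine IsLittleO.fun_sum fun c hc => ?_
    have hlt : L < wt c := not_le.1 (Finset.mem_filter.1 hc).2
    simpa using (isLittleO_pow_pow_of_lt hlt).smul_isBigO
      (isBigO_const_const (faaDiBrunoTerm G x v c) (one_ne_zero : (1 : ℝ) ≠ 0) (𝓝 0))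
  refine (h3.add h4).congr_left fun ε => ?_
  simp only [Function.comp]
  rw [hsum1, hsum2, ← Finset.sum_filter_add_sum_filter_not S (fun c => wt c ≤ L)]
  abel

/-- For `L = 0` this is continuity of `G`; otherwise strict differentiability makes `G` Lipschitz
near `x`. -/
theorem ContDiffAt.isLittleO_comp_sub_comp {L : ℕ} {G : X → W} {x : X}
    (hG : ContDiffAt ℝ (L : WithTop ℕ∞) G x) {F : Filter ℝ} {c c' : ℝ → X}
    (hc : Tendsto c F (𝓝 x)) (hc' : Tendsto c' F (𝓝 x))
    (h : (fun ε => c ε - c' ε) =o[F] fun ε => ε ^ L) :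
    (fun ε => G (c ε) - G (c' ε)) =o[F] fun ε => ε ^ L := by
  obtain _ | L := L
  · simp only [pow_zero, isLittleO_one_iff]
    simpa using (hG.continuousAt.tendsto.comp hc).sub (hG.continuousAt.tendsto.comp hc')
  · have h1 := (hG.hasStrictFDerivAt (by simp)).isBigO_sub
    exact (h1.comp_tendsto (hc.prodMk_nhds hc')).trans_isLittleO h

theorem weightedCurve_sub_isLittleO {l r : ℕ} (hlr : l ≤ r) (v : ℕ → X) :
    (fun ε => weightedCurve (fun j : Fin r => v (j + 1)) ε -
      weightedCurve (fun j : Fin l => v (j + 1)) ε) =o[𝓝 0] fun ε : ℝ => ε ^ l := by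
  have : ∀ ε, weightedCurve (fun j : Fin r => v (j + 1)) ε -
      weightedCurve (fun j : Fin l => v (j + 1)) ε =
      ∑ j ∈ Finset.Ico l r, (ε ^ (j + 1) / ((j + 1)! : ℝ)) • v (j + 1) := by
    intro ε
    unfold weightedCurve
    rw [Fin.sum_univ_eq_sum_range (fun j => (ε ^ (j + 1) / ((j + 1)! : ℝ)) • v (j + 1)),
      Fin.sum_univ_eq_sum_range (fun j => (ε ^ (j + 1) / ((j + 1)! : ℝ)) • v (j + 1)),
      Finset.sum_Ico_eq_sub _ hlr]
  simp only [this]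
  refine IsLittleO.fun_sum fun j hj => ?_
  have hlt : l < j + 1 := Nat.lt_succ_of_le (Finset.mem_Ico.1 hj).1
  have h1 := (isLittleO_pow_pow_of_lt hlt).const_mul_left (1 / ((j + 1)! : ℝ))
  simpa [div_eq_inv_mul] using h1.smul_isBigO
      (isBigO_const_const (v (j + 1)) (one_ne_zero : (1 : ℝ) ≠ 0) (𝓝 0))

theorem tendsto_add_weightedCurve {r : ℕ} (x : X) (v : Fin r → X) :
    Tendsto (fun ε => x + weightedCurve v ε) (𝓝 0) (𝓝 x) := by
  simpa using (tendsto_weightedCurve v).const_add x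

/-- No combinatorics of tuples is needed: the vectors beyond `v l` move the curve by o(ε^l) only, so
both sides are the coefficient of ε^l in the same expansion. -/
theorem faaDiBrunoSum_of_le {l r : ℕ} (hlr : l ≤ r) {G : X → W} {x : X}
    (hG : ContDiffAt ℝ (l : WithTop ℕ∞) G x) (v : ℕ → X) :
    faaDiBrunoSum r l G x (fun j : Fin r => v (j + 1)) =
      faaDiBrunoSum l l G x (fun j : Fin l => v (j + 1)) := by
  have h1 := hG.faaDiBruno_isLittleO (fun j : Fin r => v (j + 1))
  have h2 := hG.faaDiBruno_isLittleO (fun j : Fin l => v (j + 1))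
  have h3 := hG.isLittleO_comp_sub_comp
    (tendsto_add_weightedCurve x (fun j : Fin r => v (j + 1)))
    (tendsto_add_weightedCurve x (fun j : Fin l => v (j + 1)))
    (by simpa using weightedCurve_sub_isLittleO hlr v)
  have h4 : (fun ε : ℝ => ∑ i ∈ Finset.range (l + 1), ε ^ i •
      (faaDiBrunoSum r i G x (fun j : Fin r => v (j + 1)) -
      faaDiBrunoSum l i G x (fun j : Fin l => v (j + 1)))) =o[𝓝 0] (fun ε : ℝ => ε ^ l) := by
    refine ((h3.sub h1).add h2).congr_left fun ε => ?_
    simp only [smul_sub, Finset.sum_sub_distrib]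
    abel
  exact sub_eq_zero.1 (coeff_eq_zero_of_isLittleO l (h4.mono nhdsWithin_le_nhds) l le_rfl)

/-- Adding the last vector moves the curve by exactly ε^{l+1} / (l+1)! times `v (l + 1)`, and the
strict derivative gives the effect on `G` up to o(ε^{l+1}). The coefficients of ε^{l+1} are then
compared. -/
theorem faaDiBrunoSum_succ_succ (l : ℕ) {G : X → W} {x : X}
    (hG : ContDiffAt ℝ ((l + 1 : ℕ) : WithTop ℕ∞) G x) (v : ℕ → X) :
    faaDiBrunoSum (l + 1) (l + 1) G x (fun j : Fin (l + 1) => v (j + 1)) =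
      faaDiBrunoSum l (l + 1) G x (fun j : Fin l => v (j + 1)) +
        (1 / ((l + 1)! : ℝ)) • fderiv ℝ G x (v (l + 1)) := by
  have h1 := hG.faaDiBruno_isLittleO (fun j : Fin (l + 1) => v (j + 1))
  have h2 := hG.faaDiBruno_isLittleO (fun j : Fin l => v (j + 1))
  have h3 := (hG.hasStrictFDerivAt (by simp)).isLittleO.comp_tendsto
    ((tendsto_add_weightedCurve x (fun j : Fin (l + 1) => v (j + 1))).prodMk_nhds
    (tendsto_add_weightedCurve x (fun j : Fin l => v (j + 1))))
  have hd : ∀ ε, (x + weightedCurve (fun j : Fin (l + 1) => v (j + 1)) ε) -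
      (x + weightedCurve (fun j : Fin l => v (j + 1)) ε) =
      (ε ^ (l + 1) / ((l + 1)! : ℝ)) • v (l + 1) := by
    intro ε
    simp only [weightedCurve, Fin.sum_univ_castSucc, Fin.val_castSucc, Fin.val_last]
    abel
  have h4 : (fun ε : ℝ => G (x + weightedCurve (fun j : Fin (l + 1) => v (j + 1)) ε) -
      G (x + weightedCurve (fun j : Fin l => v (j + 1)) ε) -
      ε ^ (l + 1) • (1 / ((l + 1)! : ℝ)) • fderiv ℝ G x (v (l + 1))) =o[𝓝 0]
      (fun ε : ℝ => ε ^ (l + 1)) := by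
    refine (h3.congr_left fun ε => ?_).trans_isBigO ?_
    · simp only [Function.comp]
      rw [hd, map_smul, smul_smul, mul_one_div]
    · simp only [Function.comp_def, hd]
      have h1 := (isBigO_refl (fun ε : ℝ => ε ^ (l + 1)) (𝓝 0)).const_mul_left
        (1 / ((l + 1)! : ℝ))
      simpa [div_eq_inv_mul] using h1.smul
        (isBigO_const_const (v (l + 1)) (one_ne_zero : (1 : ℝ) ≠ 0) (𝓝 0))
  have h5 : (fun ε : ℝ => ∑ i ∈ Finset.range (l + 1 + 1), ε ^ i •
      (faaDiBrunoSum (l + 1) i G x (fun j : Fin (l + 1) => v (j + 1)) -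
      faaDiBrunoSum l i G x (fun j : Fin l => v (j + 1)) -
      if i = l + 1 then (1 / ((l + 1)! : ℝ)) • fderiv ℝ G x (v (l + 1)) else 0)) =o[𝓝 0]
      (fun ε : ℝ => ε ^ (l + 1)) := by
    refine ((h4.sub h1).add h2).congr_left fun ε => ?_
    simp only [smul_sub, Finset.sum_sub_distrib, smul_ite, smul_zero, Finset.sum_ite_eq',
      Finset.mem_range, Nat.lt_succ_self, if_true]
    abel
  have h6 := coeff_eq_zero_of_isLittleO (l + 1) (h5.mono nhdsWithin_le_nhds) (l + 1) le_rfl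
  rw [if_pos rfl, sub_sub, sub_eq_zero] at h6
  exact h6

/-- Expansion to order `L` of a function along a curve which is given to order `L`. -/
theorem ContDiffAt.expansion_comp {L : ℕ} {G : X → W} {x : X}
    (hG : ContDiffAt ℝ (L : WithTop ℕ∞) G x) (v : ℕ → X) {F : Filter ℝ} (hF : F ≤ 𝓝 0)
    {c : ℝ → X} (hc : (fun ε => c ε - (x + weightedCurve (fun j : Fin L => v (j + 1)) ε)) =o[F]
      fun ε => ε ^ L) :
    (fun ε : ℝ => G (c ε) - ∑ l ∈ Finset.range (L + 1), ε ^ l •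
      faaDiBrunoSum l l G x (fun j : Fin l => v (j + 1))) =o[F] fun ε : ℝ => ε ^ L := by
  have hw := (tendsto_add_weightedCurve x (fun j : Fin L => v (j + 1))).mono_left hF
  have hcx : Tendsto c F (𝓝 x) := by
    have h1 : Tendsto (fun ε => c ε - (x + weightedCurve (fun j : Fin L => v (j + 1)) ε)) F
        (𝓝 0) := by
      have h2 : (fun ε : ℝ => ε ^ L) =O[F] (fun _ => (1 : ℝ)) :=
        ((Continuous.tendsto (by fun_prop : Continuous fun ε : ℝ => ε ^ L) 0).mono_left
          hF).isBigO_one ℝ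
      exact (isLittleO_one_iff ℝ).1 (hc.trans_isBigO h2)
    simpa using h1.add hw
  have h1 := hG.isLittleO_comp_sub_comp hcx hw hc
  refine (h1.add ((hG.faaDiBruno_isLittleO (fun j : Fin L => v (j + 1))).mono hF)).congr_left
    fun ε => ?_
  -- The coefficient of ε^l depends on the first l vectors only, so the `L` vectors of the curve may
  -- be cut down.
  rw [Finset.sum_congr rfl fun l hl => by
    rw [faaDiBrunoSum_of_le (Nat.lt_succ_iff.1 (Finset.mem_range.1 hl))
      (hG.of_le (by exact_mod_cast Nat.lt_succ_iff.1 (Finset.mem_range.1 hl))) v]]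
  abel

end FaaDiBruno

/-! ### Smoothness of superposition operators on spaces of continuous maps. -/

section Nemytskii

variable {K : Type*} [TopologicalSpace K] [CompactSpace K]
  {Y F : Type u} [NormedAddCommGroup Y] [NormedSpace ℝ Y] [NormedAddCommGroup F] [NormedSpace ℝ F]

open Classical in
/-- Composition `u ↦ f ∘ u` on spaces of continuous maps (zero where `f ∘ u` is not continuous). -/
noncomputable def nemytskii (f : Y → F) (u : C(K, Y)) : C(K, F) :=
  if h : Continuous (f ∘ u) then ⟨f ∘ u, h⟩ else 0

/-- The continuous maps with values in `Ω`. -/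
def mapsInto (K : Type*) [TopologicalSpace K] (Ω : Set Y) : Set C(K, Y) := {u | ∀ s, u s ∈ Ω}

theorem isOpen_mapsInto {Ω : Set Y} (hΩ : IsOpen Ω) : IsOpen (mapsInto K Ω) := by
  have := ContinuousMap.isOpen_setOfPred_mapsTo (X := K) (Y := Y) isCompact_univ hΩ
  convert this using 1
  ext u
  simp [mapsInto, MapsTo]

theorem nemytskii_apply {f : Y → F} {Ω : Set Y} (hf : ContinuousOn f Ω) {u : C(K, Y)}
    (hu : u ∈ mapsInto K Ω) (s : K) : nemytskii f u s = f (u s) := by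
  have h : Continuous (f ∘ u) := hf.comp_continuous u.continuous hu
  simp [nemytskii, dif_pos h]

/-- Pointwise application of operator valued continuous maps. -/
noncomputable def pointwiseApply : C(K, Y →L[ℝ] F) →L[ℝ] C(K, Y) →L[ℝ] C(K, F) :=
  LinearMap.mkContinuous₂
    (LinearMap.mk₂ ℝ (fun (A : C(K, Y →L[ℝ] F)) (u : C(K, Y)) =>
        (⟨fun s => A s (u s), by fun_prop⟩ : C(K, F)))
      (fun _ _ _ => by ext; simp) (fun _ _ _ => by ext; simp)
      (fun _ _ _ => by ext; simp) (fun _ _ _ => by ext; simp)) 1 (fun A u => by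
    rw [ContinuousMap.norm_le _ (by positivity)]
    intro s
    rw [one_mul]
    exact ((A s).le_opNorm _).trans (by gcongr <;> exact ContinuousMap.norm_coe_le_norm _ _))

@[simp]
theorem pointwiseApply_apply (A : C(K, Y →L[ℝ] F)) (u : C(K, Y)) (s : K) :
    pointwiseApply A u s = A s (u s) := rfl

/-- The range of `u` is compact in Ω, so one radius both stays inside Ω and controls the oscillation
of `f` for all `s`. This uniformity turns pointwise estimates into estimates in the supremum norm.
-/
theorem exists_uniform_nhds {Z : Type*} [NormedAddCommGroup Z] {f : Y → Z} {Ω : Set Y}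
    (hΩ : IsOpen Ω) (hf : ContinuousOn f Ω)
    {u : C(K, Y)} (hu : u ∈ mapsInto K Ω) {C : ℝ} (hC : 0 < C) :
    ∃ δ > 0, ∀ s, ∀ y ∈ Metric.ball (u s) δ, y ∈ Ω ∧ ‖f y - f (u s)‖ ≤ C := by
  have hK : IsCompact (range u) := isCompact_range u.continuous
  have hsub : range u ⊆ Ω := by rintro _ ⟨s, rfl⟩; exact hu s
  obtain ⟨δ₁, hδ₁, h1⟩ := hK.exists_thickening_subset_open hΩ hsub
  have h2 := hK.uniformContinuousAt_of_continuousAt (f := f)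
    (fun y hy => (hf.continuousAt (hΩ.mem_nhds (hsub hy))))
    (Metric.dist_mem_uniformity hC)
  obtain ⟨δ₂, hδ₂, h2⟩ := Metric.mem_uniformity_dist.1 h2
  refine ⟨min δ₁ δ₂, lt_min hδ₁ hδ₂, fun s y hy => ⟨h1 ?_, ?_⟩⟩
  · rw [Metric.mem_thickening_iff]
    exact ⟨u s, mem_range_self s, lt_of_lt_of_le hy (min_le_left _ _)⟩
  · have h3 : dist (u s) y < δ₂ := by
      rw [dist_comm]; exact lt_of_lt_of_le hy (min_le_right _ _)
    have h4 := h2 h3 (mem_range_self s)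
    rw [← dist_eq_norm, dist_comm]
    exact le_of_lt h4

theorem continuousOn_nemytskii {f : Y → F} {Ω : Set Y} (hΩ : IsOpen Ω) (hf : ContinuousOn f Ω) :
    ContinuousOn (nemytskii f) (mapsInto K Ω) := by
  intro u hu
  apply ContinuousAt.continuousWithinAt
  rw [Metric.continuousAt_iff']
  intro C hC
  obtain ⟨δ, hδ, h⟩ := exists_uniform_nhds hΩ hf hu (half_pos hC)
  filter_upwards [Metric.ball_mem_nhds u hδ, (isOpen_mapsInto hΩ).mem_nhds hu] with w hw hwΩ
  refine lt_of_le_of_lt ?_ (half_lt_self hC)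
  rw [dist_eq_norm, ContinuousMap.norm_le _ (half_pos hC).le]
  intro s
  rw [ContinuousMap.sub_apply, nemytskii_apply hf hu, nemytskii_apply hf hwΩ]
  exact (h s (w s) (lt_of_le_of_lt (ContinuousMap.dist_apply_le_dist s) hw)).2

/-- The mean value inequality is applied at each `s` on a ball around `u s` whose radius does not
depend on `s`. -/
theorem hasFDerivAt_nemytskii {f : Y → F} {f' : Y → Y →L[ℝ] F} {Ω : Set Y} (hΩ : IsOpen Ω)
    (hf : ∀ y ∈ Ω, HasFDerivAt f (f' y) y) (hf' : ContinuousOn f' Ω)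
    {u : C(K, Y)} (hu : u ∈ mapsInto K Ω) :
    HasFDerivAt (nemytskii f) (pointwiseApply (nemytskii f' u)) u := by
  have hfc : ContinuousOn f Ω := fun y hy => (hf y hy).continuousAt.continuousWithinAt
  rw [hasFDerivAt_iff_isLittleO, isLittleO_iff]
  intro C hC
  obtain ⟨δ, hδ, h⟩ := exists_uniform_nhds hΩ hf' hu hC
  filter_upwards [Metric.ball_mem_nhds u hδ, (isOpen_mapsInto hΩ).mem_nhds hu] with w hw hwΩ
  rw [ContinuousMap.norm_le _ (by positivity)]
  intro s
  simp only [ContinuousMap.sub_apply, pointwiseApply_apply]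
  rw [nemytskii_apply hfc hu, nemytskii_apply hfc hwΩ, nemytskii_apply hf' hu]
  have h1 : ‖f (w s) - f (u s) - f' (u s) (w s - u s)‖ ≤ C * ‖w s - u s‖ :=
    (convex_ball (u s) δ).norm_image_sub_le_of_norm_hasFDerivWithin_le'
    (fun y hy => (hf y (h s y hy).1).hasFDerivWithinAt) (fun y hy => (h s y hy).2)
    (Metric.mem_ball_self hδ) (lt_of_le_of_lt (ContinuousMap.dist_apply_le_dist s) hw)
  refine h1.trans ?_
  gcongr
  exact ContinuousMap.norm_coe_le_norm (w - u) s

/-- The derivative is the superposition operator of `fderiv ℝ f` followed by the fixed continuous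
linear map `pointwiseApply`, so smoothness follows by induction with varying codomain. -/
theorem contDiffOn_nemytskii {Ω : Set Y} (hΩ : IsOpen Ω) (n : ℕ) :
    ∀ {F : Type u} [NormedAddCommGroup F] [NormedSpace ℝ F] {f : Y → F},
      ContDiffOn ℝ (n : WithTop ℕ∞) f Ω →
      ContDiffOn ℝ (n : WithTop ℕ∞) (nemytskii f) (mapsInto K Ω) := by
  induction n with
  | zero =>
    intro F _ _ f hf
    simp only [Nat.cast_zero, contDiffOn_zero] at hf ⊢
    exact continuousOn_nemytskii hΩ hf
  | succ n ih =>
    intro F _ _ f hf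
    push_cast at hf ⊢
    rw [contDiffOn_succ_iff_fderiv_of_isOpen hΩ] at hf
    rw [contDiffOn_succ_iff_fderiv_of_isOpen (isOpen_mapsInto hΩ)]
    obtain ⟨hd, -, hf'⟩ := hf
    have hder : ∀ u ∈ mapsInto K Ω, HasFDerivAt (nemytskii f)
        (pointwiseApply (nemytskii (fderiv ℝ f) u)) u := fun u hu =>
      hasFDerivAt_nemytskii hΩ
        (fun y hy => ((hd y hy).differentiableAt (hΩ.mem_nhds hy)).hasFDerivAt)
        hf'.continuousOn hu
    refine ⟨fun u hu => (hder u hu).differentiableAt.differentiableWithinAt, by simp, ?_⟩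
    refine ContDiffOn.congr (f := fun u => pointwiseApply (nemytskii (fderiv ℝ f) u)) ?_
      fun u hu => (hder u hu).fderiv
    exact (pointwiseApply (K := K) (Y := Y) (F := F)).contDiff.comp_contDiffOn (ih hf')

end Nemytskii

/-! ### Integration over one strip as a bounded operator. -/

section IndicatorIntegral

open MeasureTheory

variable {F : Type*} [NormedAddCommGroup F] [NormedSpace ℝ F]

theorem intervalIntegrable_indicator {g : ℝ → F} (hg : Continuous g) {J : Set ℝ}
    (hJ : MeasurableSet J) (a b : ℝ) : IntervalIntegrable (J.indicator g) volume a b := by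
  have := hg.intervalIntegrable (μ := volume) a b
  rw [intervalIntegrable_iff] at this ⊢
  exact this.indicator hJ

variable {T : ℝ} (hT : 0 ≤ T) {J : Set ℝ} (hJ : MeasurableSet J)

theorem norm_indicatorIntegral_le (u : C(Icc (0 : ℝ) T, F)) (t : Icc (0 : ℝ) T) :
    ‖∫ s in (0 : ℝ)..t, J.indicator (IccExtend hT u) s‖ ≤
      ∫ s in (0 : ℝ)..t, ‖IccExtend hT u s‖ := by
  refine intervalIntegral.norm_integral_le_of_norm_le t.2.1 ?_ ?_
  · exact Eventually.of_forall fun s _ => norm_indicator_le_norm_self _ _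
  · exact (u.continuous.Icc_extend' (h := hT)).norm.intervalIntegrable _ _

/-- The operator `u ↦ (t ↦ ∫_0^t χ_J u)` on `C([0, T], F)`. -/
noncomputable def indicatorIntegral : C(Icc (0 : ℝ) T, F) →L[ℝ] C(Icc (0 : ℝ) T, F) :=
  LinearMap.mkContinuous
    { toFun := fun u => ⟨fun t => ∫ s in (0 : ℝ)..t, J.indicator (IccExtend hT u) s,
        (intervalIntegral.continuous_primitive (fun a b =>
          intervalIntegrable_indicator u.continuous.Icc_extend' hJ a b) 0).comp
          continuous_subtype_val⟩
      map_add' := fun u v => by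
        ext t
        have : J.indicator (IccExtend hT (u + v)) =
            fun s => J.indicator (IccExtend hT u) s + J.indicator (IccExtend hT v) s := by
          funext s
          by_cases hs : s ∈ J <;> simp [hs, IccExtend]
        simp only [ContinuousMap.coe_mk, ContinuousMap.add_apply]
        rw [this]
        exact intervalIntegral.integral_add
          (intervalIntegrable_indicator u.continuous.Icc_extend' hJ _ _)
          (intervalIntegrable_indicator v.continuous.Icc_extend' hJ _ _)
      map_smul' := fun c u => by
        ext t
        have : J.indicator (IccExtend hT ⇑(c • u)) =
            fun s => c • J.indicator (IccExtend hT u) s := by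
          funext s
          by_cases hs : s ∈ J <;> simp [hs, IccExtend]
        simp only [ContinuousMap.coe_mk, ContinuousMap.smul_apply, RingHom.id_apply]
        rw [this]
        exact intervalIntegral.integral_smul _ _ } T (fun u => by
    rw [ContinuousMap.norm_le _ (by positivity)]
    intro t
    refine (norm_indicatorIntegral_le hT u t).trans ?_
    have h1 := intervalIntegral.norm_integral_le_of_norm_le_const (a := 0) (b := (t : ℝ))
      (f := fun s => ‖IccExtend hT u s‖) (C := ‖u‖) (fun s _ => by
        simpa [IccExtend] using ContinuousMap.norm_coe_le_norm u _)
    refine (le_abs_self _).trans (h1.trans ?_)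
    rw [sub_zero, abs_of_nonneg t.2.1, mul_comm]
    gcongr
    exact t.2.2)

theorem indicatorIntegral_apply (u : C(Icc (0 : ℝ) T, F)) (t : Icc (0 : ℝ) T) :
    indicatorIntegral hT hJ u t = ∫ s in (0 : ℝ)..t, J.indicator (IccExtend hT u) s := rfl

end IndicatorIntegral

/-! ### Expansion in ε with coefficients that are smooth in z. -/

section PartialTaylor

variable {Z F : Type u} [NormedAddCommGroup Z] [NormedSpace ℝ Z]
  [NormedAddCommGroup F] [NormedSpace ℝ F] [CompleteSpace F]

/-- The map that sends `(z, ε)` to the segment `s ↦ (z, s ε)`. -/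
noncomputable def verticalSegment : Z × ℝ →L[ℝ] C(Icc (0 : ℝ) 1, Z × ℝ) :=
  LinearMap.mkContinuous
    { toFun := fun p => ⟨fun s => (p.1, (s : ℝ) * p.2), by fun_prop⟩
      map_add' := fun p q => by ext s <;> simp [mul_add]
      map_smul' := fun c p => by
        ext s
        · simp
        · simp only [ContinuousMap.coe_mk, ContinuousMap.smul_apply, Prod.smul_snd, smul_eq_mul,
            RingHom.id_apply]
          ring } 1 (fun p => by
    rw [ContinuousMap.norm_le _ (by positivity)]
    intro s
    simp only [LinearMap.coe_mk, AddHom.coe_mk, ContinuousMap.coe_mk, one_mul]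
    rw [Prod.norm_def, Prod.norm_def, norm_mul]
    refine max_le_max le_rfl ?_
    refine mul_le_of_le_one_left (norm_nonneg _) ?_
    rw [Real.norm_eq_abs, abs_of_nonneg s.2.1]
    exact s.2.2)

/-- The quotient is q(z, ε) = ∫_0^1 ∂_ε h(z, s ε) ds. It is a continuous linear functional of a
superposition operator evaluated on `verticalSegment`, so it loses just one derivative. -/
theorem ContDiffAt.exists_divided_difference {n : ℕ} {h : Z × ℝ → F} {z₀ : Z}
    (hh : ContDiffAt ℝ ((n + 1 : ℕ) : WithTop ℕ∞) h (z₀, 0)) :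
    ∃ q : Z × ℝ → F, ContDiffAt ℝ (n : WithTop ℕ∞) q (z₀, 0) ∧
      ∀ᶠ p in 𝓝 (z₀, (0 : ℝ)), h p = h (p.1, 0) + p.2 • q p := by
  obtain ⟨U, hU, hhU⟩ := hh.contDiffOn le_rfl (by simp)
  obtain ⟨r, hr, hball⟩ := Metric.mem_nhds_iff.1 hU
  let Ω : Set (Z × ℝ) := Metric.ball (z₀, 0) r
  have hΩ : IsOpen Ω := Metric.isOpen_ball
  have hhΩ : ContDiffOn ℝ ((n + 1 : ℕ) : WithTop ℕ∞) h Ω := hhU.mono hball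
  let d : Z × ℝ → F := fun p => fderiv ℝ h p (0, 1)
  have hd : ContDiffOn ℝ (n : WithTop ℕ∞) d Ω :=
    (hhΩ.fderiv_of_isOpen hΩ (by push_cast; exact le_rfl)).clm_apply contDiffOn_const
  let I1 : C(Icc (0 : ℝ) 1, F) →L[ℝ] C(Icc (0 : ℝ) 1, F) :=
    indicatorIntegral zero_le_one MeasurableSet.univ
  let ev : C(Icc (0 : ℝ) 1, F) →L[ℝ] F := ContinuousMap.evalCLM ℝ ⟨1, by simp⟩
  let q : Z × ℝ → F := fun p => ev (I1 (nemytskii d (verticalSegment p)))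
  have hseg : ∀ p ∈ Ω, verticalSegment p ∈ mapsInto (Icc (0 : ℝ) 1) Ω := by
    intro p hp s
    simp only [Ω, mem_ball_iff_norm, Prod.norm_def, Prod.fst_sub, Prod.snd_sub, sub_zero,
      max_lt_iff] at hp ⊢
    refine ⟨hp.1, ?_⟩
    change ‖(s : ℝ) * p.2‖ < r
    rw [norm_mul]
    refine lt_of_le_of_lt (mul_le_of_le_one_left (norm_nonneg _) ?_) hp.2
    rw [Real.norm_eq_abs, abs_of_nonneg s.2.1]
    exact s.2.2
  have h0 : ((z₀, 0) : Z × ℝ) ∈ Ω := Metric.mem_ball_self hr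
  refine ⟨q, ?_, ?_⟩
  · have h1 : ContDiffOn ℝ (n : WithTop ℕ∞) (fun p : Z × ℝ =>
        nemytskii (K := Icc (0 : ℝ) 1) d (verticalSegment p)) Ω :=
      (contDiffOn_nemytskii hΩ n hd).comp
        (ContinuousLinearMap.contDiff (verticalSegment (Z := Z))).contDiffOn hseg
    have h2 := (ev.comp I1).contDiff.comp_contDiffOn h1
    exact h2.contDiffAt (hΩ.mem_nhds h0)
  · filter_upwards [hΩ.mem_nhds h0] with p hp
    have hval : q p = ∫ s in (0 : ℝ)..1, d (p.1, s * p.2) := by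
      simp only [q, ev, I1, ContinuousMap.evalCLM_apply, indicatorIntegral_apply, indicator_univ]
      refine intervalIntegral.integral_congr fun s hs => ?_
      rw [uIcc_of_le zero_le_one] at hs
      rw [IccExtend_of_mem _ _ hs, nemytskii_apply hd.continuousOn (hseg p hp)]
      rfl
    have hmem : ∀ s ∈ Icc (0 : ℝ) 1, (p.1, s * p.2) ∈ Ω := fun s hs => hseg p hp ⟨s, hs⟩
    have hder : ∀ s ∈ uIcc (0 : ℝ) 1, HasDerivAt (fun s : ℝ => h (p.1, s * p.2))
        (p.2 • d (p.1, s * p.2)) s := by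
      intro s hs
      rw [uIcc_of_le zero_le_one] at hs
      have h1 : HasFDerivAt h (fderiv ℝ h (p.1, s * p.2)) (p.1, s * p.2) :=
        ((hhΩ.contDiffAt (hΩ.mem_nhds (hmem s hs))).differentiableAt (by simp)).hasFDerivAt
      have h2 : HasDerivAt (fun s : ℝ => (p.1, s * p.2)) ((0 : Z), p.2) s := by
        have := (hasDerivAt_id s).mul_const p.2
        simp only [id, one_mul] at this
        exact (hasDerivAt_const s p.1).prodMk this
      have h3 := h1.comp_hasDerivAt s h2
      have h4 : ((0 : Z), p.2) = p.2 • ((0 : Z), (1 : ℝ)) := by simp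
      rw [h4, map_smul] at h3
      exact h3
    have hcont : ContinuousOn (fun s : ℝ => p.2 • d (p.1, s * p.2)) (uIcc 0 1) := by
      rw [uIcc_of_le zero_le_one]
      exact (hd.continuousOn.comp (by fun_prop) hmem).const_smul _
    have := intervalIntegral.integral_eq_sub_of_hasDerivAt hder hcont.intervalIntegrable
    rw [intervalIntegral.integral_smul, ← hval, one_mul, zero_mul] at this
    rw [this]
    simp

/-- Expansion of a function of `(z, ε)` in powers of `ε`, with coefficients depending smoothly
on `z`. -/
theorem ContDiffAt.exists_partial_expansion (k : ℕ) : ∀ {h : Z × ℝ → F} {z₀ : Z},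
    ContDiffAt ℝ ((k + 1 : ℕ) : WithTop ℕ∞) h (z₀, 0) →
    ∃ (c : ℕ → Z → F) (ρ : Z × ℝ → F),
      (∀ i ≤ k, ContDiffAt ℝ ((k + 1 - i : ℕ) : WithTop ℕ∞) (c i) z₀) ∧
      ContDiffAt ℝ 1 ρ (z₀, 0) ∧ (∀ z, ρ (z, 0) = 0) ∧
      ∀ᶠ p in 𝓝 (z₀, (0 : ℝ)),
        h p = ∑ i ∈ Finset.range (k + 1), p.2 ^ i • c i p.1 + p.2 ^ k • ρ p := by
  have hinl : ∀ z : Z, ContDiffAt ℝ ⊤ (fun z : Z => (z, (0 : ℝ))) z := fun z =>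
    contDiffAt_id.prodMk contDiffAt_const
  induction k with
  | zero =>
    intro h z₀ hh
    have h1 : ContDiffAt ℝ ((0 + 1 : ℕ) : WithTop ℕ∞) (fun z => h (z, 0)) z₀ :=
      ContDiffAt.comp z₀ (g := h) (f := fun z => (z, 0)) hh ((hinl z₀).of_le le_top)
    refine ⟨fun _ z => h (z, 0), fun p => h p - h (p.1, 0), ?_, ?_, by simp, ?_⟩
    · intro i hi
      obtain rfl : i = 0 := by omega
      exact h1
    · have h2 : ContDiffAt ℝ ((0 + 1 : ℕ) : WithTop ℕ∞) (fun p : Z × ℝ => h (p.1, 0)) (z₀, 0) :=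
        ContDiffAt.comp (z₀, (0 : ℝ)) (g := fun z => h (z, 0)) (f := Prod.fst) h1 contDiffAt_fst
      simpa using hh.sub h2
    · exact Eventually.of_forall fun p => by simp
  | succ k ih =>
    intro h z₀ hh
    have h1 : ContDiffAt ℝ ((k + 1 + 1 : ℕ) : WithTop ℕ∞) (fun z => h (z, 0)) z₀ :=
      ContDiffAt.comp z₀ (g := h) (f := fun z => (z, 0)) hh ((hinl z₀).of_le le_top)
    obtain ⟨q, hq, hhq⟩ := hh.exists_divided_difference
    obtain ⟨c, ρ, hc, hρ, hρ0, he⟩ := ih hq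
    -- The expansion of the quotient `q` is shifted by one power of ε, with h(·, 0) put in front.
    -- Each division costs one derivative, hence the class C^{k+1-i} of the i-th coefficient.
    refine ⟨fun i => Nat.casesOn i (fun z => h (z, 0)) c, ρ, ?_, hρ, hρ0, ?_⟩
    · intro i hi
      obtain _ | i := i
      · exact h1
      · have := hc i (by omega)
        rwa [show k + 1 + 1 - (i + 1) = k + 1 - i by omega]
    · filter_upwards [hhq, he] with p h2 h3
      rw [h2, h3, Finset.sum_range_succ' _ (k + 1), smul_add, Finset.smul_sum]
      simp only [smul_smul, ← pow_succ', pow_zero, one_smul]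
      change h (p.1, 0) + (_ + _) = _ + h (p.1, 0) + _
      abel

end PartialTaylor

/-! ### Linear Volterra equations with piecewise continuous coefficients. -/

section Volterra

open MeasureTheory

variable {G : Type*} [NormedAddCommGroup G] [NormedSpace ℝ G] {T : ℝ} (hT : 0 ≤ T)
  {ι : Type*} [Fintype ι] {J : ι → Set ℝ} (hJ : ∀ j, MeasurableSet (J j))

/-- The Volterra operator `u ↦ (t ↦ ∑_j ∫_0^t χ_{J_j} A_j u)`. -/
noncomputable def volterra (A : ι → C(Icc (0 : ℝ) T, G →L[ℝ] G)) :
    C(Icc (0 : ℝ) T, G) →L[ℝ] C(Icc (0 : ℝ) T, G) :=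
  ∑ j, (indicatorIntegral hT (hJ j)).comp (pointwiseApply (A j))

theorem volterra_apply (A : ι → C(Icc (0 : ℝ) T, G →L[ℝ] G)) (u : C(Icc (0 : ℝ) T, G)) :
    volterra hT hJ A u = ∑ j, indicatorIntegral hT (hJ j) (pointwiseApply (A j) u) := by
  simp [volterra]

theorem norm_volterra_apply_le (A : ι → C(Icc (0 : ℝ) T, G →L[ℝ] G))
    (u : C(Icc (0 : ℝ) T, G)) (t : Icc (0 : ℝ) T) :
    ‖volterra hT hJ A u t‖ ≤ (∑ j, ‖A j‖) * ∫ s in (0 : ℝ)..t, ‖IccExtend hT u s‖ := by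
  rw [volterra_apply, ContinuousMap.sum_apply, Finset.sum_mul]
  refine norm_sum_le_of_le _ fun j _ => ?_
  rw [indicatorIntegral_apply]
  refine (norm_indicatorIntegral_le hT _ t).trans ?_
  rw [← intervalIntegral.integral_const_mul]
  refine intervalIntegral.integral_mono_on t.2.1 ?_ ?_ fun s _ => ?_
  · exact (ContinuousMap.continuous _).Icc_extend'.norm.intervalIntegrable _ _
  · exact (continuous_const.mul (u.continuous.Icc_extend' (h := hT)).norm).intervalIntegrable _ _
  · refine ((A j (projIcc 0 T hT s)).le_opNorm _).trans ?_
    refine mul_le_mul_of_nonneg_right (ContinuousMap.norm_coe_le_norm _ _) (norm_nonneg _)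

/-- Each further application integrates the previous bound once, which produces the terms of the
exponential series. -/
theorem norm_volterra_pow_apply_le (A : ι → C(Icc (0 : ℝ) T, G →L[ℝ] G)) (n : ℕ)
    (u : C(Icc (0 : ℝ) T, G)) (t : Icc (0 : ℝ) T) :
    ‖((volterra hT hJ A) ^ n) u t‖ ≤ ‖u‖ * (((∑ j, ‖A j‖) * t) ^ n / (n ! : ℝ)) := by
  induction n generalizing t with
  | zero => simpa using ContinuousMap.norm_coe_le_norm u t
  | succ n ih =>
    rw [pow_succ', mul_apply_eq_comp]
    refine (norm_volterra_apply_le hT hJ A _ t).trans ?_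
    set M : ℝ := ∑ j, ‖A j‖
    have hM : 0 ≤ M := Finset.sum_nonneg fun j _ => norm_nonneg (A j)
    have h1 : ∫ s in (0 : ℝ)..t, ‖IccExtend hT (((volterra hT hJ A) ^ n) u) s‖ ≤
        ∫ s in (0 : ℝ)..t, ‖u‖ * ((M * s) ^ n / (n ! : ℝ)) := by
      refine intervalIntegral.integral_mono_on t.2.1 ?_ ?_ fun s hs => ?_
      · exact (ContinuousMap.continuous _).Icc_extend'.norm.intervalIntegrable _ _
      · exact Continuous.intervalIntegrable (by fun_prop) _ _
      · have hs' : s ∈ Icc (0 : ℝ) T := ⟨hs.1, hs.2.trans t.2.2⟩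
        rw [IccExtend_of_mem _ _ hs']
        exact ih ⟨s, hs'⟩
    have h2 : ∫ s in (0 : ℝ)..t, ‖u‖ * ((M * s) ^ n / (n ! : ℝ)) =
        ‖u‖ * (M ^ n * ((t : ℝ) ^ (n + 1) / (n + 1)) / (n ! : ℝ)) := by
      rw [intervalIntegral.integral_const_mul]
      simp only [mul_pow]
      rw [intervalIntegral.integral_div, intervalIntegral.integral_const_mul, integral_pow]
      simp
    refine (mul_le_mul_of_nonneg_left (h1.trans_eq h2) hM).trans_eq ?_
    rw [Nat.factorial_succ]
    push_cast
    field_simp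
    ring

/-- Some power satisfies ‖V^n‖ < 1, so 1 - V^n is invertible; 1 - V is a factor of it that commutes
with the cofactor ∑_{i<n} V^i. No smallness of T or of the coefficients is required. -/
theorem isUnit_one_sub_volterra (A : ι → C(Icc (0 : ℝ) T, G →L[ℝ] G)) [CompleteSpace G] :
    IsUnit (1 - volterra hT hJ A) := by
  set V := volterra hT hJ A
  set M : ℝ := ∑ j, ‖A j‖
  have hM : 0 ≤ M := Finset.sum_nonneg fun j _ => norm_nonneg (A j)
  have hlim := FloorSemiring.tendsto_pow_div_factorial_atTop (M * T)
  obtain ⟨n, hn⟩ := (hlim.eventually (gt_mem_nhds (zero_lt_one' ℝ))).exists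
  have hV : ‖V ^ n‖ < 1 := by
    refine lt_of_le_of_lt (ContinuousLinearMap.opNorm_le_bound _ (by positivity) fun u => ?_) hn
    rw [ContinuousMap.norm_le _ (by positivity)]
    intro t
    refine (norm_volterra_pow_apply_le hT hJ A n u t).trans ?_
    rw [mul_comm]
    have := t.2.1
    have := t.2.2
    gcongr
  have h1 : IsUnit (1 - V ^ n) := (Units.oneSub (V ^ n) hV).isUnit
  have h2 : (1 - V) * ∑ i ∈ Finset.range n, V ^ i = 1 - V ^ n := by
    have := mul_neg_geom_sum V n
    exact this
  have h3 : Commute (1 - V) (∑ i ∈ Finset.range n, V ^ i) := by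
    refine Commute.sum_right _ _ _ fun i _ => ?_
    exact ((Commute.one_left _).sub_left (Commute.refl V)).pow_right i
  rw [← h2] at h1
  exact (h3.isUnit_mul_iff.1 h1).1

theorem volterra_eq_unique (A : ι → C(Icc (0 : ℝ) T, G →L[ℝ] G)) [CompleteSpace G]
    {u v w : C(Icc (0 : ℝ) T, G)} (hu : u = w + volterra hT hJ A u)
    (hv : v = w + volterra hT hJ A v) : u = v := by
  obtain ⟨U, hU⟩ := isUnit_one_sub_volterra hT hJ A
  have h1 : (1 - volterra hT hJ A) u = w := by
    rw [sub_apply, one_apply_eq_self]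
    exact sub_eq_of_eq_add hu
  have h2 : (1 - volterra hT hJ A) v = w := by
    rw [sub_apply, one_apply_eq_self]
    exact sub_eq_of_eq_add hv
  rw [← hU] at h1 h2
  have h3 : ∀ x, (↑U⁻¹ : C(Icc (0 : ℝ) T, G) →L[ℝ] C(Icc (0 : ℝ) T, G)) ((U : C(Icc (0 : ℝ) T, G) →L[ℝ] C(Icc (0 : ℝ) T, G)) x) = x := fun x => by
    rw [← mul_apply_eq_comp, Units.inv_mul, one_apply_eq_self]
  rw [← h3 u, h1, ← h2, h3]

theorem exists_volterra_eq (A : ι → C(Icc (0 : ℝ) T, G →L[ℝ] G)) [CompleteSpace G]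
    (w : C(Icc (0 : ℝ) T, G)) : ∃ u, u = w + volterra hT hJ A u := by
  obtain ⟨U, hU⟩ := isUnit_one_sub_volterra hT hJ A
  refine ⟨(↑U⁻¹ : C(Icc (0 : ℝ) T, G) →L[ℝ] C(Icc (0 : ℝ) T, G)) w, ?_⟩
  have h3 : (1 - volterra hT hJ A) ((↑U⁻¹ : C(Icc (0 : ℝ) T, G) →L[ℝ] C(Icc (0 : ℝ) T, G)) w) = w := by
    rw [← hU, ← mul_apply_eq_comp, Units.mul_inv, one_apply_eq_self]
  rw [sub_apply, one_apply_eq_self] at h3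
  exact sub_eq_iff_eq_add.1 h3

end Volterra

/-! ### Geometry of the time strips and integration over them. -/

namespace PiecewiseSystem

section Strips

open MeasureTheory

variable {E : Type*} [NormedAddCommGroup E] [NormedSpace ℝ E] {n k : ℕ}
  (S : PiecewiseSystem E n k)

theorem strip_zero (j : Fin n) : S.strip 0 j = Icc (S.t j.castSucc) (S.t j.succ) := by
  simp [strip]

theorem measurableSet_strip (q : ℤ) (j : Fin n) : MeasurableSet (S.strip q j) := measurableSet_Icc

theorem t_nonneg (i : Fin (n + 1)) : 0 ≤ S.t i := by
  rw [← S.t_zero]; exact S.t_strictMono.monotone (Fin.zero_le _)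

theorem t_le_T (i : Fin (n + 1)) : S.t i ≤ S.T := by
  rw [← S.t_last]; exact S.t_strictMono.monotone (Fin.le_last _)

theorem t_castSucc_lt (j : Fin n) : S.t j.castSucc < S.t j.succ :=
  S.t_strictMono (Fin.castSucc_lt_succ)

theorem strip_subset (j : Fin n) : S.strip 0 j ⊆ Icc 0 S.T := by
  rw [strip_zero]; exact Icc_subset_Icc (S.t_nonneg _) (S.t_le_T _)

theorem exists_mem_Ico {s : ℝ} (hs : s ∈ Ico 0 S.T) :
    ∃ j : Fin n, s ∈ Ico (S.t j.castSucc) (S.t j.succ) := by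
  -- The strip starts at the largest index i with t_i ≤ s; since s < T, this is not the last index.
  let P := (Finset.univ : Finset (Fin (n + 1))).filter fun i => S.t i ≤ s
  have hP : P.Nonempty := ⟨0, by simp [P, S.t_zero, hs.1]⟩
  have hmem := (Finset.mem_filter.1 (P.max'_mem hP)).2
  have hne : P.max' hP ≠ Fin.last n := by
    intro h
    rw [h, S.t_last] at hmem
    exact absurd hs.2 (not_lt.2 hmem)
  obtain ⟨j, hj⟩ := Fin.exists_castSucc_eq.2 hne
  refine ⟨j, by rw [hj]; exact hmem, ?_⟩
  by_contra hcon
  have h1 : j.succ ∈ P := Finset.mem_filter.2 ⟨Finset.mem_univ _, not_lt.1 hcon⟩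
  have h2 := P.le_max' _ h1
  rw [← hj] at h2
  exact absurd h2 (not_le.2 (Fin.castSucc_lt_succ))

theorem notMem_strip_of_mem_Ioo {i j : Fin n} (hij : i ≠ j) {s : ℝ}
    (hs : s ∈ Ioo (S.t j.castSucc) (S.t j.succ)) : s ∉ S.strip 0 i := by
  rw [strip_zero]
  intro h
  rcases lt_or_gt_of_ne hij with hlt | hlt
  · have : S.t i.succ ≤ S.t j.castSucc :=
      S.t_strictMono.monotone (by rw [Fin.le_def]; simpa using hlt)
    linarith [h.2, hs.1]
  · have : S.t j.succ ≤ S.t i.castSucc :=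
      S.t_strictMono.monotone (by rw [Fin.le_def]; simpa using hlt)
    linarith [h.1, hs.2]

theorem exists_mem_strip {s : ℝ} (hs : s ∈ Icc 0 S.T) : ∃ j : Fin n, s ∈ S.strip 0 j := by
  rcases eq_or_lt_of_le hs.2 with h | h
  · obtain _ | n := n
    · have h1 := S.t_last
      have h2 := S.t_zero
      have h3 := S.T_pos
      rw [show (Fin.last 0) = 0 from rfl, h2] at h1
      linarith
    · refine ⟨Fin.last n, ?_⟩
      rw [strip_zero, Fin.succ_last, S.t_last, h]
      exact ⟨S.t_le_T _, le_rfl⟩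
  · obtain ⟨j, hj⟩ := S.exists_mem_Ico ⟨hs.1, h⟩
    exact ⟨j, by rw [strip_zero]; exact ⟨hj.1, hj.2.le⟩⟩

theorem T_nonneg : 0 ≤ S.T := S.T_pos.le

theorem continuousOn_of_strips {Y : Type*} [TopologicalSpace Y] {x : ℝ → Y}
    (hx : ∀ j, ContinuousOn x (S.strip 0 j)) : ContinuousOn x (Icc 0 S.T) := by
  have h1 : ContinuousOn x (⋃ j, S.strip 0 j) :=
    (locallyFinite_of_finite _).continuousOn_iUnion (fun j => isClosed_Icc) hx
  exact h1.mono fun s hs => mem_iUnion.2 (S.exists_mem_strip hs)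

/-- A property which is passed on from the left to the right end of each strip, and from the left
end to all points of the strip, holds on the whole period. -/
theorem forall_mem_of_strips {P : ℝ → Prop} (h0 : P 0)
    (h : ∀ j : Fin n, P (S.t j.castSucc) → ∀ s ∈ S.strip 0 j, P s) : ∀ s ∈ Icc 0 S.T, P s := by
  have h1 : ∀ i : Fin (n + 1), P (S.t i) := by
    intro i
    induction i using Fin.induction with
    | zero => rwa [S.t_zero]
    | succ j ih => exact h j ih _ (by rw [strip_zero]; exact ⟨(S.t_castSucc_lt j).le, le_rfl⟩)
  intro s hs
  obtain ⟨j, hj⟩ := S.exists_mem_strip hs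
  exact h j (h1 _) s hj

variable {F : Type*} [NormedAddCommGroup F] [NormedSpace ℝ F]

/-- The sum of the integrals over the strips, `t ↦ ∑_j ∫_0^t χ_j w_j`. -/
noncomputable def stripIntegral (w : Fin n → C(Icc (0 : ℝ) S.T, F)) : C(Icc (0 : ℝ) S.T, F) :=
  ∑ j, indicatorIntegral S.T_nonneg (S.measurableSet_strip 0 j) (w j)

theorem stripIntegral_apply (w : Fin n → C(Icc (0 : ℝ) S.T, F)) (t : Icc (0 : ℝ) S.T) :
    S.stripIntegral w t =
      ∑ j, ∫ s in (0 : ℝ)..t, (S.strip 0 j).indicator (IccExtend S.T_nonneg (w j)) s := by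
  simp [stripIntegral, ContinuousMap.sum_apply, indicatorIntegral_apply]

theorem stripIntegral_zero (w : Fin n → C(Icc (0 : ℝ) S.T, F)) :
    S.stripIntegral w ⟨0, left_mem_Icc.2 S.T_nonneg⟩ = 0 := by
  simp [stripIntegral_apply]

/-- Between the left end of strip `j` and `s`, every other strip is met in endpoints at most, so
only the j-th integrand contributes. -/
theorem stripIntegral_sub [CompleteSpace F] (w : Fin n → C(Icc (0 : ℝ) S.T, F)) (j : Fin n)
    {s : ℝ} (hs : s ∈ S.strip 0 j) :
    IccExtend S.T_nonneg (S.stripIntegral w) s =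
      IccExtend S.T_nonneg (S.stripIntegral w) (S.t j.castSucc) +
        ∫ r in (S.t j.castSucc)..s, IccExtend S.T_nonneg (w j) r := by
  have hs' := S.strip_subset j hs
  have ht' : S.t j.castSucc ∈ Icc (0 : ℝ) S.T := ⟨S.t_nonneg _, S.t_le_T _⟩
  rw [IccExtend_of_mem _ _ hs', IccExtend_of_mem _ _ ht', stripIntegral_apply, stripIntegral_apply]
  have hint : ∀ (i : Fin n) (a b : ℝ), IntervalIntegrable
      ((S.strip 0 i).indicator (IccExtend S.T_nonneg (w i))) volume a b := fun i a b =>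
    intervalIntegrable_indicator (w i).continuous.Icc_extend' (S.measurableSet_strip 0 i) a b
  rw [strip_zero] at hs
  have h1 : ∀ i : Fin n, (∫ r in (0 : ℝ)..s, (S.strip 0 i).indicator
      (IccExtend S.T_nonneg (w i)) r) = (∫ r in (0 : ℝ)..(S.t j.castSucc),
      (S.strip 0 i).indicator (IccExtend S.T_nonneg (w i)) r) +
      if i = j then ∫ r in (S.t j.castSucc)..s, IccExtend S.T_nonneg (w j) r else 0 := by
    intro i
    rw [← intervalIntegral.integral_add_adjacent_intervals (hint i 0 (S.t j.castSucc))
      (hint i (S.t j.castSucc) s)]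
    congr 1
    split_ifs with hij
    · subst hij
      refine intervalIntegral.integral_congr fun r hr => ?_
      rw [uIcc_of_le hs.1] at hr
      refine indicator_of_mem ?_ _
      rw [strip_zero]
      exact ⟨hr.1, hr.2.trans hs.2⟩
    · rw [intervalIntegral.integral_congr_Ioo_of_le (g := fun _ => 0) hs.1 fun r hr => ?_]
      · simp
      · exact indicator_of_notMem
          (S.notMem_strip_of_mem_Ioo hij ⟨hr.1, hr.2.trans_le hs.2⟩) _
  simp only [h1]
  rw [Finset.sum_add_distrib]
  simp

theorem hasDerivWithinAt_stripIntegral [CompleteSpace F] (w : Fin n → C(Icc (0 : ℝ) S.T, F))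
    (j : Fin n) {s : ℝ} (hs : s ∈ S.strip 0 j) :
    HasDerivWithinAt (IccExtend S.T_nonneg (S.stripIntegral w))
      (IccExtend S.T_nonneg (w j) s) (S.strip 0 j) s := by
  have hc : Continuous (IccExtend S.T_nonneg (w j)) := (w j).continuous.Icc_extend'
  have h1 := ((hc.integral_hasStrictDerivAt (S.t j.castSucc) s).hasDerivAt.const_add
    (IccExtend S.T_nonneg (S.stripIntegral w) (S.t j.castSucc))).hasDerivWithinAt
    (s := S.strip 0 j)
  exact h1.congr (fun r hr => S.stripIntegral_sub w j hr) (S.stripIntegral_sub w j hs)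

/-- On each strip the difference has zero derivative, and equality passes from strip to strip
through the common endpoints. -/
theorem eqOn_of_hasDerivWithinAt_strip [CompleteSpace F] {x y : ℝ → F} {f : Fin n → ℝ → F}
    (h0 : x 0 = y 0)
    (hx : ∀ j, ∀ s ∈ S.strip 0 j, HasDerivWithinAt x (f j s) (S.strip 0 j) s)
    (hy : ∀ j, ∀ s ∈ S.strip 0 j, HasDerivWithinAt y (f j s) (S.strip 0 j) s) :
    EqOn x y (Icc 0 S.T) := by
  refine S.forall_mem_of_strips (P := fun s => x s = y s) h0 fun j hj s hs => ?_
  have hd : ∀ s ∈ S.strip 0 j, HasDerivWithinAt (x - y) 0 (S.strip 0 j) s := fun s hs => by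
    simpa using (hx j s hs).sub (hy j s hs)
  rw [strip_zero] at hd hs
  have h1 := constant_of_derivWithin_zero (f := x - y)
    (fun s hs => (hd s hs).differentiableWithinAt)
    (fun r hr => (hd r ⟨hr.1, hr.2.le⟩).derivWithin
      (uniqueDiffOn_Icc (S.t_castSucc_lt j) r ⟨hr.1, hr.2.le⟩)) s hs
  simp only [Pi.sub_apply, hj, sub_self] at h1
  exact sub_eq_zero.1 h1

/-- A function with prescribed continuous derivatives on the strips is their integral. -/
theorem eq_add_stripIntegral [CompleteSpace F] {x : ℝ → F} {w : Fin n → C(Icc (0 : ℝ) S.T, F)}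
    (hx : ∀ j, ∀ s ∈ S.strip 0 j,
      HasDerivWithinAt x (IccExtend S.T_nonneg (w j) s) (S.strip 0 j) s) (t : Icc (0 : ℝ) S.T) :
    x t = x 0 + S.stripIntegral w t := by
  have h1 := S.eqOn_of_hasDerivWithinAt_strip
    (y := fun s => x 0 + IccExtend S.T_nonneg (S.stripIntegral w) s)
    (f := fun j => IccExtend S.T_nonneg (w j)) (by
      rw [IccExtend_of_mem _ _ (left_mem_Icc.2 S.T_nonneg), stripIntegral_zero, add_zero]) hx
    (fun j s hs => (S.hasDerivWithinAt_stripIntegral w j hs).const_add _) t.2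
  rw [h1]
  simp

end Strips

end PiecewiseSystem

/-! ### Affine maps into spaces of continuous functions. -/

section Embeddings

variable {K : Type*} [TopologicalSpace K] [CompactSpace K]
  {E : Type*} [NormedAddCommGroup E] [NormedSpace ℝ E]

/-- Constant maps, as a continuous linear map. -/
noncomputable def constCLM (K E : Type*) [TopologicalSpace K] [CompactSpace K]
    [NormedAddCommGroup E] [NormedSpace ℝ E] : E →L[ℝ] C(K, E) :=
  LinearMap.mkContinuous
    { toFun := fun z => ContinuousMap.const K z
      map_add' := fun _ _ => rfl
      map_smul' := fun _ _ => rfl } 1 (fun z => by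
    rw [ContinuousMap.norm_le _ (by positivity)]
    intro s
    rw [one_mul]
    exact le_rfl)

@[simp]
theorem constCLM_apply (z : E) (s : K) : constCLM K E z s = z := rfl

variable {T : ℝ}

/-- The linear part of `graphMap`. -/
noncomputable def graphCLM (T : ℝ) (E : Type*) [NormedAddCommGroup E] [NormedSpace ℝ E] :
    C(Icc (0 : ℝ) T, E) × ℝ →L[ℝ] C(Icc (0 : ℝ) T, ℝ × E × ℝ) :=
  LinearMap.mkContinuous
    { toFun := fun p => ⟨fun s => (0, p.1 s, p.2), by fun_prop⟩
      map_add' := fun p q => by ext s <;> simp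
      map_smul' := fun c p => by ext s <;> simp } 1 (fun p => by
    rw [ContinuousMap.norm_le _ (by positivity)]
    intro s
    simp only [LinearMap.coe_mk, AddHom.coe_mk, ContinuousMap.coe_mk, one_mul]
    rw [Prod.norm_def, Prod.norm_def, Prod.norm_def]
    simp only [norm_zero]
    refine max_le (le_max_of_le_left (norm_nonneg p.1)) (max_le_max ?_ le_rfl)
    exact ContinuousMap.norm_coe_le_norm _ _)

@[simp]
theorem graphCLM_apply (p : C(Icc (0 : ℝ) T, E) × ℝ) (s : Icc (0 : ℝ) T) :
    graphCLM T E p s = (0, p.1 s, p.2) := rfl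

/-- The map `(u, ε) ↦ (s ↦ (s, u s, ε))`. -/
noncomputable def graphMap (p : C(Icc (0 : ℝ) T, E) × ℝ) : C(Icc (0 : ℝ) T, ℝ × E × ℝ) :=
  (⟨fun s => ((s : ℝ), 0, 0), by fun_prop⟩ : C(Icc (0 : ℝ) T, ℝ × E × ℝ)) + graphCLM T E p

@[simp]
theorem graphMap_apply (p : C(Icc (0 : ℝ) T, E) × ℝ) (s : Icc (0 : ℝ) T) :
    graphMap p s = ((s : ℝ), p.1 s, p.2) := by
  simp [graphMap]

theorem contDiff_graphMap {n : WithTop ℕ∞} :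
    ContDiff ℝ n (graphMap : C(Icc (0 : ℝ) T, E) × ℝ → C(Icc (0 : ℝ) T, ℝ × E × ℝ)) :=
  contDiff_const.add (graphCLM T E).contDiff

end Embeddings

/-! ### Implicit function theorem for fixed points. -/

section FixedPoint

variable {P U : Type*} [NormedAddCommGroup P] [NormedSpace ℝ P] [CompleteSpace P]
  [NormedAddCommGroup U] [NormedSpace ℝ U] [CompleteSpace U]

/-- Nondegenerate fixed points depend smoothly on parameters. -/
theorem ContDiffAt.exists_fixedPoint {n : WithTop ℕ∞} (hn : n ≠ 0) {N : P × U → U} {p₀ : P} {u₀ : U}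
    (hN : ContDiffAt ℝ n N (p₀, u₀)) (h₀ : N (p₀, u₀) = u₀) {V : U →L[ℝ] U}
    (hV : HasFDerivAt (fun u => N (p₀, u)) V u₀) (hunit : IsUnit (1 - V)) :
    ∃ X : P → U, X p₀ = u₀ ∧ ContDiffAt ℝ n X p₀ ∧ ∀ᶠ p in 𝓝 p₀, X p = N (p, X p) := by
  let Φ : P × U → U := fun p => p.2 - N p
  have hΦ : ContDiffAt ℝ n Φ (p₀, u₀) := contDiffAt_snd.sub hN
  have h1 : fderiv ℝ Φ (p₀, u₀) ∘L ContinuousLinearMap.inr ℝ P U = 1 - V := by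
    have h2 : HasFDerivAt (fun u => Φ (p₀, u))
        (fderiv ℝ Φ (p₀, u₀) ∘L ContinuousLinearMap.inr ℝ P U) u₀ :=
      HasFDerivAt.comp u₀ (hΦ.differentiableAt hn).hasFDerivAt (hasFDerivAt_prodMk_right p₀ u₀)
    exact h2.unique ((hasFDerivAt_id u₀).sub hV)
  have hinv : (fderiv ℝ Φ (p₀, u₀) ∘L ContinuousLinearMap.inr ℝ P U).IsInvertible := by
    rw [h1]
    obtain ⟨U, hU⟩ := hunit
    exact ⟨ContinuousLinearEquiv.unitsEquiv ℝ _ U, by rw [← hU]; rfl⟩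
  have h0 : Φ (p₀, u₀) = 0 := sub_eq_zero.2 h₀.symm
  refine ⟨hΦ.implicitFunction hn hinv, hΦ.implicitFunction_apply_self hn hinv,
    hΦ.contDiffAt_implicitFunction hn hinv, ?_⟩
  filter_upwards [hΦ.eventually_apply_implicitFunction hn hinv] with p hp
  rw [h0] at hp
  exact sub_eq_zero.1 hp

end FixedPoint

/-! ### The flow on [0, T]: smooth dependence and uniqueness. Time is kept as a variable of
`fieldMap`, so that the right-hand side along `u` is a superposition operator on the graph of `u`.
-/

namespace PiecewiseSystem

section Flow

variable {E : Type u} [NormedAddCommGroup E] [NormedSpace ℝ E] {n k : ℕ}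
  (S : PiecewiseSystem E n k)

/-- The right-hand side on the `j`-th strip as a function of `(s, x, ε)`. -/
def fieldMap (j : Fin n) (p : ℝ × E × ℝ) : E := S.field p.2.2 j p.1 p.2.1

/-- The common domain of the right-hand sides. -/
def fieldDomain : Set (ℝ × E × ℝ) := univ ×ˢ S.D ×ˢ Ioo (-S.ε₀) S.ε₀

theorem isOpen_fieldDomain : IsOpen S.fieldDomain :=
  isOpen_univ.prod (S.isOpen_D.prod isOpen_Ioo)

theorem contDiffOn_fieldMap (j : Fin n) :
    ContDiffOn ℝ ((k + 1 : ℕ) : WithTop ℕ∞) (S.fieldMap j) S.fieldDomain := by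
  unfold fieldMap field
  refine ContDiffOn.add (ContDiffOn.sum fun i hi => ?_) ?_
  · have hi : i ≤ k := Nat.lt_succ_iff.1 (Finset.mem_range.1 hi)
    refine ContDiffOn.smul (ContDiff.contDiffOn (by fun_prop)) ?_
    exact (S.contDiffOn_F i hi j).comp (f := fun p : ℝ × E × ℝ => (p.1, p.2.1))
      (ContDiff.contDiffOn (by fun_prop)) fun p hp => ⟨mem_univ _, hp.2.1⟩
  · exact ContDiffOn.smul (ContDiff.contDiffOn (by fun_prop)) (S.contDiffOn_R j)

/-- The restrictions to the strips of the right-hand side along `u`. -/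
noncomputable def fieldAlong (j : Fin n) (p : C(Icc (0 : ℝ) S.T, E) × ℝ) : C(Icc (0 : ℝ) S.T, E) :=
  nemytskii (S.fieldMap j) (graphMap p)

/-- `u` solves the system with parameter `ε` and initial value `z` on `[0, T]`, in the form of an
integral equation. -/
structure IsFlow (z : E) (ε : ℝ) (u : C(Icc (0 : ℝ) S.T, E)) : Prop where
  mem : u ∈ mapsInto (Icc (0 : ℝ) S.T) S.D
  lt : |ε| < S.ε₀
  eq : u = constCLM _ E z + S.stripIntegral fun j => S.fieldAlong j (u, ε)

variable {S}

theorem graphMap_mem {u : C(Icc (0 : ℝ) S.T, E)} {ε : ℝ}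
    (hu : u ∈ mapsInto (Icc (0 : ℝ) S.T) S.D) (hε : |ε| < S.ε₀) :
    graphMap (u, ε) ∈ mapsInto (Icc (0 : ℝ) S.T) S.fieldDomain := fun s => by
  rw [graphMap_apply]
  exact ⟨mem_univ _, hu s, abs_lt.1 hε⟩

theorem fieldAlong_apply {u : C(Icc (0 : ℝ) S.T, E)} {ε : ℝ}
    (hu : u ∈ mapsInto (Icc (0 : ℝ) S.T) S.D) (hε : |ε| < S.ε₀) (j : Fin n)
    (s : Icc (0 : ℝ) S.T) : S.fieldAlong j (u, ε) s = S.field ε j s (u s) := by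
  rw [fieldAlong, nemytskii_apply (S.contDiffOn_fieldMap j).continuousOn (graphMap_mem hu hε),
    graphMap_apply]
  rfl

theorem contDiffAt_fieldAlong {u : C(Icc (0 : ℝ) S.T, E)} {ε : ℝ}
    (hu : u ∈ mapsInto (Icc (0 : ℝ) S.T) S.D) (hε : |ε| < S.ε₀) (j : Fin n) :
    ContDiffAt ℝ ((k + 1 : ℕ) : WithTop ℕ∞) (S.fieldAlong j) (u, ε) := by
  have h1 := (contDiffOn_nemytskii (K := Icc (0 : ℝ) S.T) S.isOpen_fieldDomain (k + 1)
    (S.contDiffOn_fieldMap j)).contDiffAt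
      ((isOpen_mapsInto S.isOpen_fieldDomain).mem_nhds (graphMap_mem hu hε))
  exact ContDiffAt.comp (u, ε) h1 contDiff_graphMap.contDiffAt

/-- The derivative in `x` of the right-hand side on the `j`-th strip along `u`. -/
noncomputable def linearization (S : PiecewiseSystem E n k) (ε : ℝ) (u : C(Icc (0 : ℝ) S.T, E))
    (j : Fin n) : C(Icc (0 : ℝ) S.T, E →L[ℝ] E) :=
  nemytskii (fun p => (fderiv ℝ (S.fieldMap j) p).comp
    ((ContinuousLinearMap.inr ℝ ℝ (E × ℝ)).comp (ContinuousLinearMap.inl ℝ E ℝ))) (graphMap (u, ε))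

theorem continuousOn_fderiv_fieldMap (j : Fin n) :
    ContinuousOn (fderiv ℝ (S.fieldMap j)) S.fieldDomain :=
  (S.contDiffOn_fieldMap j).continuousOn_fderiv_of_isOpen S.isOpen_fieldDomain (by simp)

theorem linearization_apply {u : C(Icc (0 : ℝ) S.T, E)} {ε : ℝ}
    (hu : u ∈ mapsInto (Icc (0 : ℝ) S.T) S.D) (hε : |ε| < S.ε₀) (j : Fin n)
    (s : Icc (0 : ℝ) S.T) (v : E) :
    S.linearization ε u j s v = fderiv ℝ (S.fieldMap j) ((s : ℝ), u s, ε) (0, v, 0) := by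
  rw [linearization, nemytskii_apply (Ω := S.fieldDomain) _ (graphMap_mem hu hε), graphMap_apply]
  · rfl
  · exact (continuousOn_fderiv_fieldMap j).clm_comp continuousOn_const

theorem hasFDerivAt_fieldAlong_left {u : C(Icc (0 : ℝ) S.T, E)} {ε : ℝ}
    (hu : u ∈ mapsInto (Icc (0 : ℝ) S.T) S.D) (hε : |ε| < S.ε₀) (j : Fin n) :
    HasFDerivAt (fun w => S.fieldAlong j (w, ε)) (pointwiseApply (S.linearization ε u j)) u := by
  have h1 := hasFDerivAt_nemytskii (K := Icc (0 : ℝ) S.T) S.isOpen_fieldDomain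
    (f := S.fieldMap j) (f' := fderiv ℝ (S.fieldMap j))
    (fun p hp => (((S.contDiffOn_fieldMap j).contDiffAt
      (S.isOpen_fieldDomain.mem_nhds hp)).differentiableAt (by simp)).hasFDerivAt)
    (continuousOn_fderiv_fieldMap j) (graphMap_mem hu hε)
  have h2 : HasFDerivAt (fun w : C(Icc (0 : ℝ) S.T, E) => graphMap (w, ε))
      ((graphCLM S.T E).comp (ContinuousLinearMap.inl ℝ _ ℝ)) u := by
    have h3 : (fun w : C(Icc (0 : ℝ) S.T, E) => graphMap (w, ε)) = fun w =>
        graphMap (0, ε) + ((graphCLM S.T E).comp (ContinuousLinearMap.inl ℝ _ ℝ)) w := by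
      funext w
      ext s <;> simp
    rw [h3]
    exact (ContinuousLinearMap.hasFDerivAt _).const_add _
  have h3 := HasFDerivAt.comp u h1 h2
  refine h3.congr_fderiv ?_
  ext v s
  rw [pointwiseApply_apply, linearization_apply hu hε]
  change nemytskii (fderiv ℝ (S.fieldMap j)) (graphMap (u, ε)) s (0, v s, 0) = _
  rw [nemytskii_apply (continuousOn_fderiv_fieldMap j) (graphMap_mem hu hε), graphMap_apply]

theorem field_zero (j : Fin n) (s : ℝ) (x : E) : S.field 0 j s x = S.F 0 j s x := by
  simp [field, Finset.sum_range_succ']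

variable [CompleteSpace E]

/-- The solutions near a given solution on `[0, T]` depend smoothly on the initial value and the
parameter. -/
theorem IsFlow.exists_contDiffAt {z₀ : E} {ε : ℝ} {u₀ : C(Icc (0 : ℝ) S.T, E)}
    (h₀ : S.IsFlow z₀ ε u₀) :
    ∃ X : E × ℝ → C(Icc (0 : ℝ) S.T, E), X (z₀, ε) = u₀ ∧
      ContDiffAt ℝ ((k + 1 : ℕ) : WithTop ℕ∞) X (z₀, ε) ∧
      ∀ᶠ p in 𝓝 (z₀, ε), S.IsFlow p.1 p.2 (X p) := by
  -- The right side of the integral equation; the strips enter only through fixed linear operators,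
  -- so the jumps in time do not affect smoothness.
  let N : (E × ℝ) × C(Icc (0 : ℝ) S.T, E) → C(Icc (0 : ℝ) S.T, E) := fun p =>
    constCLM _ E p.1.1 + S.stripIntegral fun j => S.fieldAlong j (p.2, p.1.2)
  have hN : ContDiffAt ℝ ((k + 1 : ℕ) : WithTop ℕ∞) N ((z₀, ε), u₀) := by
    refine ContDiffAt.add ?_ ?_
    · exact ContDiffAt.continuousLinearMap_comp (constCLM (Icc (0 : ℝ) S.T) E)
        contDiffAt_fst.fst
    · refine ContDiffAt.sum fun j _ => ?_
      refine ContDiffAt.continuousLinearMap_comp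
        (indicatorIntegral (F := E) S.T_nonneg (S.measurableSet_strip 0 j)) ?_
      have hf : ContDiffAt ℝ ((k + 1 : ℕ) : WithTop ℕ∞)
          (fun p : (E × ℝ) × C(Icc (0 : ℝ) S.T, E) => (p.2, p.1.2)) ((z₀, ε), u₀) :=
        contDiffAt_snd.prodMk contDiffAt_fst.snd
      have hg : ContDiffAt ℝ ((k + 1 : ℕ) : WithTop ℕ∞) (S.fieldAlong j)
          ((fun p : (E × ℝ) × C(Icc (0 : ℝ) S.T, E) => (p.2, p.1.2)) ((z₀, ε), u₀)) :=
        contDiffAt_fieldAlong h₀.mem h₀.lt j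
      have hgf := ContDiffAt.comp ((z₀, ε), u₀) hg hf
      exact hgf
  have hV : HasFDerivAt (fun u => N ((z₀, ε), u))
      (volterra S.T_nonneg (fun j => S.measurableSet_strip 0 j) (S.linearization ε u₀)) u₀ := by
    simp only [N, stripIntegral, volterra]
    refine HasFDerivAt.const_add _ (HasFDerivAt.fun_sum fun j _ => ?_)
    exact HasFDerivAt.comp u₀ (ContinuousLinearMap.hasFDerivAt
      (indicatorIntegral (F := E) S.T_nonneg (S.measurableSet_strip 0 j)))
      (hasFDerivAt_fieldAlong_left h₀.mem h₀.lt j)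
  obtain ⟨X, hX0, hX, hXe⟩ := hN.exists_fixedPoint (by simp) h₀.eq.symm hV
    (isUnit_one_sub_volterra _ _ _)
  refine ⟨X, hX0, hX, ?_⟩
  have e1 : ∀ᶠ p in 𝓝 (z₀, ε), X p ∈ mapsInto (Icc (0 : ℝ) S.T) S.D :=
    hX.continuousAt.eventually ((isOpen_mapsInto S.isOpen_D).mem_nhds (by rw [hX0]; exact h₀.mem))
  have e2 : ∀ᶠ p in 𝓝 (z₀, ε), |p.2| < S.ε₀ :=
    (Continuous.tendsto (by fun_prop : Continuous fun p : E × ℝ => |p.2|) (z₀, ε)).eventually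
      (gt_mem_nhds h₀.lt)
  filter_upwards [e1, e2, hXe] with p hp1 hp2 hp3
  exact ⟨hp1, hp2, hp3⟩

/-- A solution of the integral equation solves the system. -/
theorem IsFlow.isSolutionOnPeriod {z : E} {ε : ℝ} {u : C(Icc (0 : ℝ) S.T, E)}
    (h : S.IsFlow z ε u) : S.IsSolutionOnPeriod (S.field ε) 0 (IccExtend S.T_nonneg u) := by
  intro j s hs
  have hs' := S.strip_subset j hs
  refine ⟨h.mem _, ?_⟩
  have h1 := (S.hasDerivWithinAt_stripIntegral (fun j => S.fieldAlong j (u, ε)) j hs).const_add z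
  rw [IccExtend_of_mem _ _ hs', fieldAlong_apply h.mem h.lt] at h1
  rw [IccExtend_of_mem _ _ hs']
  have h2 : IccExtend S.T_nonneg u = fun r => z + IccExtend S.T_nonneg
      (S.stripIntegral fun j => S.fieldAlong j (u, ε)) r := by
    funext r
    conv_lhs => rw [h.eq]
    rfl
  rw [h2]
  exact h1

theorem IsFlow.apply_zero {z : E} {ε : ℝ} {u : C(Icc (0 : ℝ) S.T, E)} (h : S.IsFlow z ε u) :
    u ⟨0, left_mem_Icc.2 S.T_nonneg⟩ = z := by
  rw [h.eq, ContinuousMap.add_apply, stripIntegral_zero, constCLM_apply, add_zero]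

theorem isFlow_of_isSolutionOnPeriod {ε : ℝ} (hε : |ε| < S.ε₀) {x : ℝ → E}
    (hx : S.IsSolutionOnPeriod (S.field ε) 0 x) :
    ∃ u : C(Icc (0 : ℝ) S.T, E), S.IsFlow (x 0) ε u ∧ ∀ s : Icc (0 : ℝ) S.T, u s = x s := by
  have hc : ContinuousOn x (Icc 0 S.T) :=
    S.continuousOn_of_strips fun j s hs => (hx j s hs).2.continuousWithinAt
  let u : C(Icc (0 : ℝ) S.T, E) := ⟨(Icc (0 : ℝ) S.T).domRestrict x, hc.domRestrict⟩
  have hu : u ∈ mapsInto (Icc (0 : ℝ) S.T) S.D := fun s => by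
    obtain ⟨j, hj⟩ := S.exists_mem_strip s.2
    exact (hx j s hj).1
  refine ⟨u, ⟨hu, hε, ?_⟩, fun s => rfl⟩
  ext t
  refine S.eq_add_stripIntegral (w := fun j => S.fieldAlong j (u, ε)) (x := x) ?_ t
  intro j s hs
  rw [IccExtend_of_mem _ _ (S.strip_subset j hs), fieldAlong_apply hu hε]
  exact (hx j s hs).2

/-- Solutions are determined by their initial values. -/
theorem IsSolutionOnPeriod.eqOn {x y : ℝ → E}
    (hx : S.IsSolutionOnPeriod (S.F 0) 0 x) (hy : S.IsSolutionOnPeriod (S.F 0) 0 y)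
    (h0 : x 0 = y 0) : EqOn x y (Icc 0 S.T) := by
  have hxc : ContinuousOn x (Icc 0 S.T) :=
    S.continuousOn_of_strips fun j s hs => (hx j s hs).2.continuousWithinAt
  have hyc : ContinuousOn y (Icc 0 S.T) :=
    S.continuousOn_of_strips fun j s hs => (hy j s hs).2.continuousWithinAt
  have hxD : ∀ s ∈ Icc 0 S.T, x s ∈ S.D := fun s hs => by
    obtain ⟨j, hj⟩ := S.exists_mem_strip hs
    exact (hx j s hj).1
  have hyD : ∀ s ∈ Icc 0 S.T, y s ∈ S.D := fun s hs => by
    obtain ⟨j, hj⟩ := S.exists_mem_strip hs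
    exact (hy j s hj).1
  -- `D` need not be convex and the fields are only locally Lipschitz; local Lipschitz bounds become
  -- a global one on the compact union of the two graphs.
  let C : Set (ℝ × E) := (fun s => (s, x s)) '' Icc 0 S.T ∪ (fun s => (s, y s)) '' Icc 0 S.T
  have hC : IsCompact C :=
    (isCompact_Icc.image_of_continuousOn (continuousOn_id.prodMk hxc)).union
      (isCompact_Icc.image_of_continuousOn (continuousOn_id.prodMk hyc))
  have hCD : C ⊆ univ ×ˢ S.D := by
    rintro p (⟨s, hs, rfl⟩ | ⟨s, hs, rfl⟩)
    · exact ⟨mem_univ _, hxD s hs⟩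
    · exact ⟨mem_univ _, hyD s hs⟩
  have hlip : ∀ j, ∃ L, LipschitzOnWith L (fun p : ℝ × E => S.F 0 j p.1 p.2) C := by
    intro j
    refine LocallyLipschitzOn.exists_lipschitzOnWith_of_compact hC fun p hp => ?_
    have h1 : ContDiffAt ℝ 1 (fun p : ℝ × E => S.F 0 j p.1 p.2) p :=
      ((S.contDiffOn_F 0 (Nat.zero_le _) j).contDiffAt
        ((isOpen_univ.prod S.isOpen_D).mem_nhds (hCD hp))).of_le (by
          exact_mod_cast Nat.succ_le_succ (Nat.zero_le k))
    obtain ⟨L, t, ht, hL⟩ := h1.exists_lipschitzOnWith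
    exact ⟨L, t, mem_nhdsWithin_of_mem_nhds ht, hL⟩
  choose L hL using hlip
  let M : ℝ := ∑ j, (L j : ℝ)
  have hM : ∀ j, (L j : ℝ) ≤ M := fun j =>
    Finset.single_le_sum (f := fun j => (L j : ℝ)) (fun _ _ => NNReal.coe_nonneg _)
      (Finset.mem_univ j)
  -- Gronwall's inequality requires right derivatives only, and these exist at the breakpoints too,
  -- from the strip that begins there.
  have key : ∀ s ∈ Ico 0 S.T, ∃ d : E, HasDerivWithinAt (fun s => x s - y s) d (Ici s) s ∧
      ‖d‖ ≤ M * ‖x s - y s‖ + 0 := by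
    intro s hs
    obtain ⟨j, hj⟩ := S.exists_mem_Ico hs
    have hs' : s ∈ S.strip 0 j := by rw [strip_zero]; exact ⟨hj.1, hj.2.le⟩
    have hI : s ∈ Icc 0 S.T := ⟨hs.1, hs.2.le⟩
    refine ⟨S.F 0 j s (x s) - S.F 0 j s (y s), ?_, ?_⟩
    · have h1 := (hx j s hs').2.sub (hy j s hs').2
      refine h1.mono_of_mem_nhdsWithin ?_
      rw [strip_zero]
      exact mem_of_superset (Icc_mem_nhdsGE hj.2) (Icc_subset_Icc_left hj.1)
    · have h1 := (hL j).norm_sub_le (x := (s, x s)) (y := (s, y s)) (Or.inl ⟨s, hI, rfl⟩)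
        (Or.inr ⟨s, hI, rfl⟩)
      simp only [Prod.mk_sub_mk, sub_self, Prod.norm_mk, norm_zero] at h1
      rw [max_eq_right (norm_nonneg _)] at h1
      rw [add_zero]
      exact h1.trans (mul_le_mul_of_nonneg_right (hM j) (norm_nonneg _))
  choose! d hd1 hd2 using key
  intro s hs
  have h1 := norm_le_gronwallBound_of_norm_deriv_right_le (δ := 0) (hxc.sub hyc) hd1
    (by simp [h0]) hd2 s hs
  rw [gronwallBound_ε0_δ0] at h1
  exact sub_eq_zero.1 (norm_le_zero_iff.1 h1)

/-- `unperturbed` is a choice: `u` shows that a solution exists, so the choice is one, and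
uniqueness identifies the two. -/
theorem IsFlow.eq_unperturbed {z : E} {u : C(Icc (0 : ℝ) S.T, E)} (h : S.IsFlow z 0 u)
    (s : Icc (0 : ℝ) S.T) : S.unperturbed z s = u s := by
  have hsol := h.isSolutionOnPeriod
  have hF : S.field 0 = S.F 0 := by
    funext j s x
    exact field_zero j s x
  rw [hF] at hsol
  have h0 : IccExtend S.T_nonneg u 0 = z := by
    rw [IccExtend_of_mem _ _ (left_mem_Icc.2 S.T_nonneg)]; exact h.apply_zero
  have hspec : S.unperturbed z 0 = z ∧ S.IsSolutionOnPeriod (S.F 0) 0 (S.unperturbed z) :=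
    Classical.epsilon_spec (p := fun x => x 0 = z ∧ S.IsSolutionOnPeriod (S.F 0) 0 x)
      ⟨_, h0, hsol⟩
  rw [IsSolutionOnPeriod.eqOn hspec.2 hsol (hspec.1.trans h0.symm) s.2, IccExtend_val]

end Flow

end PiecewiseSystem

/-! ### The fundamental matrix and the derivative of the flow. -/

namespace PiecewiseSystem

section Fundamental

variable {E : Type u} [NormedAddCommGroup E] [NormedSpace ℝ E] {n k : ℕ}
  {S : PiecewiseSystem E n k}

theorem fderiv_F_zero {u : C(Icc (0 : ℝ) S.T, E)} (hu : u ∈ mapsInto (Icc (0 : ℝ) S.T) S.D)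
    (j : Fin n) (s : Icc (0 : ℝ) S.T) :
    fderiv ℝ (S.F 0 j s) (u s) = S.linearization 0 u j s := by
  have h0 : |(0 : ℝ)| < S.ε₀ := by simpa using S.ε₀_pos
  have hp : ((s : ℝ), u s, (0 : ℝ)) ∈ S.fieldDomain := by
    have := graphMap_mem hu h0 s
    rwa [graphMap_apply] at this
  have h1 : HasFDerivAt (S.fieldMap j) (fderiv ℝ (S.fieldMap j) ((s : ℝ), u s, 0))
      ((s : ℝ), u s, 0) :=
    (((S.contDiffOn_fieldMap j).contDiffAt
      (S.isOpen_fieldDomain.mem_nhds hp)).differentiableAt (by simp)).hasFDerivAt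
  have h2 : HasFDerivAt (fun x : E => ((s : ℝ), x, (0 : ℝ)))
      ((ContinuousLinearMap.inr ℝ ℝ (E × ℝ)).comp (ContinuousLinearMap.inl ℝ E ℝ)) (u s) :=
    (hasFDerivAt_prodMk_right (s : ℝ) (u s, (0 : ℝ))).comp (u s)
      (hasFDerivAt_prodMk_left (u s) (0 : ℝ))
  have h3 := HasFDerivAt.comp (u s) h1 h2
  have h4 : S.fieldMap j ∘ (fun x : E => ((s : ℝ), x, (0 : ℝ))) = S.F 0 j s := by
    funext x
    exact field_zero j s x
  rw [h4] at h3
  rw [h3.fderiv]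
  ext v
  rw [linearization_apply hu h0]
  rfl

/-- Integral form of a linear equation on the strips. -/
theorem eq_add_volterra {G : Type*} [NormedAddCommGroup G] [NormedSpace ℝ G] [CompleteSpace G]
    {A : Fin n → C(Icc (0 : ℝ) S.T, G →L[ℝ] G)} {x : ℝ → G} {u : C(Icc (0 : ℝ) S.T, G)}
    (hu : ∀ s : Icc (0 : ℝ) S.T, u s = x s) (r : Fin n → C(Icc (0 : ℝ) S.T, G))
    (hx : ∀ j, ∀ s, ∀ hs : s ∈ S.strip 0 j, HasDerivWithinAt x
      (r j ⟨s, S.strip_subset j hs⟩ + A j ⟨s, S.strip_subset j hs⟩ (x s)) (S.strip 0 j) s) :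
    u = constCLM _ G (x 0) + S.stripIntegral r +
      volterra S.T_nonneg (fun j => S.measurableSet_strip 0 j) A u := by
  ext t
  have h1 := S.eq_add_stripIntegral (x := x) (w := fun j => r j + pointwiseApply (A j) u)
    (fun j s hs => by
      rw [IccExtend_of_mem _ _ (S.strip_subset j hs), ContinuousMap.add_apply,
        pointwiseApply_apply, hu]
      exact hx j s hs) t
  rw [hu, h1]
  simp only [stripIntegral, volterra_apply, map_add, Finset.sum_add_distrib,
    ContinuousMap.add_apply, constCLM_apply]
  abel

theorem exists_linear_solution {G : Type*} [NormedAddCommGroup G] [NormedSpace ℝ G]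
    [CompleteSpace G] (A : Fin n → C(Icc (0 : ℝ) S.T, G →L[ℝ] G)) (y : G) :
    ∃ Y : C(Icc (0 : ℝ) S.T, G), Y ⟨0, left_mem_Icc.2 S.T_nonneg⟩ = y ∧
      ∀ j, ∀ s, ∀ hs : s ∈ S.strip 0 j, HasDerivWithinAt (IccExtend S.T_nonneg Y)
        (A j ⟨s, S.strip_subset j hs⟩ (Y ⟨s, S.strip_subset j hs⟩)) (S.strip 0 j) s := by
  obtain ⟨Y, hY⟩ := exists_volterra_eq S.T_nonneg (fun j => S.measurableSet_strip 0 j) A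
    (constCLM _ G y)
  have hY' : Y = constCLM _ G y + S.stripIntegral fun j => pointwiseApply (A j) Y := by
    rw [volterra_apply] at hY
    exact hY
  refine ⟨Y, ?_, fun j s hs => ?_⟩
  · rw [hY', ContinuousMap.add_apply, stripIntegral_zero, constCLM_apply, add_zero]
  · have h1 := (S.hasDerivWithinAt_stripIntegral (fun j => pointwiseApply (A j) Y) j hs).const_add y
    rw [IccExtend_of_mem _ _ (S.strip_subset j hs), pointwiseApply_apply] at h1
    have h2 : IccExtend S.T_nonneg Y = fun r => y + IccExtend S.T_nonneg
        (S.stripIntegral fun j => pointwiseApply (A j) Y) r := by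
      funext r
      conv_lhs => rw [hY']
      rfl
    rw [h2]
    exact h1

variable [FiniteDimensional ℝ E]

/-- The fundamental matrix along an unperturbed solution, together with its inverse. -/
theorem IsFlow.exists_fundamental {z : E} {u : C(Icc (0 : ℝ) S.T, E)} (h : S.IsFlow z 0 u) :
    ∃ Y Z : C(Icc (0 : ℝ) S.T, E →L[ℝ] E),
      (∀ s : Icc (0 : ℝ) S.T, S.fundamental z s = Y s) ∧
      Y ⟨0, left_mem_Icc.2 S.T_nonneg⟩ = ContinuousLinearMap.id ℝ E ∧
      (∀ j, ∀ s, ∀ hs : s ∈ S.strip 0 j, HasDerivWithinAt (IccExtend S.T_nonneg Y)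
        ((S.linearization 0 u j ⟨s, S.strip_subset j hs⟩).comp (Y ⟨s, S.strip_subset j hs⟩))
        (S.strip 0 j) s) ∧
      (∀ s, (Z s).comp (Y s) = ContinuousLinearMap.id ℝ E) ∧
      (∀ s, (Y s).comp (Z s) = ContinuousLinearMap.id ℝ E) := by
  have : CompleteSpace E := FiniteDimensional.complete ℝ E
  let A := S.linearization 0 u
  -- Y solves Y' = A Y, and Z below solves the adjoint equation Z' = -Z A; then (Z Y)' = 0, so Z
  -- inverts Y.
  let A' : Fin n → C(Icc (0 : ℝ) S.T, (E →L[ℝ] E) →L[ℝ] (E →L[ℝ] E)) := fun j =>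
    ⟨fun s => ContinuousLinearMap.compL ℝ E E E (A j s), by fun_prop⟩
  let A'' : Fin n → C(Icc (0 : ℝ) S.T, (E →L[ℝ] E) →L[ℝ] (E →L[ℝ] E)) := fun j =>
    ⟨fun s => -(ContinuousLinearMap.compL ℝ E E E).flip (A j s), by fun_prop⟩
  obtain ⟨Y, hY0, hY⟩ := S.exists_linear_solution A' (ContinuousLinearMap.id ℝ E)
  obtain ⟨Z, hZ0, hZ⟩ := S.exists_linear_solution A'' (ContinuousLinearMap.id ℝ E)
  have hext : ∀ (V : C(Icc (0 : ℝ) S.T, E →L[ℝ] E)) (j : Fin n) (s : ℝ) (hs : s ∈ S.strip 0 j),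
      IccExtend S.T_nonneg V s = V ⟨s, S.strip_subset j hs⟩ := fun V j s hs =>
    IccExtend_of_mem _ _ (S.strip_subset j hs)
  have hZY : ∀ s, (Z s).comp (Y s) = ContinuousLinearMap.id ℝ E := by
    intro s
    have h1 := S.eqOn_of_hasDerivWithinAt_strip
      (x := fun s => (IccExtend S.T_nonneg Z s).comp (IccExtend S.T_nonneg Y s))
      (y := fun _ => ContinuousLinearMap.id ℝ E) (f := fun _ _ => 0)
      (by
        rw [IccExtend_of_mem _ _ (left_mem_Icc.2 S.T_nonneg),
          IccExtend_of_mem _ _ (left_mem_Icc.2 S.T_nonneg), hY0, hZ0]; rfl)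
      (fun j s hs => by
        have h2 := (hZ j s hs).clm_comp (hY j s hs)
        rw [hext Y j s hs, hext Z j s hs] at h2
        have h3 : (A'' j ⟨s, S.strip_subset j hs⟩ (Z ⟨s, S.strip_subset j hs⟩)).comp
            (Y ⟨s, S.strip_subset j hs⟩) + (Z ⟨s, S.strip_subset j hs⟩).comp
            (A' j ⟨s, S.strip_subset j hs⟩ (Y ⟨s, S.strip_subset j hs⟩)) = 0 := by
          ext v
          simp [A', A'']
        rw [h3] at h2
        exact h2)
      (fun j s _ => hasDerivWithinAt_const _ _ _) s.2
    simpa using h1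
  -- In finite dimension a left inverse is a right inverse.
  have hYZ : ∀ s, (Y s).comp (Z s) = ContinuousLinearMap.id ℝ E := by
    intro s
    have h1 : (Z s : E →ₗ[ℝ] E) * (Y s : E →ₗ[ℝ] E) = 1 := by
      ext v
      exact congrArg (fun T : E →L[ℝ] E => T v) (hZY s)
    have h2 := mul_eq_one_comm.1 h1
    ext v
    exact congrArg (fun T : E →ₗ[ℝ] E => T v) h2
  refine ⟨Y, Z, ?_, hY0, hY, hZY, hYZ⟩
  have hspec : S.fundamental z 0 = ContinuousLinearMap.id ℝ E ∧
      ∀ j, ∀ s ∈ S.strip 0 j, HasDerivWithinAt (S.fundamental z)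
        ((fderiv ℝ (S.F 0 j s) (S.unperturbed z s)).comp (S.fundamental z s)) (S.strip 0 j) s := by
    refine Classical.epsilon_spec (p := fun Y : ℝ → E →L[ℝ] E =>
      Y 0 = ContinuousLinearMap.id ℝ E ∧ ∀ j, ∀ s ∈ S.strip 0 j,
      HasDerivWithinAt Y ((fderiv ℝ (S.F 0 j s) (S.unperturbed z s)).comp (Y s)) (S.strip 0 j) s)
      ⟨IccExtend S.T_nonneg Y, ?_, fun j s hs => ?_⟩
    · rw [IccExtend_of_mem _ _ (left_mem_Icc.2 S.T_nonneg), hY0]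
    · have h2 := hY j s hs
      rw [h.eq_unperturbed ⟨s, S.strip_subset j hs⟩,
        fderiv_F_zero h.mem j ⟨s, S.strip_subset j hs⟩, hext Y j s hs]
      exact h2
  have hc : ContinuousOn (S.fundamental z) (Icc 0 S.T) :=
    S.continuousOn_of_strips fun j s hs => (hspec.2 j s hs).continuousWithinAt
  let Y' : C(Icc (0 : ℝ) S.T, E →L[ℝ] E) :=
    ⟨(Icc (0 : ℝ) S.T).domRestrict (S.fundamental z), hc.domRestrict⟩
  have e1 := S.eq_add_volterra (A := A') (x := S.fundamental z) (u := Y') (fun s => rfl)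
    (fun _ => 0) (fun j s hs => by
      have h2 := hspec.2 j s hs
      rw [h.eq_unperturbed ⟨s, S.strip_subset j hs⟩,
        fderiv_F_zero h.mem j ⟨s, S.strip_subset j hs⟩] at h2
      rw [ContinuousMap.zero_apply, zero_add]
      exact h2)
  have e2 := S.eq_add_volterra (A := A') (x := IccExtend S.T_nonneg Y) (u := Y) (fun s => by simp)
    (fun _ => 0) (fun j s hs => by
      rw [ContinuousMap.zero_apply, zero_add, hext Y j s hs]
      exact hY j s hs)
  rw [IccExtend_of_mem _ _ (left_mem_Icc.2 S.T_nonneg), hY0] at e2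
  rw [hspec.1] at e1
  -- The chosen matrix `S.fundamental z` and Y satisfy the same Volterra equation.
  have e3 := volterra_eq_unique _ _ _ e1 e2
  intro s
  exact congrArg (fun V : C(Icc (0 : ℝ) S.T, E →L[ℝ] E) => V s) e3

/-- The fundamental matrix is the derivative of the solution with respect to the initial value. -/
theorem IsFlow.fderiv_apply_eq_fundamental {z : E} {X : E → C(Icc (0 : ℝ) S.T, E)}
    (hX : DifferentiableAt ℝ X z) (h : ∀ᶠ z' in 𝓝 z, S.IsFlow z' 0 (X z')) (v : E)
    (s : Icc (0 : ℝ) S.T) : fderiv ℝ X z v s = S.fundamental z s v := by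
  have : CompleteSpace E := FiniteDimensional.complete ℝ E
  have hz := h.self_of_nhds
  obtain ⟨Y, Z, hY, hY0, hYd, -, -⟩ := hz.exists_fundamental
  have h0 : |(0 : ℝ)| < S.ε₀ := by simpa using S.ε₀_pos
  let A := S.linearization 0 (X z)
  let V := volterra S.T_nonneg (fun j => S.measurableSet_strip 0 j) A
  have h1 : HasFDerivAt (fun z' => constCLM (Icc (0 : ℝ) S.T) E z' +
      S.stripIntegral fun j => S.fieldAlong j (X z', 0))
      (constCLM (Icc (0 : ℝ) S.T) E + V.comp (fderiv ℝ X z)) z := by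
    refine (constCLM (Icc (0 : ℝ) S.T) E).hasFDerivAt.add ?_
    simp only [stripIntegral, V, volterra, ContinuousLinearMap.finsetSum_comp,
      ContinuousLinearMap.comp_assoc]
    refine HasFDerivAt.fun_sum fun j _ => ?_
    have h2 := HasFDerivAt.comp z (hasFDerivAt_fieldAlong_left hz.mem h0 j) hX.hasFDerivAt
    exact HasFDerivAt.comp z (ContinuousLinearMap.hasFDerivAt
      (indicatorIntegral (F := E) S.T_nonneg (S.measurableSet_strip 0 j))) h2
  -- Differentiating the integral equation in z shows that the derivative in direction v solves the
  -- same Volterra equation as Y(·) v.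
  have h2 : fderiv ℝ X z = constCLM (Icc (0 : ℝ) S.T) E + V.comp (fderiv ℝ X z) :=
    hX.hasFDerivAt.unique (h1.congr_of_eventuallyEq (by
      filter_upwards [h] with z' hz' using hz'.eq))
  have h3 : fderiv ℝ X z v = constCLM _ E v + V (fderiv ℝ X z v) :=
    congrArg (fun D : E →L[ℝ] C(Icc (0 : ℝ) S.T, E) => D v) h2
  let y : C(Icc (0 : ℝ) S.T, E) := ⟨fun s => Y s v, by fun_prop⟩
  have h4 := S.eq_add_volterra (A := A) (x := fun s => IccExtend S.T_nonneg Y s v) (u := y)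
    (fun s => by simp [y]) (fun _ => 0) (fun j s hs => by
      have h5 := (hYd j s hs).clm_apply (hasDerivWithinAt_const s (S.strip 0 j) v)
      have h6 := IccExtend_of_mem S.T_nonneg Y (S.strip_subset j hs)
      simp only [ContinuousLinearMap.comp_apply, map_zero, add_zero] at h5
      rw [ContinuousMap.zero_apply, zero_add, h6]
      exact h5)
  rw [IccExtend_of_mem _ _ (left_mem_Icc.2 S.T_nonneg), hY0] at h4
  have h5 : S.stripIntegral (fun _ => (0 : C(Icc (0 : ℝ) S.T, E))) = 0 := by
    simp [stripIntegral]
  rw [h5, add_zero] at h4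
  have h6 := volterra_eq_unique _ _ _ h3 h4
  rw [h6, hY]
  rfl

end Fundamental

end PiecewiseSystem

/-! ### Coefficients of ∑ ε^m G_m along a curve. -/

section Bracket

variable {X W : Type u} [NormedAddCommGroup X] [NormedSpace ℝ X]
  [NormedAddCommGroup W] [NormedSpace ℝ W]

/-- The coefficient of `ε^i` in the expansion of `∑_m ε^m G_m` along the curve
`x + ∑_j ε^j / j! v_j`. -/
noncomputable def expansionCoeff (i : ℕ) (G : ℕ → X → W) (x : X) (v : ℕ → X) : W :=
  ∑ l ∈ Finset.range (i + 1), faaDiBrunoSum l l (G (i - l)) x (fun j : Fin l => v (j + 1))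

/-- The part of `expansionCoeff` that does not depend on `v_i`. -/
noncomputable def expansionBracket (i : ℕ) (G : ℕ → X → W) (x : X) (v : ℕ → X) : W :=
  G i x + faaDiBrunoSum (i - 1) i (G 0) x (fun j : Fin (i - 1) => v (j + 1)) +
    ∑ l : Fin (i - 1), faaDiBrunoSum (l + 1) (l + 1) (G (i - (l + 1))) x
      (fun j : Fin (l + 1) => v (j + 1))

theorem faaDiBrunoSum_zero_zero (G : X → W) (x : X) (v : Fin 0 → X) :
    faaDiBrunoSum 0 0 G x v = G x := by
  have h : weightedTuples 0 0 = {Fin.elim0} := by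
    ext c
    simp only [mem_weightedTuples, Finset.univ_eq_empty, Finset.sum_empty, Finset.mem_singleton,
      true_iff]
    exact Subsingleton.elim _ _
  rw [faaDiBrunoSum, h, Finset.sum_singleton]
  have h2 : iteratedFDeriv ℝ (repeatedVectors (Fin.elim0 : Fin 0 → ℕ) v).length G x
      (repeatedVectors (Fin.elim0 : Fin 0 → ℕ) v).get = G x := rfl
  simp [h2]

theorem expansionCoeff_zero (G : ℕ → X → W) (x : X) (v : ℕ → X) :
    expansionCoeff 0 G x v = G 0 x := by
  rw [expansionCoeff, zero_add, Finset.sum_range_one, faaDiBrunoSum_zero_zero]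

theorem expansionCoeff_eq_add_sum (i : ℕ) (G : ℕ → X → W) (x : X) (v : ℕ → X) :
    expansionCoeff i G x v = G i x + ∑ l : Fin i, faaDiBrunoSum (l + 1) (l + 1)
      (G (i - (l + 1))) x (fun j : Fin (l + 1) => v (j + 1)) := by
  rw [expansionCoeff, Finset.sum_range_succ', faaDiBrunoSum_zero_zero, add_comm, Nat.sub_zero,
    Finset.sum_range]

/-- The vector `v i` occurs only in the summand l = i, and there linearly, by
`faaDiBrunoSum_succ_succ`. This makes the recursions for y_i and γ_i linear in the unknown. -/
theorem expansionCoeff_eq_bracket {i : ℕ} (hi : 1 ≤ i) {G : ℕ → X → W} {x : X}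
    (hG : ContDiffAt ℝ (i : WithTop ℕ∞) (G 0) x) (v : ℕ → X) :
    expansionCoeff i G x v =
      expansionBracket i G x v + (1 / (i ! : ℝ)) • fderiv ℝ (G 0) x (v i) := by
  obtain ⟨i, rfl⟩ := Nat.exists_eq_add_of_le' hi
  rw [expansionCoeff_eq_add_sum, Fin.sum_univ_castSucc, expansionBracket]
  simp only [Fin.val_castSucc, Fin.val_last, Nat.sub_self]
  rw [faaDiBrunoSum_succ_succ i hG v]
  change _ = G (i + 1) x + faaDiBrunoSum i (i + 1) (G 0) x (fun j : Fin i => v (j + 1)) +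
    ∑ l : Fin i, faaDiBrunoSum (l + 1) (l + 1) (G (i + 1 - (l + 1))) x
      (fun j : Fin (l + 1) => v (j + 1)) + _
  abel

theorem expansionBracket_congr {i : ℕ} {G G' : ℕ → X → W} {x : X} {v v' : ℕ → X}
    (hG : ∀ m ≤ i, G m = G' m) (hv : ∀ l, 1 ≤ l → l < i → v l = v' l) :
    expansionBracket i G x v = expansionBracket i G' x v' := by
  unfold expansionBracket
  rw [hG i le_rfl, hG 0 (Nat.zero_le _)]
  congr 2
  · congr 1
    funext j
    exact hv _ (by omega) (by have := j.2; omega)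
  · funext l
    rw [hG _ (Nat.sub_le _ _)]
    congr 1
    funext j
    exact hv _ (by omega) (by have := j.2; have := l.2; omega)

/-- Since G_m carries the factor ε^m, it is expanded to order k - m only, which needs no more than
C^{k-m}; the terms are then collected by m + l. -/
theorem ContDiffAt.sum_expansion {k : ℕ} {G : ℕ → X → W} {x : X}
    (hG : ∀ m ≤ k, ContDiffAt ℝ ((k - m : ℕ) : WithTop ℕ∞) (G m) x) (v : ℕ → X)
    {F : Filter ℝ} (hF : F ≤ 𝓝 0) {c : ℝ → X}
    (hc : (fun ε => c ε - (x + weightedCurve (fun j : Fin k => v (j + 1)) ε)) =o[F]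
      fun ε => ε ^ k) :
    (fun ε : ℝ => ∑ m ∈ Finset.range (k + 1), ε ^ m • G m (c ε) -
      ∑ i ∈ Finset.range (k + 1), ε ^ i • expansionCoeff i G x v) =o[F] fun ε : ℝ => ε ^ k := by
  have h1 : ∀ m ∈ Finset.range (k + 1), (fun ε : ℝ => ε ^ m • (G m (c ε) -
      ∑ l ∈ Finset.range (k - m + 1), ε ^ l •
        faaDiBrunoSum l l (G m) x (fun j : Fin l => v (j + 1)))) =o[F] fun ε : ℝ => ε ^ k := by
    intro m hm
    have hm : m ≤ k := Nat.lt_succ_iff.1 (Finset.mem_range.1 hm)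
    have h2 : (fun ε => c ε - (x + weightedCurve (fun j : Fin (k - m) => v (j + 1)) ε)) =o[F]
        fun ε => ε ^ (k - m) := by
      have h3 := ((weightedCurve_sub_isLittleO (Nat.sub_le k m) v).mono hF).add
        (hc.trans_isBigO ((isBigO_pow_pow_of_le (Nat.sub_le k m)).mono hF))
      refine h3.congr_left fun ε => ?_
      abel
    have h4 := (hG m hm).expansion_comp v hF h2
    refine ((isBigO_refl (fun ε : ℝ => ε ^ m) F).smul_isLittleO h4).congr_right fun ε => ?_
    rw [smul_eq_mul, ← pow_add]
    congr 1
    omega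
  refine (IsLittleO.fun_sum h1).congr_left fun ε => ?_
  simp only [smul_sub, Finset.sum_sub_distrib]
  congr 1
  simp only [expansionCoeff, Finset.smul_sum, smul_smul, ← pow_add]
  have h5 := Finset.sum_range_diag_flip (k + 1) (fun l m =>
    ε ^ (m + l) • faaDiBrunoSum l l (G m) x (fun j : Fin l => v (j + 1)))
  have h6 := Finset.sum_range_diag_flip (k + 1) (fun m l =>
    ε ^ (m + l) • faaDiBrunoSum l l (G m) x (fun j : Fin l => v (j + 1)))
  have h7 : ∀ m ∈ Finset.range (k + 1), k - m + 1 = k + 1 - m := fun m hm => by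
    have := Finset.mem_range.1 hm; omega
  rw [Finset.sum_congr rfl fun m hm => by rw [h7 m hm], ← h6]
  refine Finset.sum_congr rfl fun i _ => ?_
  rw [← Finset.sum_range_reflect]
  refine Finset.sum_congr rfl fun l hl => ?_
  have hl : l ≤ i := Nat.lt_succ_iff.1 (Finset.mem_range.1 hl)
  have e1 : i + 1 - 1 - l = i - l := by omega
  have e2 : i - (i - l) = l := by omega
  rw [e1, e2]
  congr 1
  congr 1
  omega

end Bracket

/-! ### The functions y_i as coefficients of the flow in ε. -/

namespace PiecewiseSystem

section Expansion

variable {E : Type u} [NormedAddCommGroup E] [NormedSpace ℝ E] {n k : ℕ}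
  {S : PiecewiseSystem E n k}

theorem yFun_eq_bracket (S : PiecewiseSystem E n k) (z : E) (i : ℕ) (τ : ℝ) :
    S.yFun z i τ = (i ! : ℝ) • S.fundamental z τ (∫ s in (0 : ℝ)..τ,
      (S.fundamental z s).inverse (expansionBracket i (fun m => S.piecewiseF m s)
        (S.unperturbed z s) (fun l => S.yFun z l s))) := by
  rw [yFun]
  rfl

/-- The open strip matters: at an interior breakpoint two indicators are active and `piecewiseF`
adds two fields. -/
theorem piecewiseF_eq {m : ℕ} {j : Fin n} {s : ℝ} (hs : s ∈ Ioo (S.t j.castSucc) (S.t j.succ)) :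
    S.piecewiseF m s = S.F m j s := by
  funext x
  unfold piecewiseF
  rw [Finset.sum_eq_single j]
  · refine indicator_of_mem ?_ _
    rw [strip_zero]
    exact ⟨hs.1.le, hs.2.le⟩
  · intro i _ hij
    exact indicator_of_notMem (S.notMem_strip_of_mem_Ioo hij hs) _
  · intro h
    exact absurd (Finset.mem_univ j) h

theorem contDiffAt_F {m : ℕ} (hm : m ≤ k) (j : Fin n) (s : ℝ) {x : E} (hx : x ∈ S.D) :
    ContDiffAt ℝ ((k + 1 : ℕ) : WithTop ℕ∞) (S.F m j s) x := by
  have h1 : ContDiffAt ℝ ((k + 1 : ℕ) : WithTop ℕ∞) (fun p : ℝ × E => S.F m j p.1 p.2) (s, x) :=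
    (S.contDiffOn_F m hm j).contDiffAt
      ((isOpen_univ.prod S.isOpen_D).mem_nhds ⟨mem_univ _, hx⟩)
  exact h1.comp x (contDiffAt_const.prodMk contDiffAt_id)

theorem isBigO_R_comp {j : Fin n} {s : ℝ} {x : E} (hx : x ∈ S.D) {c : ℝ → E}
    (hc : Tendsto c (𝓝 0) (𝓝 x)) :
    (fun ε => S.R j s (c ε) ε) =O[𝓝 0] fun _ => (1 : ℝ) := by
  have h1 : ContinuousAt (fun p : ℝ × E × ℝ => S.R j p.1 p.2.1 p.2.2) (s, x, 0) :=
    (S.contDiffOn_R j).continuousOn.continuousAt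
      ((isOpen_univ.prod (S.isOpen_D.prod isOpen_Ioo)).mem_nhds
        ⟨mem_univ _, hx, by simpa using S.ε₀_pos⟩)
  have h2 : Tendsto (fun ε : ℝ => (s, c ε, ε)) (𝓝 0) (𝓝 (s, x, 0)) :=
    tendsto_const_nhds.prodMk_nhds (hc.prodMk_nhds tendsto_id)
  exact (h1.tendsto.comp h2).isBigO_one ℝ

theorem isLittleO_eval {K : Type*} [TopologicalSpace K] [CompactSpace K] {f : ℝ → C(K, E)}
    {g : ℝ → ℝ} {F : Filter ℝ} (h : f =o[F] g) (s : K) : (fun ε => f ε s) =o[F] g :=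
  (IsBigO.of_bound 1 (Eventually.of_forall fun ε => by
    simpa using ContinuousMap.norm_coe_le_norm (f ε) s)).trans_isLittleO h

section Coefficients

variable {z : E} {x : ℝ → C(Icc (0 : ℝ) S.T, E)} (hx : ∀ᶠ ε in 𝓝 0, S.IsFlow z ε (x ε))
  {c : ℕ → C(Icc (0 : ℝ) S.T, E)} (hc0 : c 0 = x 0)
  (hc : (fun ε => x ε - ∑ i ∈ Finset.range (k + 1), ε ^ i • c i) =o[𝓝 0] fun ε => ε ^ k)
  {w : Fin n → ℕ → C(Icc (0 : ℝ) S.T, E)}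
  (hw : ∀ j, (fun ε => S.fieldAlong j (x ε, ε) - ∑ i ∈ Finset.range (k + 1), ε ^ i • w j i)
    =o[𝓝 0] fun ε => ε ^ k)
include hx hc hw

/-- Both sides of the integral equation are expanded in ε and the coefficients compared. -/
theorem coeff_eq_stripIntegral {i : ℕ} (hi : 1 ≤ i) (hik : i ≤ k) :
    c i = S.stripIntegral fun j => w j i := by
  have h1 : (fun ε => S.stripIntegral (fun j => S.fieldAlong j (x ε, ε)) -
      ∑ i ∈ Finset.range (k + 1), ε ^ i • S.stripIntegral fun j => w j i) =o[𝓝 0]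
      fun ε => ε ^ k := by
    have h2 : ∀ j ∈ Finset.univ, (fun ε => indicatorIntegral S.T_nonneg (S.measurableSet_strip 0 j)
        (S.fieldAlong j (x ε, ε) - ∑ i ∈ Finset.range (k + 1), ε ^ i • w j i)) =o[𝓝 0]
        fun ε => ε ^ k := fun j _ =>
      ((indicatorIntegral (F := E) S.T_nonneg (S.measurableSet_strip 0 j)).isBigO_comp _
        _).trans_isLittleO (hw j)
    refine (IsLittleO.fun_sum h2).congr_left fun ε => ?_
    simp only [stripIntegral, map_sub, map_sum, map_smul, Finset.sum_sub_distrib, Finset.smul_sum]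
    rw [Finset.sum_comm]
  -- The initial value contributes to the order i = 0 only.
  have h3 : (fun ε : ℝ => ∑ i ∈ Finset.range (k + 1), ε ^ i • (c i - (S.stripIntegral fun j => w j i) -
      if i = 0 then constCLM (Icc (0 : ℝ) S.T) E z else 0)) =o[𝓝 0] fun ε => ε ^ k := by
    refine (h1.sub hc).congr' ?_ EventuallyEq.rfl
    filter_upwards [hx] with ε hε
    have h4 := hε.eq
    simp only [smul_sub, Finset.sum_sub_distrib, smul_ite, smul_zero, Finset.sum_ite_eq',
      Finset.mem_range, Nat.succ_pos, if_true, pow_zero, one_smul]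
    rw [← sub_eq_iff_eq_add'.2 h4]
    abel
  have h5 := coeff_eq_zero_of_isLittleO k (h3.mono nhdsWithin_le_nhds) i hik
  rw [if_neg (by omega), sub_zero, sub_eq_zero] at h5
  exact h5

include hc0

/-- At a fixed time the solution is a curve in E, so `ContDiffAt.sum_expansion` applies; the vectors
are l! c_l because `weightedCurve` divides by l!. The term with R is bounded times ε^{k+1}. -/
theorem coeff_field_eq {i : ℕ} (hik : i ≤ k) (j : Fin n) (s : Icc (0 : ℝ) S.T) :
    w j i s = expansionCoeff i (fun m => S.F m j s) (x 0 s) (fun l => (l ! : ℝ) • c l s) := by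
  have hx0 := hx.self_of_nhds
  have hcurve : (fun ε => x ε s - (x 0 s + weightedCurve
      (fun l : Fin k => (((l : ℕ) + 1)! : ℝ) • c (l + 1) s) ε)) =o[𝓝 0] fun ε => ε ^ k := by
    refine (isLittleO_eval hc s).congr_left fun ε => ?_
    rw [ContinuousMap.sub_apply, ContinuousMap.sum_apply, Finset.sum_range_succ', weightedCurve,
      Finset.sum_range]
    simp only [ContinuousMap.smul_apply, pow_zero, one_smul, smul_smul, hc0]
    rw [add_comm (x 0 s)]
    congr 2
    refine Finset.sum_congr rfl fun l _ => ?_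
    congr 1
    have : (((l : ℕ) + 1)! : ℝ) ≠ 0 := by positivity
    field_simp
  have hcx : Tendsto (fun ε => x ε s) (𝓝 0) (𝓝 (x 0 s)) := by
    have h1 : Tendsto (fun ε : ℝ => x ε s - (x 0 s + weightedCurve
        (fun l : Fin k => (((l : ℕ) + 1)! : ℝ) • c (l + 1) s) ε)) (𝓝 0) (𝓝 0) := by
      have h2 : (fun ε : ℝ => ε ^ k) =O[𝓝 0] (fun _ => (1 : ℝ)) :=
        (Continuous.tendsto (by fun_prop : Continuous fun ε : ℝ => ε ^ k) 0).isBigO_one ℝ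
      exact (isLittleO_one_iff ℝ).1 (hcurve.trans_isBigO h2)
    simpa using h1.add (tendsto_add_weightedCurve (x 0 s)
      (fun l : Fin k => (((l : ℕ) + 1)! : ℝ) • c (l + 1) s))
  have h1 := ContDiffAt.sum_expansion (k := k) (G := fun m => S.F m j s) (x := x 0 s)
    (fun m hm => (contDiffAt_F hm j s (hx0.mem s)).of_le (by
      exact_mod_cast (by omega : k - m ≤ k + 1))) (fun l => (l ! : ℝ) • c l s) le_rfl hcurve
  have h2 : (fun ε : ℝ => ε ^ (k + 1) • S.R j s (x ε s) ε) =o[𝓝 0] fun ε : ℝ => ε ^ k := by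
    simpa using (isLittleO_pow_pow_of_lt (Nat.lt_succ_self k)).smul_isBigO
      (isBigO_R_comp (j := j) (s := (s : ℝ)) (hx0.mem s) hcx)
  have h3 : (fun ε : ℝ => ∑ i ∈ Finset.range (k + 1), ε ^ i • (w j i s -
      expansionCoeff i (fun m => S.F m j s) (x 0 s) (fun l => (l ! : ℝ) • c l s))) =o[𝓝 0]
      fun ε : ℝ => ε ^ k := by
    refine ((h1.add h2).sub (isLittleO_eval (hw j) s)).congr' ?_ EventuallyEq.rfl
    filter_upwards [hx] with ε hε
    rw [ContinuousMap.sub_apply, ContinuousMap.sum_apply, fieldAlong_apply hε.mem hε.lt, field]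
    simp only [ContinuousMap.smul_apply, smul_sub, Finset.sum_sub_distrib]
    abel
  exact sub_eq_zero.1 (coeff_eq_zero_of_isLittleO k (h3.mono nhdsWithin_le_nhds) i hik)

variable [FiniteDimensional ℝ E]

open MeasureTheory in
/-- The functions `y_i` are the derivatives of the solution in `ε` at `ε = 0`. -/
theorem yFun_eq_coeff {i : ℕ} (hi : 1 ≤ i) (hik : i ≤ k) (τ : Icc (0 : ℝ) S.T) :
    S.yFun z i τ = (i ! : ℝ) • c i τ := by
  have : CompleteSpace E := FiniteDimensional.complete ℝ E
  induction i using Nat.strong_induction_on generalizing τ with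
  | _ i ih =>
  have hx0 := hx.self_of_nhds
  obtain ⟨Y, Z, hY, -, hYd, hZY, hYZ⟩ := hx0.exists_fundamental
  let A := S.linearization 0 (x 0)
  -- The part of the i-th coefficient that is free of c_i: c_i solves the linear equation with
  -- matrix A and inhomogeneity r.
  let r : Fin n → C(Icc (0 : ℝ) S.T, E) := fun j => w j i - pointwiseApply (A j) (c i)
  have hr : ∀ j s, r j s = expansionBracket i (fun m => S.F m j s) (x 0 s)
      (fun l => (l ! : ℝ) • c l s) := by
    intro j s
    have h1 := coeff_field_eq hx hc0 hc hw hik j s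
    rw [expansionCoeff_eq_bracket hi ((contDiffAt_F (Nat.zero_le k) j s (hx0.mem s)).of_le (by
      exact_mod_cast (by omega : i ≤ k + 1))), fderiv_F_zero hx0.mem, map_smul, smul_smul,
      one_div_mul_cancel (by positivity), one_smul] at h1
    simp only [r, ContinuousMap.sub_apply, pointwiseApply_apply]
    rw [h1]
    exact add_sub_cancel_right _ _
  -- Variation of constants: c_i = Y q with q = ∫ Y⁻¹ r.
  let q := S.stripIntegral fun j => pointwiseApply Z (r j)
  have hcq : c i = pointwiseApply Y q := by
    have e1 : c i = S.stripIntegral r +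
        volterra S.T_nonneg (fun j => S.measurableSet_strip 0 j) A (c i) := by
      have h1 := coeff_eq_stripIntegral hx hc hw hi hik
      rw [volterra_apply]
      conv_lhs => rw [h1]
      simp only [stripIntegral, r, map_sub, Finset.sum_sub_distrib, sub_add_cancel]
    have e2 := S.eq_add_volterra (A := A)
      (x := fun s => IccExtend S.T_nonneg Y s (IccExtend S.T_nonneg q s))
      (u := pointwiseApply Y q) (fun s => by simp) r (fun j s hs => by
        have h2 := (hYd j s hs).clm_apply
          (S.hasDerivWithinAt_stripIntegral (fun j => pointwiseApply Z (r j)) j hs)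
        rw [IccExtend_of_mem S.T_nonneg (pointwiseApply Z (r j)) (S.strip_subset j hs),
          pointwiseApply_apply, IccExtend_of_mem S.T_nonneg
            (S.stripIntegral fun j => pointwiseApply Z (r j)) (S.strip_subset j hs)] at h2
        have h3 := congrArg (fun T : E →L[ℝ] E => T (r j ⟨s, S.strip_subset j hs⟩))
          (hYZ ⟨s, S.strip_subset j hs⟩)
        simp only [ContinuousLinearMap.comp_apply, ContinuousLinearMap.id_apply] at h3
        rw [IccExtend_of_mem S.T_nonneg Y (S.strip_subset j hs), h3,
          ContinuousLinearMap.comp_apply, add_comm] at h2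
        have h4 := IccExtend_of_mem S.T_nonneg Y (S.strip_subset j hs)
        have h5 := IccExtend_of_mem S.T_nonneg q (S.strip_subset j hs)
        simp only [h4, h5]
        exact h2)
    have h6 : IccExtend S.T_nonneg q 0 = 0 := by
      rw [IccExtend_of_mem _ _ (left_mem_Icc.2 S.T_nonneg)]
      exact S.stripIntegral_zero _
    simp only [h6, map_zero, zero_add] at e2
    exact volterra_eq_unique _ _ _ e1 e2
  rw [yFun_eq_bracket, hcq, pointwiseApply_apply, hY]
  congr 2
  have hq : q τ = ∑ j, ∫ s in (0 : ℝ)..τ, (S.strip 0 j).indicator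
      (IccExtend S.T_nonneg (pointwiseApply Z (r j))) s := S.stripIntegral_apply _ τ
  rw [hq, ← intervalIntegral.integral_finsetSum fun j _ =>
    intervalIntegrable_indicator (ContinuousMap.continuous _).Icc_extend'
      (S.measurableSet_strip 0 j) _ _]
  refine intervalIntegral.integral_congr_ae ?_
  have hfin : (range S.t).Countable := (finite_range S.t).countable
  -- The integrands are compared off the finite set of breakpoints, where exactly one strip contains
  -- s.
  filter_upwards [hfin.ae_notMem volume] with s hs hsτ
  rw [uIoc_of_le τ.2.1] at hsτ
  have hsT : s ∈ Icc (0 : ℝ) S.T := ⟨hsτ.1.le, hsτ.2.trans τ.2.2⟩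
  obtain ⟨j, hj⟩ := S.exists_mem_strip hsT
  have hj' : s ∈ Ioo (S.t j.castSucc) (S.t j.succ) := by
    have hj2 := hj
    rw [strip_zero] at hj2
    exact ⟨lt_of_le_of_ne hj2.1 fun h => hs ⟨_, h⟩, lt_of_le_of_ne hj2.2 fun h => hs ⟨_, h.symm⟩⟩
  have hsum : ∑ j, (S.strip 0 j).indicator (IccExtend S.T_nonneg (pointwiseApply Z (r j))) s =
      pointwiseApply Z (r j) ⟨s, hsT⟩ := by
    rw [Finset.sum_eq_single j]
    · rw [indicator_of_mem hj, IccExtend_of_mem _ _ hsT]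
    · intro i _ hij
      exact indicator_of_notMem (S.notMem_strip_of_mem_Ioo hij hj') _
    · intro h
      exact absurd (Finset.mem_univ j) h
  rw [hsum, pointwiseApply_apply, hr]
  have hYs := hY ⟨s, hsT⟩
  have hus := hx0.eq_unperturbed ⟨s, hsT⟩
  simp only at hYs hus
  rw [hYs, hus, ContinuousLinearMap.inverse_eq (hYZ _) (hZY _)]
  congr 1
  refine expansionBracket_congr (fun m _ => piecewiseF_eq hj') fun l hl hli => ?_
  exact ih l hli hl (by omega) ⟨s, hsT⟩

end Coefficients

end Expansion

end PiecewiseSystem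

/-! ### Slices of neighbourhoods and of partial expansions. -/

theorem Filter.Eventually.eventually_nhds_prodMk {X Y : Type*} [TopologicalSpace X]
    [TopologicalSpace Y] {x : X} {y : Y} {P : X × Y → Prop} (h : ∀ᶠ p in 𝓝 (x, y), P p) :
    ∀ᶠ x' in 𝓝 x, ∀ᶠ p in 𝓝 (x', y), P p :=
  (Continuous.tendsto (by fun_prop : Continuous fun x' : X => (x', y)) x).eventually
    h.eventually_nhds

theorem Filter.Eventually.nhds_prodMk_left {X Y : Type*} [TopologicalSpace X]
    [TopologicalSpace Y] {x : X} {y : Y} {P : X × Y → Prop} (h : ∀ᶠ p in 𝓝 (x, y), P p) :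
    ∀ᶠ x' in 𝓝 x, P (x', y) :=
  (Continuous.tendsto (by fun_prop : Continuous fun x' : X => (x', y)) x).eventually h

theorem Filter.Eventually.nhds_prodMk_right {X Y : Type*} [TopologicalSpace X]
    [TopologicalSpace Y] {x : X} {y : Y} {P : X × Y → Prop} (h : ∀ᶠ p in 𝓝 (x, y), P p) :
    ∀ᶠ y' in 𝓝 y, P (x, y') :=
  (Continuous.tendsto (by fun_prop : Continuous fun y' : Y => (x, y')) y).eventually h

section PartialExpansion

variable {Z F : Type*} [NormedAddCommGroup Z] [NormedSpace ℝ Z] [NormedAddCommGroup F]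
  [NormedSpace ℝ F] {k : ℕ} {h ρ : Z × ℝ → F} {c : ℕ → Z → F} {z : Z}

theorem eq_coeff_zero_of_partial_expansion (hρ0 : ρ (z, 0) = 0)
    (he : ∀ᶠ p in 𝓝 (z, (0 : ℝ)),
      h p = ∑ i ∈ Finset.range (k + 1), p.2 ^ i • c i p.1 + p.2 ^ k • ρ p) :
    c 0 z = h (z, 0) := by
  have h1 := he.self_of_nhds
  rw [h1, Finset.sum_range_succ']
  simp [hρ0]

theorem isLittleO_of_partial_expansion (hρ : ContinuousAt ρ (z, 0)) (hρ0 : ρ (z, 0) = 0)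
    (he : ∀ᶠ p in 𝓝 (z, (0 : ℝ)),
      h p = ∑ i ∈ Finset.range (k + 1), p.2 ^ i • c i p.1 + p.2 ^ k • ρ p) :
    (fun ε : ℝ => h (z, ε) - ∑ i ∈ Finset.range (k + 1), ε ^ i • c i z) =o[𝓝 0]
      fun ε : ℝ => ε ^ k := by
  have h1 : Tendsto (fun ε : ℝ => ρ (z, ε)) (𝓝 0) (𝓝 0) := by
    have h2 : Tendsto (fun ε : ℝ => (z, ε)) (𝓝 0) (𝓝 (z, 0)) :=
      tendsto_const_nhds.prodMk_nhds tendsto_id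
    have h3 := hρ.tendsto.comp h2
    rwa [hρ0] at h3
  have h4 := (isBigO_refl (fun ε : ℝ => ε ^ k) (𝓝 0)).smul_isLittleO ((isLittleO_one_iff ℝ).2 h1)
  refine h4.congr' ?_ (Eventually.of_forall fun ε => by simp)
  filter_upwards [he.nhds_prodMk_right] with ε hε
  rw [hε]
  exact (add_sub_cancel_left _ _).symm

end PartialExpansion

/-! ### The displacement map and the averaged functions. -/

namespace PiecewiseSystem

section Displacement

variable {E : Type u} [NormedAddCommGroup E] [NormedSpace ℝ E] {n k : ℕ}
  {S : PiecewiseSystem E n k} [FiniteDimensional ℝ E]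

/-- The end of the period, as a point of `[0, T]`. -/
def lastTime (S : PiecewiseSystem E n k) : Icc (0 : ℝ) S.T := ⟨S.T, right_mem_Icc.2 S.T_nonneg⟩

/-- The displacement map of a family of solutions. -/
def displacement (X : E × ℝ → C(Icc (0 : ℝ) S.T, E)) (p : E × ℝ) : E := X p S.lastTime - p.1

theorem IsFlow.fundamental_inverse {z : E} {u : C(Icc (0 : ℝ) S.T, E)} (h : S.IsFlow z 0 u) :
    ∃ e : E ≃L[ℝ] E, (e : E →L[ℝ] E) = S.fundamental z S.T := by
  obtain ⟨Y, Z, hY, -, -, hZY, hYZ⟩ := h.exists_fundamental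
  have hY' : S.fundamental z S.T = Y S.lastTime := hY S.lastTime
  rw [hY']
  refine ⟨ContinuousLinearEquiv.equivOfInverse (Y S.lastTime) (Z S.lastTime) (fun v => ?_)
    (fun v => ?_), rfl⟩
  · exact DFunLike.congr_fun (hZY S.lastTime) v
  · exact DFunLike.congr_fun (hYZ S.lastTime) v

/-- The displacement map has the expansion `∑_{i ≤ k} ε^i Y(T, z) g_i(z) + o(ε^k)`, with averaged
functions `g_i` that are smooth enough. -/
theorem IsFlow.exists_displacement_expansion (hk : 0 < k) {z₀ : E} {u₀ : C(Icc (0 : ℝ) S.T, E)}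
    (h₀ : S.IsFlow z₀ 0 u₀) :
    ∃ X : E × ℝ → C(Icc (0 : ℝ) S.T, E), ContDiffAt ℝ ((k + 1 : ℕ) : WithTop ℕ∞) X (z₀, 0) ∧
      (∀ᶠ p in 𝓝 (z₀, (0 : ℝ)), S.IsFlow p.1 p.2 (X p)) ∧
      ContDiffAt ℝ (k : WithTop ℕ∞) (fun z => S.fundamental z S.T) z₀ ∧
      (∀ i ≤ k, ContDiffAt ℝ ((k - i : ℕ) : WithTop ℕ∞) (S.averaged i) z₀) ∧
      (∀ᶠ z in 𝓝 z₀, X (z, 0) S.lastTime = z →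
        HasFDerivAt (S.averaged 0)
          (ContinuousLinearMap.id ℝ E - (S.fundamental z S.T).inverse) z) ∧
      ∃ ρ : E × ℝ → E, (∀ᶠ z in 𝓝 z₀, ContinuousAt ρ (z, 0)) ∧ (∀ z, ρ (z, 0) = 0) ∧
        ∀ᶠ p in 𝓝 (z₀, (0 : ℝ)), displacement X p =
          S.fundamental p.1 S.T (∑ i ∈ Finset.range (k + 1), p.2 ^ i • S.averaged i p.1) +
            p.2 ^ k • ρ p := by
  have : CompleteSpace E := FiniteDimensional.complete ℝ E
  obtain ⟨X, hX0, hX, hXe⟩ := h₀.exists_contDiffAt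
  have h00 : |(0 : ℝ)| < S.ε₀ := by simpa using S.ε₀_pos
  have hW : ∀ j, ContDiffAt ℝ ((k + 1 : ℕ) : WithTop ℕ∞)
      (fun p : E × ℝ => S.fieldAlong j (X p, p.2)) (z₀, 0) := by
    intro j
    have hf : ContDiffAt ℝ ((k + 1 : ℕ) : WithTop ℕ∞) (fun p : E × ℝ => (X p, p.2)) (z₀, 0) :=
      hX.prodMk contDiffAt_snd
    have hg : ContDiffAt ℝ ((k + 1 : ℕ) : WithTop ℕ∞) (S.fieldAlong j)
        ((fun p : E × ℝ => (X p, p.2)) (z₀, 0)) := by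
      have : (fun p : E × ℝ => (X p, p.2)) (z₀, 0) = (u₀, 0) := by simp [hX0]
      rw [this]
      exact contDiffAt_fieldAlong h₀.mem h00 j
    have hgf := ContDiffAt.comp (z₀, (0 : ℝ)) hg hf
    exact hgf
  obtain ⟨c, ρ, hc, hρ, hρ0, hce⟩ := ContDiffAt.exists_partial_expansion k hX
  choose w σ hw hσ hσ0 hwe using fun j => ContDiffAt.exists_partial_expansion k (hW j)
  -- The identification holds for all z near z₀, so the averaged functions inherit the smoothness of
  -- the c_i in z.
  have hcoeff : ∀ᶠ z in 𝓝 z₀, c 0 z = X (z, 0) ∧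
      ∀ i, 1 ≤ i → i ≤ k → ∀ τ : Icc (0 : ℝ) S.T, S.yFun z i τ = (i ! : ℝ) • c i z τ := by
    have hρe : ∀ᶠ z in 𝓝 z₀, ContDiffAt ℝ 1 ρ (z, 0) :=
      (hρ.eventually (by simp)).nhds_prodMk_left
    have hσe : ∀ᶠ z in 𝓝 z₀, ∀ j, ContDiffAt ℝ 1 (σ j) (z, 0) :=
      eventually_all.2 fun j => ((hσ j).eventually (by simp)).nhds_prodMk_left
    filter_upwards [hρe, hσe, hXe.eventually_nhds_prodMk, hce.eventually_nhds_prodMk,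
      (eventually_all.2 hwe).eventually_nhds_prodMk] with z h1 h2 h3 h4 h5
    have hc0 := eq_coeff_zero_of_partial_expansion (hρ0 z) h4
    refine ⟨hc0, fun i hi hik τ => ?_⟩
    exact yFun_eq_coeff (x := fun ε => X (z, ε)) (c := fun i => c i z) (w := fun j i => w j i z)
      h3.nhds_prodMk_right hc0 (isLittleO_of_partial_expansion h1.continuousAt (hρ0 z) h4)
      (fun j => isLittleO_of_partial_expansion (h2 j).continuousAt (hσ0 j z)
        (h5.mono fun p hp => hp j)) hi hik τ
  have hX₁ : ContDiffAt ℝ ((k + 1 : ℕ) : WithTop ℕ∞) (fun z => X (z, 0)) z₀ := by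
    have hf : ContDiffAt ℝ ((k + 1 : ℕ) : WithTop ℕ∞) (fun z : E => (z, (0 : ℝ))) z₀ :=
      contDiffAt_id.prodMk contDiffAt_const
    have hgf := ContDiffAt.comp z₀ (f := fun z : E => (z, (0 : ℝ))) hX hf
    exact hgf
  let ev : C(Icc (0 : ℝ) S.T, E) →L[ℝ] E := ContinuousMap.evalCLM ℝ S.lastTime
  have hflow : ∀ᶠ z in 𝓝 z₀, S.IsFlow z 0 (X (z, 0)) := hXe.nhds_prodMk_left
  -- Y(T, z) is the z-derivative of a C^{k+1} map, hence of class C^k.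
  have hfund : ∀ᶠ z in 𝓝 z₀, HasFDerivAt (fun z => X (z, 0) S.lastTime) (S.fundamental z S.T) z ∧
      S.fundamental z S.T = ev.comp (fderiv ℝ (fun z => X (z, 0)) z) := by
    filter_upwards [hflow.eventually_nhds, hX₁.eventually (by simp)] with z h1 h2
    have h3 : DifferentiableAt ℝ (fun z => X (z, 0)) z := h2.differentiableAt (by simp)
    have h4 : S.fundamental z S.T = ev.comp (fderiv ℝ (fun z => X (z, 0)) z) := by
      ext v
      exact (IsFlow.fderiv_apply_eq_fundamental h3 h1 v S.lastTime).symm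
    refine ⟨?_, h4⟩
    rw [h4]
    exact HasFDerivAt.comp z ev.hasFDerivAt h3.hasFDerivAt
  have hYsmooth : ContDiffAt ℝ (k : WithTop ℕ∞) (fun z => S.fundamental z S.T) z₀ := by
    have h1 : ContDiffAt ℝ (k : WithTop ℕ∞) (fderiv ℝ (fun z => X (z, 0))) z₀ :=
      hX₁.fderiv_right (by norm_cast)
    have h2 : ContDiffAt ℝ (k : WithTop ℕ∞)
        (fun z => ev.comp (fderiv ℝ (fun z => X (z, 0)) z)) z₀ := contDiffAt_const.clm_comp h1
    exact h2.congr_of_eventuallyEq (hfund.mono fun z hz => hz.2)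
  have hinv : ContDiffAt ℝ (k : WithTop ℕ∞) (fun z => (S.fundamental z S.T).inverse) z₀ := by
    obtain ⟨e, he⟩ := h₀.fundamental_inverse
    have h1 := contDiffAt_map_inverse (𝕜 := ℝ) (n := (k : WithTop ℕ∞)) e
    rw [he] at h1
    exact ContDiffAt.comp z₀ (f := fun z => S.fundamental z S.T) h1 hYsmooth
  have hav0 : ∀ᶠ z in 𝓝 z₀, S.averaged 0 z =
      (S.fundamental z S.T).inverse (X (z, 0) S.lastTime - z) := by
    filter_upwards [hflow] with z hz
    rw [averaged, if_pos rfl]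
    congr 2
    exact hz.eq_unperturbed S.lastTime
  have hav : ∀ᶠ z in 𝓝 z₀, ∀ i, 1 ≤ i → i ≤ k → S.averaged i z =
      (S.fundamental z S.T).inverse (c i z S.lastTime) := by
    filter_upwards [hcoeff] with z hz i hi hik
    have h1 : S.yFun z i S.T = (i ! : ℝ) • c i z S.lastTime := hz.2 i hi hik S.lastTime
    rw [averaged, if_neg (by omega), h1, smul_smul, one_div_mul_cancel (by positivity), one_smul]
  have hevX : ContDiffAt ℝ ((k + 1 : ℕ) : WithTop ℕ∞) (fun z => X (z, 0) S.lastTime - z) z₀ := by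
    have h1 : ContDiffAt ℝ ((k + 1 : ℕ) : WithTop ℕ∞) (fun z => ev (X (z, 0))) z₀ :=
      hX₁.continuousLinearMap_comp ev
    exact h1.sub contDiffAt_id
  refine ⟨X, hX, hXe, hYsmooth, ?_, ?_, ?_⟩
  · intro i hik
    rcases Nat.eq_zero_or_pos i with rfl | hi
    · have h1 := hinv.clm_apply (hevX.of_le (by exact_mod_cast Nat.le_succ k))
      exact h1.congr_of_eventuallyEq hav0
    · have h2 : ContDiffAt ℝ ((k - i : ℕ) : WithTop ℕ∞) (fun z => ev (c i z)) z₀ :=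
        ((hc i hik).of_le (by exact_mod_cast (by omega : k - i ≤ k + 1 - i))).continuousLinearMap_comp
          ev
      have h1 := (hinv.of_le (by exact_mod_cast Nat.sub_le k i)).clm_apply h2
      exact h1.congr_of_eventuallyEq (hav.mono fun z hz => hz i hi hik)
  · filter_upwards [hfund, hav0.eventually_nhds, hinv.eventually (by simp), hflow]
      with z h1 h2 h3 h4 h5
    obtain ⟨e, he⟩ := h4.fundamental_inverse
    -- In the product rule, the derivative of Y⁻¹ is applied to x(T, z, 0) - z = 0, so Y⁻¹ (Y - Id)
    -- = Id - Y⁻¹ remains.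
    have h6 := (h3.differentiableAt (by exact_mod_cast hk.ne')).hasFDerivAt.clm_apply
      (h1.1.sub (hasFDerivAt_id z))
    refine (h6.congr_of_eventuallyEq h2).congr_fderiv ?_
    ext v
    simp [h5, ← he]
  · refine ⟨fun p => ρ p S.lastTime, ?_, fun z => by simp [hρ0], ?_⟩
    · filter_upwards [(hρ.eventually (by simp)).nhds_prodMk_left] with z hz
      exact ev.continuous.continuousAt.comp hz.continuousAt
    · have h1 : Tendsto (Prod.fst : E × ℝ → E) (𝓝 (z₀, 0)) (𝓝 z₀) := continuous_fst.tendsto _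
      filter_upwards [hce, h1.eventually hcoeff, h1.eventually hav0, h1.eventually hav,
        h1.eventually hflow] with p h2 h3 h4 h5 h6
      obtain ⟨e, he⟩ := h6.fundamental_inverse
      rw [displacement, h2, map_sum, Finset.sum_range_succ' _ k, Finset.sum_range_succ' _ k, h4,
        h3.1, ContinuousMap.add_apply, ContinuousMap.add_apply, ContinuousMap.sum_apply, ← he]
      have h7 : ∀ i ∈ Finset.range k, (e : E →L[ℝ] E) (p.2 ^ (i + 1) • S.averaged (i + 1) p.1) =
          (p.2 ^ (i + 1) • c (i + 1) p.1) S.lastTime := by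
        intro i hi
        rw [h5 (i + 1) (by omega) (by have := Finset.mem_range.1 hi; omega), ← he]
        simp
      rw [Finset.sum_congr rfl h7]
      simp
      abel

end Displacement

end PiecewiseSystem

/-! ### The bifurcation functions as coefficients along the curves built from the γ_i. -/

section Gamma

variable {A B : Type u} [NormedAddCommGroup A] [NormedSpace ℝ A]
  [NormedAddCommGroup B] [NormedSpace ℝ B] {g : ℕ → A × B → A × B} {Δ : A → B →L[ℝ] B}
  {β : A → B} {α : A} {k : ℕ}

theorem gammaFun_eq_bracket (g : ℕ → A × B → A × B) (Δ : A → B →L[ℝ] B) (β : A → B) (i : ℕ)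
    (α : A) : gammaFun g Δ β i α = -((i ! : ℝ) • (Δ α).inverse
      (expansionBracket i (fun m b => (g m (α, b)).2) (β α) (fun l => gammaFun g Δ β l α))) := by
  rw [gammaFun]
  rfl

theorem bifurcationFun_eq_coeff (g : ℕ → A × B → A × B) (Δ : A → B →L[ℝ] B) (β : A → B) (i : ℕ)
    (α : A) : bifurcationFun g Δ β i α =
      expansionCoeff i (fun m b => (g m (α, b)).1) (β α) (fun l => gammaFun g Δ β l α) := by
  rw [expansionCoeff_eq_add_sum]
  rfl

/-- The functions `γ_i` annihilate the second component of `∑_i ε^i g_i`. -/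
theorem expansionCoeff_gammaFun_eq_zero (h0 : g 0 (α, β α) = 0)
    (hg : ContDiffAt ℝ (k : WithTop ℕ∞) (g 0) (α, β α)) {e : B ≃L[ℝ] B} (he : (e : B →L[ℝ] B) = Δ α)
    (hΔ : HasFDerivAt (fun b => (g 0 (α, b)).2) (Δ α) (β α)) {i : ℕ} (hi : i ≤ k) :
    expansionCoeff i (fun m b => (g m (α, b)).2) (β α) (fun l => gammaFun g Δ β l α) = 0 := by
  rcases Nat.eq_zero_or_pos i with rfl | hi0
  · rw [expansionCoeff_zero, h0]
    rfl
  have h1 : ContDiffAt ℝ (i : WithTop ℕ∞) (fun b => (g 0 (α, b)).2) (β α) := by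
    have h2 : ContDiffAt ℝ (k : WithTop ℕ∞) (fun b => g 0 (α, b)) (β α) :=
      hg.comp (β α) (contDiffAt_const.prodMk contDiffAt_id)
    exact h2.snd.of_le (by exact_mod_cast hi)
  -- The definition of γ_i solves "bracket + (1 / i!) Δ γ_i = 0".
  rw [expansionCoeff_eq_bracket hi0 h1, hΔ.fderiv, gammaFun_eq_bracket, ← he]
  simp only [ContinuousLinearMap.inverse_equiv, map_neg, map_smul, smul_neg, smul_smul]
  rw [one_div_mul_cancel (by positivity), one_smul]
  simp

/-- Along the curve given by the `γ_i`, the expansion of `∑_i ε^i g_i` is that of the bifurcation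
functions. -/
theorem sum_isLittleO_bifurcationFun
    (hg : ∀ m ≤ k, ContDiffAt ℝ ((k - m : ℕ) : WithTop ℕ∞) (g m) (α, β α))
    (h0 : g 0 (α, β α) = 0) {e : B ≃L[ℝ] B} (he : (e : B →L[ℝ] B) = Δ α)
    (hΔ : HasFDerivAt (fun b => (g 0 (α, b)).2) (Δ α) (β α))
    (hf : ∀ i, 1 ≤ i → i < k → bifurcationFun g Δ β i α = 0) :
    (fun ε : ℝ => ∑ i ∈ Finset.range (k + 1), ε ^ i • g i
        (α, β α + weightedCurve (fun j : Fin k => gammaFun g Δ β (j + 1) α) ε) -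
      ε ^ k • (bifurcationFun g Δ β k α, (0 : B))) =o[𝓝 0] fun ε : ℝ => ε ^ k := by
  have hg' : ∀ m ≤ k, ContDiffAt ℝ ((k - m : ℕ) : WithTop ℕ∞) (fun b => g m (α, b)) (β α) :=
    fun m hm => (hg m hm).comp (β α) (contDiffAt_const.prodMk contDiffAt_id)
  have hz : (fun ε => (β α + weightedCurve (fun j : Fin k => gammaFun g Δ β (j + 1) α) ε) -
      (β α + weightedCurve (fun j : Fin k => gammaFun g Δ β (j + 1) α) ε)) =o[𝓝 0]
      fun ε : ℝ => ε ^ k := by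
    simp
  have h1 := ContDiffAt.sum_expansion (G := fun m b => (g m (α, b)).1)
    (fun m hm => (hg' m hm).fst) (fun l => gammaFun g Δ β l α) le_rfl hz
  have h2 := ContDiffAt.sum_expansion (G := fun m b => (g m (α, b)).2)
    (fun m hm => (hg' m hm).snd) (fun l => gammaFun g Δ β l α) le_rfl hz
  have e2 : ∀ ε : ℝ, ∑ i ∈ Finset.range (k + 1), ε ^ i • expansionCoeff i
      (fun m b => (g m (α, b)).2) (β α) (fun l => gammaFun g Δ β l α) = 0 := fun ε =>
    Finset.sum_eq_zero fun i hi => by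
      rw [expansionCoeff_gammaFun_eq_zero h0 (hg 0 (Nat.zero_le k)) he hΔ
        (Nat.lt_succ_iff.1 (Finset.mem_range.1 hi)), smul_zero]
  have e1 : ∀ ε : ℝ, ∑ i ∈ Finset.range (k + 1), ε ^ i • expansionCoeff i
      (fun m b => (g m (α, b)).1) (β α) (fun l => gammaFun g Δ β l α) =
      ε ^ k • bifurcationFun g Δ β k α := fun ε => by
    rw [Finset.sum_range_succ, ← bifurcationFun_eq_coeff, add_eq_right]
    refine Finset.sum_eq_zero fun i hi => ?_
    have hi := Finset.mem_range.1 hi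
    rcases Nat.eq_zero_or_pos i with rfl | hi0
    · rw [expansionCoeff_zero, h0]
      exact smul_zero _
    · rw [← bifurcationFun_eq_coeff, hf i hi0 hi, smul_zero]
  simp only [e1] at h1
  simp only [e2] at h2
  refine (h1.prod_left h2).congr_left fun ε => ?_
  ext
  · simp [Prod.fst_sum]
  · simp [Prod.snd_sum]

end Gamma

/-! ### Two tools: implicit functions with local uniqueness, and products at a zero. -/

section Implicit

variable {P U W : Type*} [NormedAddCommGroup P] [NormedSpace ℝ P] [CompleteSpace P]
  [NormedAddCommGroup U] [NormedSpace ℝ U] [CompleteSpace U]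
  [NormedAddCommGroup W] [NormedSpace ℝ W] [CompleteSpace W]

/-- The local uniqueness in the last clause is what later recognises the approximate curve as a
value of the implicit function. -/
theorem ContDiffAt.exists_implicit {n : WithTop ℕ∞} (hn : n ≠ 0) {Φ : P × U → W} {p₀ : P} {u₀ : U}
    (hΦ : ContDiffAt ℝ n Φ (p₀, u₀)) (h0 : Φ (p₀, u₀) = 0) {e : U ≃L[ℝ] W}
    (he : HasFDerivAt (fun u => Φ (p₀, u)) (e : U →L[ℝ] W) u₀) :
    ∃ X : P → U, X p₀ = u₀ ∧ ContDiffAt ℝ n X p₀ ∧ (∀ᶠ p in 𝓝 p₀, Φ (p, X p) = 0) ∧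
      ∀ᶠ q in 𝓝 (p₀, u₀), Φ q = 0 → X q.1 = q.2 := by
  have hinv : (fderiv ℝ Φ (p₀, u₀) ∘L ContinuousLinearMap.inr ℝ P U).IsInvertible := by
    have h2 : HasFDerivAt (fun u => Φ (p₀, u))
        (fderiv ℝ Φ (p₀, u₀) ∘L ContinuousLinearMap.inr ℝ P U) u₀ :=
      HasFDerivAt.comp u₀ (hΦ.differentiableAt hn).hasFDerivAt (hasFDerivAt_prodMk_right p₀ u₀)
    exact ⟨e, he.unique h2⟩
  refine ⟨hΦ.implicitFunction hn hinv, hΦ.implicitFunction_apply_self hn hinv,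
    hΦ.contDiffAt_implicitFunction hn hinv, ?_, ?_⟩
  · filter_upwards [hΦ.eventually_apply_implicitFunction hn hinv] with p hp
    rw [hp, h0]
  · filter_upwards [hΦ.eventually_apply_eq_iff_implicitFunction hn hinv] with q hq h
    exact hq.1 (by rw [h, h0])

/-- At a zero of `f` the factor `C` need only be continuous: its variation multiplies a quantity
that is O(‖y - x‖). -/
theorem HasFDerivAt.clm_apply_of_eq_zero {C : P → U →L[ℝ] W} {f : P → U} {f' : P →L[ℝ] U} {x : P}
    (hC : ContinuousAt C x) (hf : HasFDerivAt f f' x) (h0 : f x = 0) :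
    HasFDerivAt (fun y => C y (f y)) ((C x).comp f') x := by
  rw [hasFDerivAt_iff_isLittleO]
  have h1 : (fun y => C y (f y - f x - f' (y - x))) =o[𝓝 x] fun y => y - x := by
    have h2 : (fun y => C y (f y - f x - f' (y - x))) =O[𝓝 x] fun y => f y - f x - f' (y - x) := by
      obtain ⟨c, hc⟩ := (hC.tendsto.isBigO_one ℝ).bound
      refine IsBigO.of_bound c ?_
      filter_upwards [hc] with y hy
      refine (ContinuousLinearMap.le_opNorm _ _).trans (mul_le_mul_of_nonneg_right ?_
        (norm_nonneg _))
      simpa using hy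
    exact h2.trans_isLittleO (hasFDerivAt_iff_isLittleO.1 hf)
  have h3 : (fun y => (C y - C x) (f' (y - x))) =o[𝓝 x] fun y => y - x := by
    have h4 : (fun y => (C y - C x) (f' (y - x))) =O[𝓝 x] fun y => ‖C y - C x‖ * ‖y - x‖ := by
      refine IsBigO.of_bound ‖f'‖ (Eventually.of_forall fun y => ?_)
      refine (ContinuousLinearMap.le_opNorm _ _).trans ?_
      have := mul_le_mul_of_nonneg_left (f'.le_opNorm (y - x)) (norm_nonneg (C y - C x))
      rw [norm_mul, norm_norm, norm_norm]
      linarith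
    have h5 : (fun y => ‖C y - C x‖) =o[𝓝 x] fun _ => (1 : ℝ) := by
      rw [isLittleO_one_iff]
      have := (hC.tendsto.sub_const (C x)).norm
      simpa using this
    have h6 := h5.mul_isBigO (isBigO_refl (fun y => ‖y - x‖) (𝓝 x))
    simp only [one_mul] at h6
    exact (h4.trans_isLittleO h6).of_norm_right
  refine (h1.add h3).congr_left fun y => ?_
  simp [h0]

end Implicit

/-! ### Lyapunov–Schmidt reduction. -/

section Reduction

variable {A B : Type u} [NormedAddCommGroup A] [NormedSpace ℝ A] [CompleteSpace A]
  [NormedAddCommGroup B] [NormedSpace ℝ B] [CompleteSpace B] {k : ℕ}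

/-- A branch of zeros of `f(α, ε) = ε^k ψ(α) + o(ε^k)` bifurcates from a simple zero of `ψ`. -/
theorem ContDiffAt.exists_zero_branch {f : A × ℝ → A} {a : A}
    (hf : ContDiffAt ℝ ((k + 1 : ℕ) : WithTop ℕ∞) f (a, 0)) {ψ : A → A} (h0 : ψ a = 0)
    {e : A ≃L[ℝ] A} (he : HasFDerivAt ψ (e : A →L[ℝ] A) a)
    (h : ∀ᶠ α in 𝓝 a, (fun ε : ℝ => f (α, ε) - ε ^ k • ψ α) =o[𝓝 0] fun ε : ℝ => ε ^ k) :
    ∃ γ : ℝ → A, γ 0 = a ∧ ContDiffAt ℝ 1 γ 0 ∧ ∀ᶠ ε in 𝓝 0, f (γ ε, ε) = 0 := by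
  obtain ⟨c, ρ, hc, hρ, hρ0, hce⟩ := ContDiffAt.exists_partial_expansion k hf
  -- Uniqueness of coefficients, at every α near a, shows that f is divisible by ε^k.
  have hcoeff : ∀ᶠ α in 𝓝 a, (∀ i < k, c i α = 0) ∧ c k α = ψ α := by
    filter_upwards [h, hce.eventually_nhds_prodMk, (hρ.eventually (by simp)).nhds_prodMk_left]
      with α h1 h2 h3
    have h4 := isLittleO_of_partial_expansion h3.continuousAt (hρ0 α) h2
    have h5 : (fun ε : ℝ => ∑ i ∈ Finset.range (k + 1), ε ^ i • (c i α - if i = k then ψ α else 0))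
        =o[𝓝 0] fun ε : ℝ => ε ^ k := by
      refine (h1.sub h4).congr_left fun ε => ?_
      simp only [smul_sub, Finset.sum_sub_distrib, smul_ite, smul_zero, Finset.sum_ite_eq',
        Finset.mem_range, Nat.lt_succ_self, if_true]
      abel
    have h6 := coeff_eq_zero_of_isLittleO k (h5.mono nhdsWithin_le_nhds)
    refine ⟨fun i hi => ?_, ?_⟩
    · have := h6 i hi.le
      rwa [if_neg hi.ne, sub_zero] at this
    · have := h6 k le_rfl
      rwa [if_pos rfl, sub_eq_zero] at this
  -- The quotient f / ε^k, extended to ε = 0 by ψ. It is C^1 because f is C^{k+1}.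
  let G : ℝ × A → A := fun p => c k p.2 + ρ (p.2, p.1)
  have hck : ContDiffAt ℝ 1 (c k) a := by
    have := hc k le_rfl
    rwa [Nat.add_sub_cancel_left] at this
  have hG : ContDiffAt ℝ 1 G (0, a) := by
    have h1 : ContDiffAt ℝ 1 (fun p : ℝ × A => c k p.2) (0, a) :=
      ContDiffAt.comp (0, a) (f := Prod.snd) hck contDiffAt_snd
    have h2 : ContDiffAt ℝ 1 (fun p : ℝ × A => ρ (p.2, p.1)) (0, a) :=
      ContDiffAt.comp (0, a) (f := fun p : ℝ × A => (p.2, p.1)) hρ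
        (contDiffAt_snd.prodMk contDiffAt_fst)
    exact h1.add h2
  have hG0 : ∀ᶠ α in 𝓝 a, G (0, α) = ψ α := by
    filter_upwards [hcoeff] with α hα
    simp [G, hρ0, hα.2]
  obtain ⟨γ, hγ0, hγ, hγe, -⟩ := hG.exists_implicit one_ne_zero
    (by rw [hG0.self_of_nhds, h0]) (he.congr_of_eventuallyEq hG0)
  refine ⟨γ, hγ0, hγ, ?_⟩
  have hlim : Tendsto (fun ε => (γ ε, ε)) (𝓝 0) (𝓝 (a, 0)) := by
    have h1 := hγ.continuousAt.tendsto
    rw [hγ0] at h1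
    exact h1.prodMk_nhds tendsto_id
  have hlim' : Tendsto γ (𝓝 0) (𝓝 a) := by
    have h1 := hγ.continuousAt.tendsto
    rwa [hγ0] at h1
  filter_upwards [hγe, hlim.eventually hce, hlim'.eventually hcoeff] with ε h1 h2 h3
  rw [h2, Finset.sum_range_succ, Finset.sum_eq_zero fun i hi => by
    rw [h3.1 i (Finset.mem_range.1 hi), smul_zero], zero_add, ← smul_add]
  exact (congrArg _ h1).trans (smul_zero _)

/-- Lyapunov–Schmidt reduction: zeros of `h(·, ε)` that bifurcate from the graph of `β`, along
which `h(·, 0)` vanishes. The curves `b α` are such that `h((α, b α ε), ε)` is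
`ε^k M_α (F α, 0) + o(ε^k)`. -/
theorem ContDiffAt.exists_lyapunovSchmidt (hk : 0 < k) {h : (A × B) × ℝ → A × B} {a : A}
    {β : A → B} (hh : ContDiffAt ℝ ((k + 1 : ℕ) : WithTop ℕ∞) h ((a, β a), 0))
    (hβ : ContinuousAt β a) (h0 : h ((a, β a), 0) = 0)
    {M : A → (A × B) →L[ℝ] (A × B)} (hM : ContinuousAt M a) {e₀ : (A × B) ≃L[ℝ] (A × B)}
    (he₀ : (e₀ : (A × B) →L[ℝ] (A × B)) = M a) {e₂ : B ≃L[ℝ] B}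
    (he₂ : HasFDerivAt (fun b => (e₀.symm (h ((a, b), 0))).2) (e₂ : B →L[ℝ] B) (β a))
    {b : A → ℝ → B} (hb : ∀ᶠ α in 𝓝 a, Tendsto (b α) (𝓝 0) (𝓝 (β α)))
    {F : A → A} (hF0 : F a = 0) {e : A ≃L[ℝ] A} (he : HasFDerivAt F (e : A →L[ℝ] A) a)
    (hexp : ∀ᶠ α in 𝓝 a, (fun ε : ℝ => h ((α, b α ε), ε) - ε ^ k • M α (F α, 0)) =o[𝓝 0]
      fun ε : ℝ => ε ^ k) :
    ∃ z : ℝ → A × B, z 0 = (a, β a) ∧ ContDiffAt ℝ 1 z 0 ∧ ∀ᶠ ε in 𝓝 0, h (z ε, ε) = 0 := by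
  -- The constant inverse of M at `a` is used in place of a variable one, so that H stays C^{k+1}; M
  -- itself is only continuous at `a`.
  let H : (A × B) × ℝ → A × B := fun p => e₀.symm (h p)
  have hH : ContDiffAt ℝ ((k + 1 : ℕ) : WithTop ℕ∞) H ((a, β a), 0) :=
    hh.continuousLinearMap_comp (e₀.symm : (A × B) →L[ℝ] (A × B))
  -- The extra parameter w prescribes the value of the second component; w = 0 is the equation to be
  -- solved, other values are attained on the approximate curves.
  let Φ : ((A × ℝ) × B) × B → B := fun q => (H ((q.1.1.1, q.2), q.1.1.2)).2 - q.1.2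
  have hΦ : ContDiffAt ℝ ((k + 1 : ℕ) : WithTop ℕ∞) Φ (((a, 0), 0), β a) := by
    have h1 : ContDiffAt ℝ ((k + 1 : ℕ) : WithTop ℕ∞)
        (fun q : ((A × ℝ) × B) × B => H ((q.1.1.1, q.2), q.1.1.2)) (((a, 0), 0), β a) :=
      ContDiffAt.comp (((a, 0), 0), β a)
        (f := fun q : ((A × ℝ) × B) × B => ((q.1.1.1, q.2), q.1.1.2)) hH (by fun_prop)
    exact h1.snd.sub (by fun_prop)
  have hΦ0 : Φ (((a, 0), 0), β a) = 0 := by simp [Φ, H, h0]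
  obtain ⟨Bf, hBf0, hBf, hBfe, hBfu⟩ := hΦ.exists_implicit (by simp) hΦ0 (e := e₂)
    (he₂.sub_const 0)
  let Θ : (A × ℝ) × B → A := fun p => (H ((p.1.1, Bf p), p.1.2)).1
  have hΘ : ContDiffAt ℝ ((k + 1 : ℕ) : WithTop ℕ∞) Θ ((a, 0), 0) := by
    have h1 : ContDiffAt ℝ ((k + 1 : ℕ) : WithTop ℕ∞)
        (fun p : (A × ℝ) × B => ((p.1.1, Bf p), p.1.2)) ((a, 0), 0) :=
      (contDiffAt_fst.fst.prodMk hBf).prodMk contDiffAt_fst.snd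
    have h2 : ContDiffAt ℝ ((k + 1 : ℕ) : WithTop ℕ∞) H
        ((fun p : (A × ℝ) × B => ((p.1.1, Bf p), p.1.2)) ((a, 0), 0)) := by
      simp only [hBf0]
      exact hH
    exact (ContDiffAt.comp ((a, (0 : ℝ)), (0 : B)) h2 h1).fst
  let N : A → A →L[ℝ] (A × B) := fun α =>
    ((e₀.symm : (A × B) →L[ℝ] (A × B)).comp (M α)).comp (ContinuousLinearMap.inl ℝ A B)
  -- The operator that the passage from the approximate curve to w = 0 produces: the first component
  -- of N minus the correction ∂_wΘ applied to the second.
  let C : A → A →L[ℝ] A := fun α => (ContinuousLinearMap.fst ℝ A B).comp (N α) -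
    ((fderiv ℝ Θ ((α, 0), 0)).comp (ContinuousLinearMap.inr ℝ (A × ℝ) B)).comp
      ((ContinuousLinearMap.snd ℝ A B).comp (N α))
  have hC : ContinuousAt C a := by
    have h1 : ContinuousAt N a :=
      (continuousAt_const.clm_comp hM).clm_comp continuousAt_const
    have h2 : ContinuousAt (fun α : A => fderiv ℝ Θ ((α, 0), 0)) a := by
      have h3 : ContinuousAt (fderiv ℝ Θ) ((a, 0), 0) :=
        (hΘ.fderiv_right (m := (k : WithTop ℕ∞)) (by norm_cast)).continuousAt
      exact ContinuousAt.comp (f := fun α : A => ((α, (0 : ℝ)), (0 : B))) h3 (by fun_prop)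
    exact (continuousAt_const.clm_comp h1).sub
      ((h2.clm_comp continuousAt_const).clm_comp (continuousAt_const.clm_comp h1))
  have hNa : ∀ v, N a v = (v, 0) := fun v => by
    simp [N, ← he₀]
  have hCa : (C a).comp (e : A →L[ℝ] A) = e := by
    ext v
    simp only [C, hNa, ContinuousLinearMap.comp_apply, sub_apply, ContinuousLinearMap.coe_fst',
      ContinuousLinearMap.coe_snd', map_zero, sub_zero]
  have hψ : HasFDerivAt (fun α => C α (F α)) (e : A →L[ℝ] A) a := by
    have h1 := he.clm_apply_of_eq_zero hC hF0
    rwa [hCa] at h1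
  have hfs : ContDiffAt ℝ ((k + 1 : ℕ) : WithTop ℕ∞) (fun p : A × ℝ => Θ (p, 0)) (a, 0) :=
    ContDiffAt.comp (a, (0 : ℝ)) (f := fun p : A × ℝ => (p, (0 : B))) hΘ (by fun_prop)
  have hred : ∀ᶠ α in 𝓝 a, (fun ε : ℝ => Θ ((α, ε), 0) - ε ^ k • C α (F α)) =o[𝓝 0]
      fun ε : ℝ => ε ^ k := by
    have hstrict : ∀ᶠ α in 𝓝 a, ContDiffAt ℝ ((k + 1 : ℕ) : WithTop ℕ∞) Θ ((α, 0), 0) :=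
      (hΘ.eventually (by simp)).nhds_prodMk_left.nhds_prodMk_left
    have huniq : ∀ᶠ α in 𝓝 a, ∀ᶠ q in 𝓝 ((((α, (0 : ℝ)), (0 : B)), β α)),
        Φ q = 0 → Bf q.1 = q.2 := by
      have h1 : Tendsto (fun α => (((α, (0 : ℝ)), (0 : B)), β α)) (𝓝 a)
          (𝓝 (((a, 0), 0), β a)) :=
        ((tendsto_id.prodMk_nhds tendsto_const_nhds).prodMk_nhds tendsto_const_nhds).prodMk_nhds
          hβ.tendsto
      exact h1.eventually hBfu.eventually_nhds
    filter_upwards [hb, hexp, hstrict, huniq] with α h1 h2 h3 h4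
    let w : ℝ → A × B := fun ε => H ((α, b α ε), ε)
    have hw : (fun ε => w ε - ε ^ k • N α (F α)) =o[𝓝 0] fun ε : ℝ => ε ^ k := by
      refine (((e₀.symm : (A × B) →L[ℝ] (A × B)).isBigO_comp _ _).trans_isLittleO h2).congr_left
        fun ε => ?_
      simp [w, H, N]
    have hk0 : Tendsto (fun ε : ℝ => ε ^ k) (𝓝 0) (𝓝 0) := by
      have := (continuous_pow k : Continuous fun ε : ℝ => ε ^ k).tendsto 0
      rwa [zero_pow hk.ne'] at this
    have hwO : w =O[𝓝 0] fun ε : ℝ => ε ^ k := by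
      have h5 : (fun ε : ℝ => ε ^ k • N α (F α)) =O[𝓝 0] fun ε : ℝ => ε ^ k := by
        refine IsBigO.of_bound ‖N α (F α)‖ (Eventually.of_forall fun ε => ?_)
        rw [norm_smul, mul_comm]
      exact (hw.isBigO.add h5).congr_left fun ε => by simp
    have hw2 : (fun ε => (w ε).2) =O[𝓝 0] fun ε : ℝ => ε ^ k :=
      (IsBigO.of_bound 1 (Eventually.of_forall fun ε => by
        rw [one_mul]; exact norm_snd_le (w ε))).trans hwO
    have hw0 : Tendsto (fun ε => (w ε).2) (𝓝 0) (𝓝 0) := hw2.trans_tendsto hk0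
    have hx : Tendsto (fun ε : ℝ => ((α, ε), (w ε).2)) (𝓝 0) (𝓝 ((α, 0), 0)) :=
      (tendsto_const_nhds.prodMk_nhds tendsto_id).prodMk_nhds hw0
    have hy : Tendsto (fun ε : ℝ => ((α, ε), (0 : B))) (𝓝 0) (𝓝 ((α, 0), 0)) :=
      (tendsto_const_nhds.prodMk_nhds tendsto_id).prodMk_nhds tendsto_const_nhds
    -- Local uniqueness: `b α ε` solves the second equation with right side (w ε).2.
    have hΘw : ∀ᶠ ε in 𝓝 0, Θ ((α, ε), (w ε).2) = (w ε).1 := by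
      filter_upwards [(hx.prodMk_nhds h1).eventually h4] with ε h5
      have h6 : Bf ((α, ε), (w ε).2) = b α ε := h5 (sub_self _)
      simp only [Θ, h6, w]
    -- Both points move with ε, so the strict derivative at ((α, 0), 0) is needed to compare Θ at (w
    -- ε).2 and at 0.
    have hst := (h3.hasStrictFDerivAt (by simp)).isLittleO.comp_tendsto (hx.prodMk_nhds hy)
    have hst' : (fun ε => Θ ((α, ε), (w ε).2) - Θ ((α, ε), 0) -
        fderiv ℝ Θ ((α, 0), 0) (0, (w ε).2)) =o[𝓝 0] fun ε : ℝ => ε ^ k := by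
      have h5 : (fun ε : ℝ => (((α, ε), (w ε).2) : (A × ℝ) × B) - ((α, ε), 0)) =O[𝓝 0]
          fun ε : ℝ => ε ^ k := by
        refine (IsBigO.of_bound 1 (Eventually.of_forall fun ε => ?_)).trans hw2
        simp [Prod.norm_def]
      refine (hst.trans_isBigO h5).congr_left fun ε => ?_
      change Θ _ - Θ _ - fderiv ℝ Θ _ ((((α, ε), (w ε).2) : (A × ℝ) × B) - ((α, ε), 0)) = _
      rw [Prod.mk_sub_mk, sub_self, sub_zero]
    have hw1 : (fun ε => (w ε).1 - ε ^ k • (N α (F α)).1) =o[𝓝 0] fun ε : ℝ => ε ^ k :=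
      ((ContinuousLinearMap.fst ℝ A B).isBigO_comp _ _).trans_isLittleO hw
    let L : A × B →L[ℝ] A := ((fderiv ℝ Θ ((α, 0), 0)).comp
      (ContinuousLinearMap.inr ℝ (A × ℝ) B)).comp (ContinuousLinearMap.snd ℝ A B)
    have hw3 : (fun ε => L (w ε - ε ^ k • N α (F α))) =o[𝓝 0] fun ε : ℝ => ε ^ k :=
      (L.isBigO_comp _ _).trans_isLittleO hw
    refine ((hw1.sub hst').sub hw3).congr' ?_ EventuallyEq.rfl
    filter_upwards [hΘw] with ε h5
    simp only [h5, L, C, map_sub, map_smul, ContinuousLinearMap.comp_apply,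
      sub_apply, ContinuousLinearMap.inr_apply, ContinuousLinearMap.coe_fst',
      ContinuousLinearMap.coe_snd', smul_sub]
    abel
  obtain ⟨γ, hγ0, hγ, hγe⟩ := hfs.exists_zero_branch (by simp [hF0]) hψ hred
  have hg : ContDiffAt ℝ 1 (fun ε => ((γ ε, ε), (0 : B))) 0 :=
    (hγ.prodMk contDiffAt_id).prodMk contDiffAt_const
  have hlim : Tendsto (fun ε => ((γ ε, ε), (0 : B))) (𝓝 0) (𝓝 ((a, 0), 0)) := by
    have := hg.continuousAt.tendsto
    rwa [hγ0] at this
  have hBg : ContDiffAt ℝ 1 (fun ε => Bf ((γ ε, ε), 0)) 0 := by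
    have h1 : ContDiffAt ℝ 1 Bf ((γ 0, 0), 0) := by
      rw [hγ0]
      exact hBf.of_le (by exact_mod_cast Nat.succ_le_succ (Nat.zero_le k))
    exact ContDiffAt.comp (0 : ℝ) (f := fun ε => ((γ ε, ε), (0 : B))) h1 hg
  refine ⟨fun ε => (γ ε, Bf ((γ ε, ε), 0)), by simp only [hγ0, hBf0], hγ.prodMk hBg, ?_⟩
  filter_upwards [hγe, hlim.eventually hBfe] with ε h1 h2
  have h3 : H ((γ ε, Bf ((γ ε, ε), 0)), ε) = 0 := Prod.ext h1 (sub_eq_zero.1 h2)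
  exact e₀.symm.map_eq_zero_iff.1 h3

end Reduction

/-! ### Periodic extension of solutions on [0, T]. -/

namespace PiecewiseSystem

section Periodic

variable {E : Type*} [NormedAddCommGroup E] [NormedSpace ℝ E] {n k : ℕ}
  {S : PiecewiseSystem E n k}

theorem field_add_int_mul {ε : ℝ} (hε : |ε| < S.ε₀) (j : Fin n) {x : E} (hx : x ∈ S.D) (q : ℤ)
    (s : ℝ) : S.field ε j (s + q * S.T) x = S.field ε j s x := by
  have h : Function.Periodic (fun s => S.field ε j s x) S.T := fun s => by
    simp only [field]
    rw [S.periodic_R j s x hx ε (abs_lt.1 hε)]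
    congr 1
    refine Finset.sum_congr rfl fun i hi => ?_
    rw [S.periodic_F i (Nat.lt_succ_iff.1 (Finset.mem_range.1 hi)) j s x hx]
  exact h.int_mul q s

variable [CompleteSpace E]

/-- A solution on `[0, T]` that returns to its initial value extends periodically. -/
theorem IsFlow.exists_isPeriodicSolution {z : E} {ε : ℝ} {u : C(Icc (0 : ℝ) S.T, E)}
    (h : S.IsFlow z ε u) (hT : u S.lastTime = z) :
    ∃ x : ℝ → E, x 0 = z ∧ S.IsPeriodicSolution (S.field ε) x := by
  let y := IccExtend S.T_nonneg u
  have hy0 : y 0 = z := by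
    simp only [y]
    rw [IccExtend_of_mem _ _ (left_mem_Icc.2 S.T_nonneg)]
    exact h.apply_zero
  have hyT : y S.T = z := by
    simp only [y]
    rw [IccExtend_of_mem _ _ (right_mem_Icc.2 S.T_nonneg)]
    exact hT
  let x : ℝ → E := fun s => y (toIcoMod S.T_pos 0 s)
  -- The formula includes the right end of the period, where it holds because y(T) = y(0); the
  -- closed last strip requires this.
  have hxy : ∀ q : ℤ, ∀ s, s - q * S.T ∈ Icc 0 S.T → x s = y (s - q * S.T) := by
    intro q s hs
    have h1 : toIcoMod S.T_pos 0 s = toIcoMod S.T_pos 0 (s - q * S.T) := by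
      rw [← zsmul_eq_mul, toIcoMod_sub_zsmul]
    simp only [x, h1]
    rcases hs.2.eq_or_lt with h2 | h2
    · have h3 : toIcoMod S.T_pos 0 S.T = 0 := by
        have := toIcoMod_apply_right S.T_pos 0
        rwa [zero_add] at this
      rw [h2, hyT, h3, hy0]
    · rw [(toIcoMod_eq_self S.T_pos).2 ⟨hs.1, by rwa [zero_add]⟩]
  refine ⟨x, ?_, fun s => by simp [x], fun q j s hs => ?_⟩
  · rw [hxy 0 0 (by simpa using S.T_nonneg)]
    simpa using hy0
  have hmaps : MapsTo (fun s => s - q * S.T) (S.strip q j) (S.strip 0 j) := fun r hr => by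
    rw [strip_zero]
    exact ⟨by linarith [hr.1], by linarith [hr.2]⟩
  have hr := hmaps hs
  have hx : ∀ r ∈ S.strip q j, x r = y (r - q * S.T) := fun r hr =>
    hxy q r (S.strip_subset j (hmaps hr))
  obtain ⟨hD, hd⟩ := h.isSolutionOnPeriod j _ hr
  rw [hx s hs]
  refine ⟨hD, ?_⟩
  have h1 := hd.scomp s (hasDerivWithinAt_id s (S.strip q j) |>.sub_const (q * S.T)) hmaps
  rw [one_smul, ← field_add_int_mul h.lt j hD q, sub_add_cancel] at h1
  exact h1.congr hx (hx s hs)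

end Periodic

theorem exists_isFlow_of_isPeriodicSolution {E : Type*} [NormedAddCommGroup E] [NormedSpace ℝ E]
    [CompleteSpace E] {n k : ℕ} {S : PiecewiseSystem E n k} {y : ℝ → E}
    (hy : S.IsPeriodicSolution (S.F 0) y) :
    ∃ u : C(Icc (0 : ℝ) S.T, E), S.IsFlow (y 0) 0 u ∧ u S.lastTime = y 0 := by
  have hF : S.field 0 = S.F 0 := by
    funext j s x
    exact field_zero j s x
  obtain ⟨u, hu, huy⟩ := isFlow_of_isSolutionOnPeriod (S := S) (ε := 0) (by simpa using S.ε₀_pos)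
    (hF ▸ hy.2 0)
  refine ⟨u, hu, ?_⟩
  rw [huy]
  have := hy.1 0
  rwa [zero_add] at this

end PiecewiseSystem

/-! ### Determinants, and the conclusion. -/

theorem ContinuousLinearMap.exists_equiv_of_det_ne_zero {X : Type*} [NormedAddCommGroup X]
    [NormedSpace ℝ X] [FiniteDimensional ℝ X] {f : X →L[ℝ] X} (h : f.det ≠ 0) :
    ∃ e : X ≃L[ℝ] X, (e : X →L[ℝ] X) = f :=
  ⟨f.toContinuousLinearEquivOfDetNeZero h, by ext; rfl⟩

/-- Without differentiability `fderiv` is 0, whose determinant vanishes except in dimension 0, where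
every map is differentiable. The simple zero thus carries its own differentiability. -/
theorem differentiableAt_of_det_fderiv_ne_zero {X : Type*} [NormedAddCommGroup X]
    [NormedSpace ℝ X] [FiniteDimensional ℝ X] {f : X → X} {x : X} (h : (fderiv ℝ f x).det ≠ 0) :
    DifferentiableAt ℝ f x := by
  by_contra hd
  rw [fderiv_zero_of_not_differentiableAt hd] at h
  have h1 : Module.finrank ℝ X = 0 := by
    by_contra h2
    refine h ?_
    change LinearMap.det (0 : X →ₗ[ℝ] X) = 0
    rw [LinearMap.det_zero, zero_pow h2]
  have : Subsingleton X := Module.finrank_zero_iff.1 h1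
  exact hd (hasFDerivAt_of_subsingleton f x).differentiableAt

theorem mainTheorem1 {d m n k : ℕ} (hdm : d < m) (hk : 1 ≤ k)
    (S : PiecewiseSystem (EuclideanSpace ℝ (Fin d) × EuclideanSpace ℝ (Fin (m - d))) n k)
    (V : Set (EuclideanSpace ℝ (Fin d))) (hV : IsOpen V)
    (β : EuclideanSpace ℝ (Fin d) → EuclideanSpace ℝ (Fin (m - d)))
    (hβ : ContDiffOn ℝ ((k + 1 : ℕ) : WithTop ℕ∞) β (closure V))
    (hZD : ∀ α ∈ closure V, (α, β α) ∈ S.D)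
    (hZ : ∀ α ∈ closure V, ∃ y : ℝ → EuclideanSpace ℝ (Fin d) × EuclideanSpace ℝ (Fin (m - d)),
      y 0 = (α, β α) ∧ S.IsPeriodicSolution (S.F 0) y)
    (hΔ : ∀ α ∈ closure V, (S.Delta β α).det ≠ 0)
    (hf : ∀ i, 1 ≤ i → i < k → ∀ α ∈ closure V, S.bifurcation β i α = 0)
    (αs : EuclideanSpace ℝ (Fin d)) (hαs : αs ∈ V)
    (hzero : S.bifurcation β k αs = 0)
    (hsimple : (fderiv ℝ (S.bifurcation β k) αs).det ≠ 0) :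
    ∃ x : ℝ → ℝ → EuclideanSpace ℝ (Fin d) × EuclideanSpace ℝ (Fin (m - d)),
      (∃ ε₁ : ℝ, 0 < ε₁ ∧ ε₁ ≤ S.ε₀ ∧
        ∀ ε : ℝ, |ε| < ε₁ → S.IsPeriodicSolution (S.field ε) (fun s => x s ε)) ∧
      (fun ε : ℝ => x 0 ε - (αs, β αs)) =O[𝓝 0] (fun ε : ℝ => ε) := by
  have hVc : ∀ᶠ α in 𝓝 αs, α ∈ closure V :=
    mem_of_superset (hV.mem_nhds hαs) subset_closure
  have hβs : ContinuousAt β αs := hβ.continuousOn.continuousAt hVc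
  have hbase : ∀ α ∈ closure V, ∃ u : C(Icc (0 : ℝ) S.T, _), S.IsFlow (α, β α) 0 u ∧
      u S.lastTime = (α, β α) := by
    intro α hα
    obtain ⟨y, hy0, hy⟩ := hZ α hα
    rw [← hy0]
    exact S.exists_isFlow_of_isPeriodicSolution hy
  obtain ⟨u₀, h₀, -⟩ := hbase αs hVc.self_of_nhds
  obtain ⟨X, hX, hXe, hY, hg, hg0, ρ, hρ, hρ0, hexp⟩ := h₀.exists_displacement_expansion hk
  have hgraph : Tendsto (fun α => (α, β α)) (𝓝 αs) (𝓝 (αs, β αs)) :=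
    tendsto_id.prodMk_nhds hβs
  have hflow := hgraph.eventually hXe.nhds_prodMk_left
  -- By uniqueness the smooth family X passes through the given periodic solutions.
  have hfix : ∀ᶠ α in 𝓝 αs, X ((α, β α), 0) S.lastTime = (α, β α) := by
    filter_upwards [hVc, hflow] with α hα h1
    obtain ⟨u, hu, huT⟩ := hbase α hα
    rw [← h1.eq_unperturbed, hu.eq_unperturbed, huT]
  have havzero : ∀ᶠ α in 𝓝 αs, S.averaged 0 (α, β α) = 0 := by
    filter_upwards [hflow, hfix] with α h1 h2
    have h3 : S.unperturbed (α, β α) S.T = (α, β α) := (h1.eq_unperturbed S.lastTime).trans h2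
    rw [PiecewiseSystem.averaged, if_pos rfl, h3, sub_self, map_zero]
  have hDav : ∀ᶠ α in 𝓝 αs, HasFDerivAt (S.averaged 0) (ContinuousLinearMap.id ℝ _ -
      (S.fundamental (α, β α) S.T).inverse) (α, β α) := by
    filter_upwards [hgraph.eventually hg0, hfix] with α h1 h2 using h1 h2
  have hDelta : ∀ᶠ α in 𝓝 αs,
      HasFDerivAt (fun b => (S.averaged 0 (α, b)).2) (S.Delta β α) (β α) := by
    filter_upwards [hDav] with α h1
    exact (h1.comp (β α) (hasFDerivAt_prodMk_right α (β α))).snd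
  have hgs : ∀ᶠ z in 𝓝 (αs, β αs), ∀ i ∈ Finset.range (k + 1),
      ContDiffAt ℝ ((k - i : ℕ) : WithTop ℕ∞) (S.averaged i) z :=
    (eventually_all_finset _).2 fun i hi =>
      (hg i (Nat.lt_succ_iff.1 (Finset.mem_range.1 hi))).eventually (by simp)
  let b : EuclideanSpace ℝ (Fin d) → ℝ → EuclideanSpace ℝ (Fin (m - d)) := fun α ε =>
    β α + weightedCurve (fun j : Fin k => gammaFun S.averaged (S.Delta β) β (j + 1) α) ε
  have hb : ∀ α, Tendsto (b α) (𝓝 0) (𝓝 (β α)) := fun α => tendsto_add_weightedCurve _ _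
  have hcurve : ∀ᶠ α in 𝓝 αs, (fun ε : ℝ => PiecewiseSystem.displacement X ((α, b α ε), ε) -
      ε ^ k • S.fundamental (α, β α) S.T (S.bifurcation β k α, 0)) =o[𝓝 0]
      fun ε : ℝ => ε ^ k := by
    filter_upwards [hVc, havzero, hDelta, hgraph.eventually hgs, hgraph.eventually hρ,
      hgraph.eventually (hY.eventually (by simp)),
      hgraph.eventually hexp.eventually_nhds_prodMk] with α hα h1 h2 h3 h4 h5 h6
    obtain ⟨e, he⟩ := ContinuousLinearMap.exists_equiv_of_det_ne_zero (hΔ α hα)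
    have h7 := sum_isLittleO_bifurcationFun
      (fun i hi => h3 i (Finset.mem_range.2 (Nat.lt_succ_iff.2 hi))) h1 he h2
      (fun i hi hik => hf i hi hik α hα)
    have hz : Tendsto (fun ε => (α, b α ε)) (𝓝 0) (𝓝 (α, β α)) :=
      tendsto_const_nhds.prodMk_nhds (hb α)
    have hzε : Tendsto (fun ε => ((α, b α ε), ε)) (𝓝 0) (𝓝 ((α, β α), 0)) :=
      hz.prodMk_nhds tendsto_id
    have hYz : Tendsto (fun ε => S.fundamental (α, b α ε) S.T) (𝓝 0)
        (𝓝 (S.fundamental (α, β α) S.T)) := h5.continuousAt.tendsto.comp hz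
    -- The matrices Y(T, ·) along the curve are bounded, so they preserve o(ε^k).
    have e1 : (fun ε : ℝ => S.fundamental (α, b α ε) S.T
        (∑ i ∈ Finset.range (k + 1), ε ^ i • S.averaged i (α, b α ε) -
          ε ^ k • (S.bifurcation β k α, 0))) =o[𝓝 0] fun ε : ℝ => ε ^ k := by
      obtain ⟨c, hc⟩ := (hYz.isBigO_one ℝ).bound
      refine (IsBigO.of_bound c ?_).trans_isLittleO h7
      filter_upwards [hc] with ε hε
      refine (ContinuousLinearMap.le_opNorm _ _).trans (mul_le_mul_of_nonneg_right ?_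
        (norm_nonneg _))
      simpa using hε
    -- Freezing Y(T, ·) at z_α costs o(ε^k), since the term it acts on has the factor ε^k already.
    have e2 : (fun ε : ℝ => ε ^ k • (S.fundamental (α, b α ε) S.T (S.bifurcation β k α, 0) -
        S.fundamental (α, β α) S.T (S.bifurcation β k α, 0) + ρ ((α, b α ε), ε))) =o[𝓝 0]
        fun ε : ℝ => ε ^ k := by
      have h8 : Tendsto (fun ε : ℝ => S.fundamental (α, b α ε) S.T (S.bifurcation β k α, 0) -
          S.fundamental (α, β α) S.T (S.bifurcation β k α, 0) + ρ ((α, b α ε), ε)) (𝓝 0)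
          (𝓝 0) := by
        have h10 : Tendsto (fun ε => S.fundamental (α, b α ε) S.T (S.bifurcation β k α, 0)) (𝓝 0)
            (𝓝 (S.fundamental (α, β α) S.T (S.bifurcation β k α, 0))) :=
          ((ContinuousLinearMap.apply ℝ _ (S.bifurcation β k α, 0)).continuous.tendsto _).comp hYz
        have h9 := (h10.sub_const
          (S.fundamental (α, β α) S.T (S.bifurcation β k α, 0))).add (h4.tendsto.comp hzε)
        rwa [sub_self, hρ0, zero_add] at h9
      simpa using (isBigO_refl (fun ε : ℝ => ε ^ k) (𝓝 0)).smul_isLittleO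
        ((isLittleO_one_iff ℝ).2 h8)
    refine (e1.add e2).congr' ?_ EventuallyEq.rfl
    filter_upwards [hzε.eventually h6] with ε hε
    rw [hε, map_sub, map_smul, smul_add, smul_sub]
    abel
  obtain ⟨e₀, he₀⟩ := h₀.fundamental_inverse
  obtain ⟨e₂, he₂⟩ := ContinuousLinearMap.exists_equiv_of_det_ne_zero
    (hΔ αs hVc.self_of_nhds)
  obtain ⟨e, he⟩ := ContinuousLinearMap.exists_equiv_of_det_ne_zero hsimple
  have hdisp : ContDiffAt ℝ ((k + 1 : ℕ) : WithTop ℕ∞) (PiecewiseSystem.displacement X)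
      ((αs, β αs), 0) := by
    have h1 := hX.continuousLinearMap_comp (ContinuousMap.evalCLM ℝ S.lastTime)
    exact h1.sub contDiffAt_fst
  have hdisp0 : PiecewiseSystem.displacement X ((αs, β αs), 0) = 0 :=
    sub_eq_zero.2 hfix.self_of_nhds
  have hD₂ : HasFDerivAt (fun b => (e₀.symm (PiecewiseSystem.displacement X ((αs, b), 0))).2)
      (e₂ : _ →L[ℝ] _) (β αs) := by
    -- At ε = 0 the displacement is Y(T, z) g_0(z), and g_0 vanishes at the base point, so Y need
    -- not be differentiated. Applying the inverse of Y(T, z_{α*}) leaves Id - Y⁻¹, whose lower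
    -- right block is Δ.
    have h1 : HasFDerivAt (fun z => PiecewiseSystem.displacement X (z, 0))
        ((S.fundamental (αs, β αs) S.T).comp (ContinuousLinearMap.id ℝ _ -
          (S.fundamental (αs, β αs) S.T).inverse)) (αs, β αs) := by
      refine (HasFDerivAt.clm_apply_of_eq_zero hY.continuousAt hDav.self_of_nhds
        havzero.self_of_nhds).congr_of_eventuallyEq ?_
      filter_upwards [hexp.nhds_prodMk_left] with z hz
      rw [hz, Finset.sum_range_succ']
      simp [hρ0]
    have h2 := (e₀.symm.hasFDerivAt.comp _ h1).comp (β αs) (hasFDerivAt_prodMk_right αs (β αs))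
    refine h2.snd.congr_fderiv ?_
    rw [he₂]
    ext v : 1
    simp [PiecewiseSystem.Delta, lowerRightBlock, ← he₀]
  obtain ⟨z, hz0, hz, hze⟩ := ContDiffAt.exists_lyapunovSchmidt hk hdisp hβs hdisp0
    (M := fun α => S.fundamental (α, β α) S.T)
    (ContinuousAt.comp (f := fun α => (α, β α)) hY.continuousAt hgraph) he₀ hD₂
    (Eventually.of_forall hb) hzero
    (he ▸ (differentiableAt_of_det_fderiv_ne_zero hsimple).hasFDerivAt) hcurve
  have hzlim : Tendsto (fun ε => (z ε, ε)) (𝓝 0) (𝓝 ((αs, β αs), 0)) := by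
    have h1 := hz.continuousAt.tendsto
    rw [hz0] at h1
    exact h1.prodMk_nhds tendsto_id
  have hsol : ∀ᶠ ε in 𝓝 (0 : ℝ), ∃ x : ℝ → _, x 0 = z ε ∧
      S.IsPeriodicSolution (S.field ε) x := by
    filter_upwards [hze, hzlim.eventually hXe] with ε h1 h2
    exact h2.exists_isPeriodicSolution (sub_eq_zero.1 h1)
  obtain ⟨δ, hδ, hδx⟩ := Metric.eventually_nhds_iff.1 hsol
  choose! x hx0 hx using fun ε (hε : dist ε 0 < δ) => hδx hε
  refine ⟨fun s ε => x ε s, ⟨min δ S.ε₀, lt_min hδ S.ε₀_pos, min_le_right _ _, fun ε hε => ?_⟩, ?_⟩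
  · exact hx ε (by simpa using hε.trans_le (min_le_left _ _))
  -- Differentiability at 0 of the branch of initial values gives the O(ε) bound.
  · have h1 := (hz.differentiableAt one_ne_zero).isBigO_sub
    simp only [hz0, sub_zero] at h1
    refine h1.congr' ?_ EventuallyEq.rfl
    filter_upwards [Metric.ball_mem_nhds (0 : ℝ) hδ] with ε hε
    rw [hx0 ε hε]
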